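/- **Setting.** Let $\lambda_1,\dots,\lambda_8$ be the Gell-Mann matrices and $E_j=i\lambda_j/\sqrt2$, an orthonormal basis of $\mathfrak{su}(3)$ for $\langle X|Y\rangle=\operatorname{tr}(X^\dagger Y)$, with coordinates $x_1,\dots,x_8$. Let $\xi=\frac{i}{\sqrt6}\operatorname{diag}(2,-1,-1)$, let $\mathcal O=\{g\xi g^{-1}:g\in SU(3)\}\simeq\mathbb CP^2$, and let $Poly(\mathcal O)$ be the algebra of restrictions to $\mathcal O$ of complex polynomials on $\mathfrak{su}(3)$. Functions on $\mathcal O$ are integrated against the $SU(3)$-invariant probability measure, $\|\cdot\|_\infty$ is the supremum norm on $\mathcal O$, and $\{\cdot,\cdot\}$ is the restriction to $\mathcal O$ of the Poisson bracket $\{f,h\}=\sum_{j,k,l}c^l_{kj}\,x_l\,\partial_jf\,\partial_kh$, where $[E_k,E_j]=\sum_l c^l_{kj}E_l$. For $p\ge1$ let $\mathcal H_p$ be the unitary irreducible representation $\rho_p$ of $SU(3)$ of highest weight $(p,0)$ (the $p$-th symmetric power of $\mathbb C^3$), and write $A^g=\rho_p(g)A\rho_p(g)^{-1}$ for operators $A\in\mathcal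 B(\mathcal H_p)$ and $f^g(x)=f(g^{-1}xg)$ for functions $f$ on $\mathcal O$. A *symbol correspondence* is an injective linear map $W:\mathcal B(\mathcal H_p)\to Poly(\mathcal O)$, $A\mapsto W_A$, with $W_{A^g}=(W_A)^g$, $W_{A^\dagger}=\overline{W_A}$ and $\int_{\mathcal O}W_A=\operatorname{tr}(A)/\dim\mathcal H_p$. The (symmetric) *Berezin correspondence* is $B^p_A(g\xi g^{-1})=\operatorname{tr}(A\,\Pi^g)$, where $\Pi$ is the orthogonal projection onto the highest weight line of $\mathcal H_p$. For $0\le n\le p$ let $V_+$ be the operator on $\mathcal H_p$ by which the matrix unit $E_{13}\in\mathfrak{sl}(3)$ acts, and normalize the highest weight operator of the summand $(n,n)$ of $\mathcal B(\mathcal H_p)$ as $$\boldsymbol e_n^p=\frac1{\mu_n(p)}V_+^n,\qquad \mu_n(p)=\frac{n!}{\sqrt{(2n+2)!}}\sqrt{\frac{(p+n+2)!}{(p-n)!}} .$$ Let $X^n=v_+^n/\|v_+^n\|_{L^2(\mathcal O)}$ with $v_+=x_4+ix_5$. The $n$-th *characteristic number* of $W$ is the real number $c_n$ such that $W$ maps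 $\sqrt{\dim\mathcal H_p}\,(\boldsymbol e_n^p)^g$ to $c_n\,(X^n)^g$ for all $g\in SU(3)$. A *ray of pure-quark correspondences* is a sequence $(W^p)_{p\ge1}$ of symbol correspondences $W^p:\mathcal B(\mathcal H_p)\to Poly(\mathcal O)$. It induces the twisted products $W^p_A\star^pW^p_{A'}=W^p_{AA'}$ on the images of the $W^p$. The ray is *of Poisson type* if any $f_1,f_2\in Poly(\mathcal O)$ lie in the image of $W^p$ for all large $p$ and, as $p\to\infty$, $$\|f_1\star^pf_2-f_1f_2\|_\infty\to0,\qquad \Big\|\sqrt{\tfrac23}\,p\,\big(f_1\star^pf_2-f_2\star^pf_1\big)-i\{f_1,f_2\}\Big\|_\infty\to0 .$$ **Statement.** 1. For every $p\ge1$ the Berezin correspondence exists and is a symbol correspondence, and its characteristic numbers are $$b_n^p=\sqrt{\binom pn\Big/\binom{p+n+2}n}>0\qquad(0\le n\le p).$$ For every fixed $n$, $|b_n^p-1|=O(1/p)$ as $p\to\infty$. 2. For every ray $(W^p)_{p\ge1}$ of pure-quark correspondences, the characteristic numbers $c_n^p$ $(0\le n\le p)$ of the $W^p$ exist and are unique,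 and the ray is of Poisson type if and only if $\lim_{p\to\infty}c_n^p=1$ for every $n$. -/

import Mathlib

open Filter Topology MeasureTheory

noncomputable section

namespace QuarkSystem

/-! ### The group `SU(3)` and its normalized Haar measure -/

/-- The group `SU(3)`. -/
abbrev SU3 := Matrix.specialUnitaryGroup (Fin 3) ℂ

instance : IsTopologicalGroup SU3 where
  continuous_inv := by
    apply Continuous.subtype_mk (continuous_star.comp continuous_subtype_val)

instance : MeasurableSpace SU3 := borel SU3

instance : BorelSpace SU3 := ⟨rfl⟩

instance : CompactSpace SU3 := by
  refine isCompact_iff_compactSpace.1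
    (?_ : IsCompact (Matrix.specialUnitaryGroup (Fin 3) ℂ : Set (Matrix (Fin 3) (Fin 3) ℂ)))
  have hK : IsCompact (Set.pi Set.univ fun _ : Fin 3 =>
      Set.pi Set.univ fun _ : Fin 3 => Metric.closedBall (0 : ℂ) 1) :=
    isCompact_univ_pi fun _ => isCompact_univ_pi fun _ => isCompact_closedBall _ _
  refine IsCompact.of_isClosed_subset
    (s := (Set.pi Set.univ fun _ : Fin 3 =>
      Set.pi Set.univ fun _ : Fin 3 => Metric.closedBall (0 : ℂ) 1 :
        Set (Matrix (Fin 3) (Fin 3) ℂ))) hK ?_ ?_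
  · have h : (Matrix.specialUnitaryGroup (Fin 3) ℂ : Set (Matrix (Fin 3) (Fin 3) ℂ)) =
        {A | A * star A = 1} ∩ {A | A.det = 1} := by
      ext A
      simp [Matrix.mem_specialUnitaryGroup_iff, Matrix.mem_unitaryGroup_iff]
    have h' : IsClosed ({A | A * star A = 1} ∩ {A | A.det = 1} :
        Set (Matrix (Fin 3) (Fin 3) ℂ)) :=
      (isClosed_eq (continuous_id.mul continuous_star) continuous_const).inter
        (isClosed_eq (Continuous.matrix_det continuous_id) continuous_const)
    rw [← h] at h'
    exact h'
  · intro A hA i _ j _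
    have := entry_norm_bound_of_unitary
      (Matrix.specialUnitaryGroup_le_unitaryGroup hA) i j
    simpa using this

/-- The Haar measure of `SU(3)` of total mass `1`. -/
def haar : Measure SU3 := Measure.haarMeasure ⊤

/-! ### The adjoint orbit `𝒪 ≃ ℂP²` in the unit sphere of `su(3)` -/

/-- The Gell-Mann matrices `λ₁, …, λ₈` (indexed from `0`). -/
def gellMann : Fin 8 → Matrix (Fin 3) (Fin 3) ℂ :=
  ![!![0, 1, 0; 1, 0, 0; 0, 0, 0],
    !![0, -Complex.I, 0; Complex.I, 0, 0; 0, 0, 0],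
    !![1, 0, 0; 0, -1, 0; 0, 0, 0],
    !![0, 0, 1; 0, 0, 0; 1, 0, 0],
    !![0, 0, -Complex.I; 0, 0, 0; Complex.I, 0, 0],
    !![0, 0, 0; 0, 0, 1; 0, 1, 0],
    !![0, 0, 0; 0, 0, -Complex.I; 0, Complex.I, 0],
    (((√3)⁻¹ : ℝ) : ℂ) • !![1, 0, 0; 0, 1, 0; 0, 0, -2]]

/-- The basis `E_j = i λ_j / √2` of `su(3)`, orthonormal for `⟨X|Y⟩ = tr (X† Y)`. -/
def E (j : Fin 8) : Matrix (Fin 3) (Fin 3) ℂ :=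
  (Complex.I / ((√2 : ℝ) : ℂ)) • gellMann j

/-- The coordinate `x_j = ⟨E_j|X⟩` (it is real for `X` in `su(3)`). -/
def coord (j : Fin 8) (X : Matrix (Fin 3) (Fin 3) ℂ) : ℂ :=
  ((E j).conjTranspose * X).trace

/-- The structure constants `[E_k, E_j] = ∑ l, c^l_{kj} E_l`, as `structConst k j l`. -/
def structConst (k j l : Fin 8) : ℂ := coord l (E k * E j - E j * E k)

/-- The unit vector `ξ = √(3/2) ϖ₁ = (i/√6) diag(2,-1,-1)` in the direction of the first
fundamental weight. -/
def xi : Matrix (Fin 3) (Fin 3) ℂ :=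
  (Complex.I / ((√6 : ℝ) : ℂ)) • Matrix.diagonal ![2, -1, -1]

/-- The norm of `ϖ₁`, the first dominant weight on the ray of `ξ`: `ϖ₁ = √(2/3) ξ`. -/
def integralRadius : ℝ := √(2 / 3)

/-- The adjoint orbit `{g ξ g⁻¹ : g ∈ SU(3)}`. -/
def Orbit : Type :=
  {X : Matrix (Fin 3) (Fin 3) ℂ // ∃ g : SU3, X = g.1 * xi * g⁻¹.1}

/-- The adjoint action of `SU(3)` on the orbit. -/
def act (g : SU3) (x : Orbit) : Orbit :=
  ⟨g.1 * x.1 * g⁻¹.1, by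
    obtain ⟨h, hh⟩ := x.2
    refine ⟨g * h, ?_⟩
    rw [hh, mul_inv_rev]
    simp only [Submonoid.coe_mul, mul_assoc]⟩

/-- The point `ξ` of its orbit. -/
def base : Orbit := ⟨xi, 1, by simp⟩

/-- The invariant integral on the orbit, of total mass `1`. -/
def orbitIntegral (f : Orbit → ℂ) : ℂ := ∫ g, f (act g base) ∂haar

/-- Restriction to the orbit of a complex polynomial in the coordinates `x_1, …, x_8`. -/
def restrict : MvPolynomial (Fin 8) ℂ →ₐ[ℂ] (Orbit → ℂ) :=
  MvPolynomial.aeval fun j x => coord j x.1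

/-- The algebra `Poly(𝒪)` of restrictions to the orbit of complex polynomials on `su(3)`. -/
def PolyOrbit : Subalgebra ℂ (Orbit → ℂ) := restrict.range

/-- A polynomial on `su(3)`, seen in `Poly(𝒪)`. -/
def toPoly : MvPolynomial (Fin 8) ℂ →ₐ[ℂ] PolyOrbit := restrict.rangeRestrict

/-- The Kirillov-Kostant-Souriau Poisson bracket on `su(3)`, of bivector
`∑ c^l_{kj} x_l ∂_j ⊗ ∂_k`. The orbit is a symplectic leaf, so that the restriction of the
bracket to the orbit only depends on the restrictions of the two polynomials. -/
def bracket (F G : MvPolynomial (Fin 8) ℂ) : MvPolynomial (Fin 8) ℂ :=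
  ∑ j, ∑ k, ∑ l, MvPolynomial.C (structConst k j l) * MvPolynomial.X l *
    MvPolynomial.pderiv j F * MvPolynomial.pderiv k G

/-- The supremum norm of a (bounded) function on the orbit. -/
def supNorm (f : PolyOrbit) : ℝ := ⨆ x : Orbit, ‖f.1 x‖

/-! ### The irreducible representation of highest weight `(p,0)` -/

/-- The space of the irreducible representation `(p,0)`, realized as the `p`-th symmetric power
of `ℂ³`: homogeneous polynomials of degree `p` in the basis vectors `X 0, X 1, X 2` of `ℂ³`. -/
abbrev H (p : ℕ) := ↥(MvPolynomial.homogeneousSubmodule (Fin 3) ℂ p)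

/-- The invariant Hermitian product on `H p`: monomials are orthogonal, and
`‖X^a‖² = a!`. -/
def herm {p : ℕ} (f h : H p) : ℂ :=
  ∑ a ∈ f.1.support,
    ((∏ i, (a i).factorial : ℕ) : ℂ) * starRingEnd ℂ (f.1.coeff a) * h.1.coeff a

/-- `A'` is the adjoint `A†` of `A`. -/
def IsDagger {p : ℕ} (A A' : Module.End ℂ (H p)) : Prop :=
  ∀ f h : H p, herm (A f) h = herm f (A' h)

/-- The substitution `X j ↦ g (X j) = ∑ i, g i j X i`. -/
def subst (g : Matrix (Fin 3) (Fin 3) ℂ) :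
    MvPolynomial (Fin 3) ℂ →ₐ[ℂ] MvPolynomial (Fin 3) ℂ :=
  MvPolynomial.aeval fun j => ∑ i, MvPolynomial.C (g i j) * MvPolynomial.X i

theorem isHomogeneous_linear (v : Fin 3 → ℂ) :
    (∑ i, MvPolynomial.C (v i) * MvPolynomial.X i : MvPolynomial (Fin 3) ℂ).IsHomogeneous 1 :=
  MvPolynomial.IsHomogeneous.sum _ _ _ fun i _ => MvPolynomial.isHomogeneous_C_mul_X _ i

theorem subst_mem {p : ℕ} (g : Matrix (Fin 3) (Fin 3) ℂ) (f : MvPolynomial (Fin 3) ℂ)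
    (hf : f ∈ MvPolynomial.homogeneousSubmodule (Fin 3) ℂ p) :
    subst g f ∈ MvPolynomial.homogeneousSubmodule (Fin 3) ℂ p := by
  have := MvPolynomial.IsHomogeneous.aeval (n := 1)
    ((MvPolynomial.mem_homogeneousSubmodule p f).1 hf)
    (fun j => ∑ i, MvPolynomial.C (g i j) * MvPolynomial.X i)
    (fun j => isHomogeneous_linear fun i => g i j)
  rw [one_mul] at this
  exact this

theorem subst_one : subst 1 = AlgHom.id ℂ _ := by
  apply MvPolynomial.algHom_ext
  intro j
  simp [subst, Matrix.one_apply]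

theorem subst_mul (g h : Matrix (Fin 3) (Fin 3) ℂ) :
    subst (g * h) = (subst g).comp (subst h) := by
  apply MvPolynomial.algHom_ext
  intro j
  simp only [subst, MvPolynomial.aeval_X, AlgHom.comp_apply, map_sum, map_mul,
    MvPolynomial.algHom_C, Matrix.mul_apply, Finset.mul_sum, Finset.sum_mul,
    MvPolynomial.algebraMap_eq]
  rw [Finset.sum_comm]
  refine Finset.sum_congr rfl fun k _ => Finset.sum_congr rfl fun i _ => ?_
  ring

/-- The unitary irreducible representation of `SU(3)` on `H p`. -/
def rep (p : ℕ) : SU3 →* Module.End ℂ (H p) where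
  toFun g := (subst g.1).toLinearMap.restrict (subst_mem g.1)
  map_one' := by
    ext1 f
    apply Subtype.ext
    simp [subst_one]
  map_mul' g h := by
    ext1 f
    apply Subtype.ext
    change subst (g.1 * h.1) f.1 = subst g.1 (subst h.1 f.1)
    rw [subst_mul, AlgHom.comp_apply]

/-- The action `A ↦ A^g = ρ(g) A ρ(g)⁻¹` of `SU(3)` on operators. -/
def conj {p : ℕ} (g : SU3) (A : Module.End ℂ (H p)) : Module.End ℂ (H p) :=
  rep p g * A * rep p g⁻¹

theorem raise_mem {p : ℕ} (i j : Fin 3) (f : MvPolynomial (Fin 3) ℂ)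
    (hf : f ∈ MvPolynomial.homogeneousSubmodule (Fin 3) ℂ p) :
    ((LinearMap.mulLeft ℂ (MvPolynomial.X i)).comp
      (MvPolynomial.pderiv (R := ℂ) j).toLinearMap) f ∈
      MvPolynomial.homogeneousSubmodule (Fin 3) ℂ p := by
  rw [MvPolynomial.mem_homogeneousSubmodule] at hf ⊢
  change (MvPolynomial.X i * MvPolynomial.pderiv j f).IsHomogeneous p
  rcases Nat.eq_zero_or_pos p with rfl | hp
  · rw [← MvPolynomial.totalDegree_zero_iff_isHomogeneous,
      MvPolynomial.totalDegree_eq_zero_iff_eq_C] at hf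
    rw [hf, MvPolynomial.pderiv_C, mul_zero]
    exact MvPolynomial.isHomogeneous_zero _ _ _
  · have := (MvPolynomial.isHomogeneous_X ℂ i).mul (hf.pderiv (i := j))
    rwa [Nat.add_sub_cancel' hp] at this

/-- The operator by which the matrix unit `E_{ij} ∈ sl(3)` acts on `H p`, namely
`X i ∂/∂X j`: the derivation that maps `X j` to `X i` and the other basis vectors to `0`. -/
def matrixUnitOp (p : ℕ) (i j : Fin 3) : Module.End ℂ (H p) :=
  ((LinearMap.mulLeft ℂ (MvPolynomial.X i)).comp
    (MvPolynomial.pderiv (R := ℂ) j).toLinearMap).restrict (raise_mem i j)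

/-- The raising operator `V₊ = (λ₄ + i λ₅)/2 = E₁₃`, for the highest root. -/
def Vplus (p : ℕ) : Module.End ℂ (H p) := matrixUnitOp p 0 2

/-- The highest weight vector `X_0 ^ p`. -/
def highestWeight (p : ℕ) : H p :=
  ⟨MvPolynomial.X 0 ^ p, MvPolynomial.isHomogeneous_X_pow 0 p⟩

/-- The orthogonal projection onto the line of the highest weight vector. -/
def highestProj (p : ℕ) : Module.End ℂ (H p) :=
  ((MvPolynomial.lcoeff ℂ (Finsupp.single 0 p)).comp (Submodule.subtype _)).smulRight
    (highestWeight p)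

/-! ### Symbol correspondences -/

/-- A symbol correspondence from the operators on `H p` to `Poly(𝒪)`: an injective linear map
which is equivariant, real and normalized. -/
structure IsSymbolCorrespondence (p : ℕ) (W : Module.End ℂ (H p) →ₗ[ℂ] PolyOrbit) : Prop where
  injective : Function.Injective W
  equivariant : ∀ (g : SU3) (A : Module.End ℂ (H p)) (x : Orbit),
    (W (conj g A)).1 (act g x) = (W A).1 x
  real : ∀ A A' : Module.End ℂ (H p), IsDagger A A' →
    ∀ x : Orbit, (W A').1 x = starRingEnd ℂ ((W A).1 x)
  normalized : ∀ A : Module.End ℂ (H p),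
    orbitIntegral (W A).1 = LinearMap.trace ℂ (H p) A / (Module.finrank ℂ (H p) : ℂ)

/-- The (highest weight, symmetric) Berezin correspondence: `B_A (g ξ g⁻¹) = tr (A Π^g)` for the
projection `Π` onto the highest weight line. This determines `B`. -/
def IsBerezin (p : ℕ) (B : Module.End ℂ (H p) →ₗ[ℂ] PolyOrbit) : Prop :=
  ∀ (A : Module.End ℂ (H p)) (g : SU3),
    (B A).1 (act g base) = LinearMap.trace ℂ (H p) (A * conj g (highestProj p))

/-- The constant `μ_n(p)`, for `n ≤ p`. -/
def mu (n p : ℕ) : ℝ :=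
  (n.factorial : ℝ) / √((2 * n + 2).factorial : ℝ) *
    √(((p + n + 2).factorial : ℝ) / ((p - n).factorial : ℝ))

/-- The highest weight unit vector `V₊ⁿ / μ_n(p)` of the summand `(n,n)` of the space of
operators on `H p`. -/
def operatorBasis (p n : ℕ) : Module.End ℂ (H p) :=
  (((mu n p)⁻¹ : ℝ) : ℂ) • Vplus p ^ n

/-- The function `v₊ = x₄ + i x₅` on the orbit. -/
def vplus (x : Orbit) : ℂ := coord 3 x.1 + Complex.I * coord 4 x.1

/-- The highest weight harmonic function of the summand `(n,n)` of `Poly(𝒪)`: the multiple of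
`v₊ⁿ` by a positive number which has norm `1` in `L²(𝒪)`. -/
def harmonic (n : ℕ) (x : Orbit) : ℂ :=
  vplus x ^ n / ((√(orbitIntegral fun y => ((‖vplus y ^ n‖ ^ 2 : ℝ) : ℂ)).re : ℝ) : ℂ)

/-- `c` is the `n`-th characteristic number of `W`, for `n ≤ p`: on the summand `(n,n)` of the
space of operators, which is spanned by the translates of its highest weight vector, `W` is `c`
times the equivariant map that sends `√(dim H p)` times the normalized highest weight operator
to the normalized highest weight harmonic function. -/
def IsCharacteristicNumber (p : ℕ) (W : Module.End ℂ (H p) →ₗ[ℂ] PolyOrbit) (n : ℕ)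
    (c : ℝ) : Prop :=
  ∀ (g : SU3) (x : Orbit),
    (W (((√(Module.finrank ℂ (H p) : ℝ) : ℝ) : ℂ) • conj g (operatorBasis p n))).1 (act g x) =
      (c : ℂ) * harmonic n x

/-! ### Twisted products and rays of Poisson type -/

/-- The twisted product on the image of an injective `W`: `W A ⋆ W A' = W (A A')`. (Its value is
irrelevant if one of the functions is not in the image.) -/
def twisted {p : ℕ} (W : Module.End ℂ (H p) →ₗ[ℂ] PolyOrbit) (f₁ f₂ : PolyOrbit) : PolyOrbit :=
  W (Function.invFun W f₁ * Function.invFun W f₂)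

/-- The ray `(W^p)` is of Poisson type: any two elements of `Poly(𝒪)` lie in the image of `W^p`
for all large `p`, and uniformly on the orbit `f₁ ⋆^p f₂ → f₁ f₂` and
`p r (f₁ ⋆^p f₂ - f₂ ⋆^p f₁) → i {f₁, f₂}`, with `r = √(2/3)` the integral radius of `ξ`. -/
def IsPoissonType (W : (p : ℕ) → Module.End ℂ (H p) →ₗ[ℂ] PolyOrbit) : Prop :=
  ∀ F₁ F₂ : MvPolynomial (Fin 8) ℂ,
    (∀ᶠ p in atTop, toPoly F₁ ∈ Set.range (W p) ∧ toPoly F₂ ∈ Set.range (W p)) ∧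
    Tendsto (fun p => supNorm
      (twisted (W p) (toPoly F₁) (toPoly F₂) - toPoly F₁ * toPoly F₂)) atTop (𝓝 0) ∧
    Tendsto (fun p : ℕ => supNorm
      (((p * integralRadius : ℝ) : ℂ) •
          (twisted (W p) (toPoly F₁) (toPoly F₂) - twisted (W p) (toPoly F₂) (toPoly F₁)) -
        Complex.I • toPoly (bracket F₁ F₂))) atTop (𝓝 0)

end QuarkSystem

end

open QuarkSystem

open Filter Topology MeasureTheory

noncomputable section

namespace QuarkSystem

open MvPolynomial (eval)


/-! ### The symmetric power and its coherent vectors -/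

/-! Everything is reduced to polynomial identities in a unit vector `z` (the first column of `g`)
and its conjugate. Powers `(z·X)^p` of linear forms span the symmetric power, rank-one operators
built from them span all operators, and the Berezin symbol of `A` is the value at `z̄` of the form
`A (z·X)^p`. A polynomial in `z` and `z̄` that vanishes identically is zero, whence injectivity.
Normalization holds because an invariant functional on operators is a multiple of the trace
(`exists_eq_smul_trace`).

For `a·b = 0` put `f = (a·z̄)(b·z)` (`fvec`) and `D = (a·X)(b·∂)` (`dop`). These nilpotent elements
of rank one are the conjugates of multiples of `E₁₃`, so their `n`-th powers represent the summand
`(n,n)`. The symbol of `D^n` is `p(p-1)⋯(p-n+1) f^n` (`berezin_dop_pow`), and the powers `f^n` span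
`Poly(𝒪)` (`exists_mem_polySpan`). Invariance under the stabilizer of the base point forces every
symbol correspondence to multiply `f^n` by a scalar `t_n` relative to Berezin's (`map_dop_pow`),
real and nonzero for `n ≤ p`. With the norms of `V₊^n` and `v₊^n` computed, `c_n = t_n b_n`
(`isCharacteristicNumber_iff`). Since `b_n → 1`, it remains to show that Poisson type means `t_n →
1` for all `n`.

Leibniz' rule expands the symbol of a product `D^n D'^m` exactly (`berezin_dop_pow_mul_dop_pow`).
After normalization the term with `k` contractions is of order `p^{-k}`: the term `k = 0` is the
pointwise product, and `k = 1`, antisymmetrized, is the Poisson bracket. If all `t_n → 1`, this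
gives Poisson type for powers of nilpotent functions. Bilinearity extends it to all polynomials,
once the bracket is known to descend to the orbit, which holds because Hamiltonian fields are
tangent to it.

Conversely, with a single `f` one gets `f^n ⋆ f^m` as a multiple of `f^{n+m}`, so that `t_{n+m}/(t_n
t_m) → 1` (`tendsto_relChar_div`). This alone would allow `t_n = s^n`. The commutator of `z̄₀z₂` and
`z̄₂z₀` has a factor `1/t_1`, so the bracket condition gives `t_1 → 1` (`tendsto_relChar_one`), and
induction on `n` finishes. -/

/-- The linear form `∑ i, a i X i`. -/
def lin (a : Fin 3 → ℂ) : MvPolynomial (Fin 3) ℂ :=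
  ∑ i, MvPolynomial.C (a i) * MvPolynomial.X i

theorem lin_isHomogeneous (a : Fin 3 → ℂ) : (lin a).IsHomogeneous 1 := isHomogeneous_linear a

@[simp] theorem eval_lin (a b : Fin 3 → ℂ) : eval b (lin a) = a ⬝ᵥ b := by
  simp [lin, dotProduct]

theorem lin_smul (r : ℂ) (a : Fin 3 → ℂ) : lin (r • a) = MvPolynomial.C r * lin a := by
  simp [lin, Finset.mul_sum, mul_assoc]

/-- The coherent vector `(∑ i, a i X i) ^ p`. -/
def coh (p : ℕ) (a : Fin 3 → ℂ) : H p :=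
  ⟨lin a ^ p, by simpa using (lin_isHomogeneous a).pow p⟩

@[simp] theorem coh_val (p : ℕ) (a : Fin 3 → ℂ) : (coh p a).1 = lin a ^ p := rfl

theorem lin_pow (a : Fin 3 → ℂ) (p : ℕ) :
    lin a ^ p = ∑ c ∈ Finset.piAntidiag Finset.univ p,
      MvPolynomial.monomial (Finsupp.equivFunOnFinite.symm c)
        ((Nat.multinomial Finset.univ c : ℂ) * ∏ i, a i ^ c i) := by
  rw [lin, Finset.sum_pow_eq_sum_piAntidiag]
  refine Finset.sum_congr rfl fun c _ => ?_
  rw [MvPolynomial.monomial_eq, Finsupp.prod_fintype _ _ (by simp)]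
  simp [mul_pow, Finset.prod_mul_distrib, mul_assoc]

theorem mem_piAntidiag_univ {c : Fin 3 →₀ ℕ} {p : ℕ} :
    ⇑c ∈ Finset.piAntidiag Finset.univ p ↔ c.degree = p := by
  simp [Finset.mem_piAntidiag, Finsupp.degree_eq_sum]

theorem coeff_lin_pow (a : Fin 3 → ℂ) {p : ℕ} (c : Fin 3 →₀ ℕ) (hc : c.degree = p) :
    (lin a ^ p).coeff c = (Nat.multinomial Finset.univ c : ℂ) * ∏ i, a i ^ c i := by
  classical
  rw [lin_pow, MvPolynomial.coeff_sum, Finset.sum_eq_single (⇑c)]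
  · rw [MvPolynomial.coeff_monomial, if_pos (by ext; simp)]
  · intro d _ hd
    rw [MvPolynomial.coeff_monomial, if_neg]
    rintro rfl
    exact hd (by ext; simp)
  · intro h
    exact absurd (mem_piAntidiag_univ.2 hc) h

/-- A linear functional on polynomials which vanishes on the `p`-th powers of all linear forms
vanishes on the forms of degree `p`. -/
theorem functional_eq_zero_of_lin_pow {p : ℕ} (φ : MvPolynomial (Fin 3) ℂ →ₗ[ℂ] ℂ)
    (h : ∀ a, φ (lin a ^ p) = 0) {f : MvPolynomial (Fin 3) ℂ} (hf : f.IsHomogeneous p) :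
    φ f = 0 := by
  classical
  -- As a polynomial in `a`, `G` takes the value `φ ((a·X)^p)`. It therefore vanishes, and its
  -- coefficients are the values of `φ` on monomials up to nonzero multinomial factors.
  set G : MvPolynomial (Fin 3) ℂ := ∑ c ∈ Finset.piAntidiag Finset.univ p,
      MvPolynomial.monomial (Finsupp.equivFunOnFinite.symm c)
        ((Nat.multinomial Finset.univ c : ℂ) *
          φ (MvPolynomial.monomial (Finsupp.equivFunOnFinite.symm c) 1)) with hG
  have hG0 : G = 0 := by
    apply MvPolynomial.funext
    intro a
    rw [map_zero, ← h a, lin_pow, hG, map_sum, map_sum]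
    refine Finset.sum_congr rfl fun c _ => ?_
    rw [MvPolynomial.eval_monomial, Finsupp.prod_fintype _ _ (by simp)]
    rw [show (MvPolynomial.monomial (Finsupp.equivFunOnFinite.symm c)
        ((Nat.multinomial Finset.univ c : ℂ) * ∏ i, a i ^ c i) : MvPolynomial (Fin 3) ℂ)
        = ((Nat.multinomial Finset.univ c : ℂ) * ∏ i, a i ^ c i) •
          MvPolynomial.monomial (Finsupp.equivFunOnFinite.symm c) 1 by
        rw [MvPolynomial.smul_monomial, smul_eq_mul, mul_one], map_smul, smul_eq_mul]
    simp only [Finsupp.equivFunOnFinite_symm_apply_apply]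
    ring
  have key : ∀ c : Fin 3 →₀ ℕ, c.degree = p → φ (MvPolynomial.monomial c 1) = 0 := by
    intro c hc
    have h1 : G.coeff c = (Nat.multinomial Finset.univ c : ℂ) *
        φ (MvPolynomial.monomial c 1) := by
      rw [hG, MvPolynomial.coeff_sum, Finset.sum_eq_single (⇑c)]
      · rw [MvPolynomial.coeff_monomial, if_pos (by ext; simp)]
        rw [show Finsupp.equivFunOnFinite.symm ⇑c = c by ext; simp]
      · intro d _ hd
        rw [MvPolynomial.coeff_monomial, if_neg]
        rintro rfl
        exact hd (by ext; simp)
      · intro h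
        exact absurd (mem_piAntidiag_univ.2 hc) h
    rw [hG0, MvPolynomial.coeff_zero] at h1
    have h2 : (Nat.multinomial Finset.univ c : ℂ) ≠ 0 :=
      Nat.cast_ne_zero.2 (Nat.multinomial_pos _ _).ne'
    exact (mul_eq_zero.1 h1.symm).resolve_left h2
  rw [f.as_sum, map_sum]
  refine Finset.sum_eq_zero fun c hc => ?_
  have hd : c.degree = p := by
    by_contra hne
    exact (MvPolynomial.mem_support_iff.1 hc) (hf.coeff_eq_zero hne)
  rw [show (MvPolynomial.monomial c (f.coeff c) : MvPolynomial (Fin 3) ℂ)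
    = f.coeff c • MvPolynomial.monomial c 1 by
      rw [MvPolynomial.smul_monomial, smul_eq_mul, mul_one], map_smul, key c hd, smul_zero]

instance (p : ℕ) : Module.Finite ℂ (H p) :=
  Module.Finite.iff_fg.2 (MvPolynomial.homogeneousSubmodule_fg (Fin 3) ℂ p)

theorem span_eq_top_of_functional {V : Type*} [AddCommGroup V] [Module ℂ V] {s : Set V}
    (h : ∀ φ : V →ₗ[ℂ] ℂ, (∀ x ∈ s, φ x = 0) → φ = 0) : Submodule.span ℂ s = ⊤ := by
  by_contra hne
  obtain ⟨x, -, hx⟩ := SetLike.exists_of_lt (lt_top_iff_ne_top.2 hne)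
  obtain ⟨φ, hφx, hφ⟩ := Submodule.exists_le_ker_of_notMem hx
  exact hφx (by rw [h φ fun y hy => hφ (Submodule.subset_span hy)]; rfl)

/-- Polarization: a functional that kills all coherent vectors extends to all polynomials and is
then zero on forms of degree `p`. -/
theorem span_coh (p : ℕ) : Submodule.span ℂ (Set.range (coh p)) = ⊤ := by
  refine span_eq_top_of_functional fun φ hφ => ?_
  obtain ⟨φ', hφ'⟩ := LinearMap.exists_extend φ
  have h1 : ∀ x : H p, φ' x.1 = φ x := fun x => LinearMap.congr_fun hφ' x
  ext1 f
  rw [← h1]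
  refine functional_eq_zero_of_lin_pow φ' (fun a => ?_) f.2
  have := h1 (coh p a)
  rw [coh_val] at this
  rw [this]
  exact hφ _ ⟨a, rfl⟩

/-- Evaluation of the forms of degree `p` at a vector. -/
def evalAt (p : ℕ) (b : Fin 3 → ℂ) : H p →ₗ[ℂ] ℂ :=
  (MvPolynomial.aeval (R := ℂ) b).toLinearMap.comp (Submodule.subtype _)

@[simp] theorem evalAt_apply (p : ℕ) (b : Fin 3 → ℂ) (f : H p) : evalAt p b f = eval b f.1 := by
  simp [evalAt, MvPolynomial.aeval_eq_eval]

theorem ext_evalAt {p : ℕ} {f h : H p} (hfh : ∀ b, eval b f.1 = eval b h.1) : f = h :=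
  Subtype.ext (MvPolynomial.funext hfh)

/-- The operator of rank one `h ↦ h(b) (∑ i, a i X i) ^ p`. -/
def rankOneOp (p : ℕ) (a b : Fin 3 → ℂ) : Module.End ℂ (H p) :=
  (evalAt p b).smulRight (coh p a)

/-- In a finite basis an operator is the sum of the rank-one operators given by its columns. -/
theorem span_smulRight (V : Type*) [AddCommGroup V] [Module ℂ V] [Module.Finite ℂ V]
    (Λ : Module.End ℂ V →ₗ[ℂ] ℂ)
    (h : ∀ (φ : V →ₗ[ℂ] ℂ) (v : V), Λ (φ.smulRight v) = 0) : Λ = 0 := by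
  ext A
  let b := Module.finBasis ℂ V
  have : A = ∑ i, (b.coord i).smulRight (A (b i)) := by
    apply b.ext
    intro j
    simp [LinearMap.sum_apply, Finsupp.single_apply]
  rw [this, map_sum]
  simp [h]

/-- Evaluations at points exhaust the dual of `H p`: by biduality a functional on the dual is given
by a form, which is zero if it vanishes at all points. Coherent vectors exhaust `H p` itself, so
both tensor factors are covered. -/
theorem functional_ext_rankOneOp {p : ℕ} (Λ : Module.End ℂ (H p) →ₗ[ℂ] ℂ)
    (h : ∀ a b, Λ (rankOneOp p a b) = 0) : Λ = 0 := by
  have h1 : ∀ (φ : H p →ₗ[ℂ] ℂ) (a), Λ (φ.smulRight (coh p a)) = 0 := by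
    intro φ a
    let Ψ : Module.Dual ℂ (Module.Dual ℂ (H p)) :=
      { toFun := fun φ => Λ (LinearMap.smulRight φ (coh p a))
        map_add' := fun φ ψ => by
          rw [← map_add]; congr 1; ext1 x; simp [add_smul]
        map_smul' := fun r φ => by
          rw [RingHom.id_apply, ← map_smul]; congr 1; ext1 x; simp [mul_smul] }
    have hv : (Module.evalEquiv ℂ (H p)).symm Ψ = 0 := by
      apply ext_evalAt
      intro b
      have h2 : evalAt p b ((Module.evalEquiv ℂ (H p)).symm Ψ) = Ψ (evalAt p b) :=
        Module.apply_evalEquiv_symm_apply ℂ (H p) (evalAt p b) Ψ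
      rw [evalAt_apply] at h2
      rw [h2]
      exact h a b
    have h3 : Ψ = 0 := by simpa using hv
    exact LinearMap.congr_fun h3 φ
  apply span_smulRight
  intro φ v
  have : v ∈ Submodule.span ℂ (Set.range (coh p)) := by rw [span_coh]; trivial
  induction this using Submodule.span_induction with
  | mem x hx => obtain ⟨a, rfl⟩ := hx; exact h1 φ a
  | zero => rw [LinearMap.smulRight_zero, map_zero]
  | add x y _ _ hx hy =>
    have : φ.smulRight (x + y) = φ.smulRight x + φ.smulRight y := by ext1 z; simp
    rw [this, map_add, hx, hy, add_zero]
  | smul r x _ hx =>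
    have : φ.smulRight (r • x) = r • φ.smulRight x := by
      ext1 z; exact smul_comm _ _ _
    rw [this, map_smul, hx, smul_zero]

theorem span_rankOneOp (p : ℕ) :
    Submodule.span ℂ (Set.range fun ab : (Fin 3 → ℂ) × (Fin 3 → ℂ) => rankOneOp p ab.1 ab.2)
      = ⊤ := by
  refine span_eq_top_of_functional (V := Module.End ℂ (H p)) fun Λ hΛ => ?_
  exact functional_ext_rankOneOp Λ fun a b => hΛ _ ⟨(a, b), rfl⟩

/-- To prove a linear property of all operators, consider operators of rank one. -/
theorem end_induction {p : ℕ} (S : Submodule ℂ (Module.End ℂ (H p)))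
    (h : ∀ a b, rankOneOp p a b ∈ S) (A : Module.End ℂ (H p)) : A ∈ S := by
  have : A ∈ Submodule.span ℂ
      (Set.range fun ab : (Fin 3 → ℂ) × (Fin 3 → ℂ) => rankOneOp p ab.1 ab.2) := by
    rw [span_rankOneOp]; trivial
  refine Submodule.span_le.2 ?_ this
  rintro _ ⟨ab, rfl⟩
  exact h _ _

theorem end_ext_coh {p : ℕ} {A A' : Module.End ℂ (H p)} (h : ∀ a, A (coh p a) = A' (coh p a)) :
    A = A' :=
  LinearMap.ext_on (span_coh p) (by rintro _ ⟨a, rfl⟩; exact h a)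

/-! ### The representation -/

@[simp] theorem rep_val (p : ℕ) (g : SU3) (f : H p) : (rep p g f).1 = subst g.1 f.1 := rfl

theorem subst_lin (g : Matrix (Fin 3) (Fin 3) ℂ) (a : Fin 3 → ℂ) :
    subst g (lin a) = lin (g.mulVec a) := by
  simp only [lin, map_sum, map_mul, subst, MvPolynomial.algHom_C, MvPolynomial.aeval_X,
    Matrix.mulVec, dotProduct, Finset.mul_sum, Finset.sum_mul, MvPolynomial.algebraMap_eq]
  rw [Finset.sum_comm]
  refine Finset.sum_congr rfl fun i _ => Finset.sum_congr rfl fun j _ => ?_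
  ring

theorem rep_coh (p : ℕ) (g : SU3) (a : Fin 3 → ℂ) :
    rep p g (coh p a) = coh p (g.1.mulVec a) := by
  apply Subtype.ext
  simp [subst_lin]

theorem eval_subst (g : Matrix (Fin 3) (Fin 3) ℂ) (f : MvPolynomial (Fin 3) ℂ) (b : Fin 3 → ℂ) :
    eval b (subst g f) = eval (Matrix.vecMul b g) f := by
  have : (MvPolynomial.aeval (R := ℂ) b).comp (subst g)
      = MvPolynomial.aeval (R := ℂ) (Matrix.vecMul b g) := by
    apply MvPolynomial.algHom_ext
    intro j
    simp [subst, Matrix.vecMul, dotProduct, mul_comm]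
  have h := DFunLike.congr_fun this f
  simpa [MvPolynomial.aeval_eq_eval] using h

/-- The first column of `g`. -/
def col (g : SU3) : Fin 3 → ℂ := fun i => g.1 i 0

/-- The conjugate of the first column of `g`. -/
def colBar (g : SU3) : Fin 3 → ℂ := fun i => starRingEnd ℂ (g.1 i 0)

theorem inv_val (g : SU3) : (g⁻¹).1 = g.1.conjTranspose := rfl

theorem inv_apply (g : SU3) (i j : Fin 3) : (g⁻¹).1 i j = starRingEnd ℂ (g.1 j i) := rfl

theorem mulVec_col (g h : SU3) : g.1.mulVec (col h) = col (g * h) := by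
  ext i; simp [col, Matrix.mulVec, dotProduct, Matrix.mul_apply]

theorem inv_mul_val (g : SU3) : (g⁻¹).1 * g.1 = 1 := by
  exact congrArg Subtype.val (inv_mul_cancel g)

theorem mul_inv_val (g : SU3) : g.1 * (g⁻¹).1 = 1 := by
  exact congrArg Subtype.val (mul_inv_cancel g)

theorem colBar_dot_col (g : SU3) : colBar g ⬝ᵥ col g = 1 := by
  have := congrFun (congrFun (inv_mul_val g) 0) 0
  simpa [Matrix.mul_apply, dotProduct, inv_apply, colBar, col] using this

theorem col_dot_colBar (g : SU3) : col g ⬝ᵥ colBar g = 1 := by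
  rw [dotProduct_comm, colBar_dot_col]

theorem coeff_single_eq_eval {p : ℕ} (f : H p) :
    f.1.coeff (Finsupp.single 0 p) = eval (Pi.single 0 1) f.1 := by
  classical
  rw [MvPolynomial.eval_eq']
  rw [Finset.sum_eq_single (Finsupp.single 0 p)]
  · have : ∏ i : Fin 3, (Pi.single 0 1 : Fin 3 → ℂ) i ^ (Finsupp.single (0 : Fin 3) p) i = 1 := by
      apply Finset.prod_eq_one
      intro i _
      fin_cases i <;> simp
    rw [this, mul_one]
  · intro c hc hne
    have hd : c.degree = p := by
      by_contra hne
      exact (MvPolynomial.mem_support_iff.1 hc) (f.2.coeff_eq_zero hne)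
    have : ∃ i : Fin 3, i ≠ 0 ∧ c i ≠ 0 := by
      by_contra hcon
      push Not at hcon
      apply hne
      have h0 : c 0 = p := by
        rw [← hd, Finsupp.degree_eq_sum, Finset.sum_eq_single 0]
        · intro i _ hi; exact hcon i hi
        · simp
      ext i
      by_cases hi : i = 0
      · subst hi; simp [h0]
      · rw [hcon i hi, Finsupp.single_eq_of_ne hi]
    obtain ⟨i, hi, hci⟩ := this
    rw [Finset.prod_eq_zero (Finset.mem_univ i), mul_zero]
    rw [Pi.single_eq_of_ne hi, zero_pow hci]
  · intro h
    rw [MvPolynomial.notMem_support_iff.1 h, zero_mul]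

/-- The coefficient of `X₀^p` in a form of degree `p` is its value at `e₀`. In this shape the
projection is conjugated by moving two vectors. -/
theorem highestProj_eq (p : ℕ) :
    highestProj p = rankOneOp p (Pi.single 0 1) (Pi.single 0 1) := by
  ext1 f
  apply Subtype.ext
  have hl : lin (Pi.single 0 1) = MvPolynomial.X 0 := by
    simp [lin, Fin.sum_univ_three]
  simp only [highestProj, rankOneOp, LinearMap.smulRight_apply, evalAt_apply, LinearMap.comp_apply,
    Submodule.subtype_apply, MvPolynomial.lcoeff_apply, coeff_single_eq_eval]
  simp [highestWeight, hl]

theorem conj_rankOneOp (p : ℕ) (g : SU3) (a b : Fin 3 → ℂ) :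
    conj g (rankOneOp p a b) = rankOneOp p (g.1.mulVec a) (Matrix.vecMul b g⁻¹.1) := by
  ext1 f
  simp only [conj, rankOneOp, Module.End.mul_apply, LinearMap.smulRight_apply, evalAt_apply,
    map_smul, rep_coh, rep_val, eval_subst]

theorem trace_mul_rankOneOp {p : ℕ} (A : Module.End ℂ (H p)) (a b : Fin 3 → ℂ) :
    LinearMap.trace ℂ (H p) (A * rankOneOp p a b) = eval b (A (coh p a)).1 := by
  have : A * rankOneOp p a b = (evalAt p b).smulRight (A (coh p a)) := by
    ext1 f
    simp [rankOneOp]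
  rw [this, LinearMap.trace_smulRight, evalAt_apply]

theorem trace_rankOneOp (p : ℕ) (a b : Fin 3 → ℂ) :
    LinearMap.trace ℂ (H p) (rankOneOp p a b) = (a ⬝ᵥ b) ^ p := by
  have := trace_mul_rankOneOp (1 : Module.End ℂ (H p)) a b
  simpa using this

/-- The Berezin symbol in terms of coherent vectors. -/
theorem trace_mul_conj_highestProj {p : ℕ} (A : Module.End ℂ (H p)) (g : SU3) :
    LinearMap.trace ℂ (H p) (A * conj g (highestProj p))
      = eval (colBar g) (A (coh p (col g))).1 := by
  rw [highestProj_eq, conj_rankOneOp, trace_mul_rankOneOp]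
  have h1 : g.1.mulVec (Pi.single 0 1) = col g := by
    ext i; simp [col]
  have h2 : Matrix.vecMul (Pi.single 0 1) g⁻¹.1 = colBar g := by
    ext i; simp [colBar, inv_apply]
  rw [h1, h2]


/-! ### Dimension, torus, frames -/

theorem finrank_H (p : ℕ) : Module.finrank ℂ (H p) = (p + 2).choose 2 := by
  classical
  let ι := ↥(Finset.finsuppAntidiag (Finset.univ : Finset (Fin 3)) p)
  have hdeg : ∀ c : Fin 3 →₀ ℕ, c ∈ Finset.finsuppAntidiag (Finset.univ : Finset (Fin 3)) p ↔
      c.degree = p := by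
    intro c
    simp [Finset.mem_finsuppAntidiag, Finsupp.degree_eq_sum]
  let e : H p →ₗ[ℂ] (ι → ℂ) := LinearMap.pi fun c =>
    (MvPolynomial.lcoeff ℂ c.1).comp (Submodule.subtype _)
  have he : ∀ f c, e f c = f.1.coeff c.1 := fun f c => rfl
  have hinj : Function.Injective e := by
    intro f h hfh
    apply Subtype.ext
    ext c
    by_cases hc : c.degree = p
    · have := congrFun hfh ⟨c, (hdeg c).2 hc⟩
      simpa [he] using this
    · rw [f.2.coeff_eq_zero hc, h.2.coeff_eq_zero hc]
  have hsurj : Function.Surjective e := by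
    intro x
    refine ⟨⟨∑ c : ι, MvPolynomial.monomial c.1 (x c), ?_⟩, ?_⟩
    · exact MvPolynomial.IsHomogeneous.sum _ _ _ fun c _ =>
        MvPolynomial.isHomogeneous_monomial _ ((hdeg c.1).1 c.2)
    · ext c
      rw [he, MvPolynomial.coeff_sum, Finset.sum_eq_single c]
      · simp
      · intro d _ hd
        rw [MvPolynomial.coeff_monomial, if_neg fun h => hd (Subtype.ext h)]
      · simp
  rw [(LinearEquiv.ofBijective e ⟨hinj, hsurj⟩).finrank_eq, Module.finrank_fintype_fun_eq_card,
    Fintype.card_coe, Finset.card_finsuppAntidiag_nat_eq_choose]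
  simp only [Finset.card_univ, Fintype.card_fin]
  rw [show 3 + p - 1 = p + 2 by omega]
  exact (Nat.choose_symm_of_eq_add (by omega)).symm

/-- The diagonal element of `SU(3)` with phases `θ`. -/
def torus (θ : Fin 3 → ℝ) (h : ∑ i, θ i = 0) : SU3 :=
  ⟨Matrix.diagonal fun i => Complex.exp (Complex.I * θ i), by
    rw [Matrix.mem_specialUnitaryGroup_iff]
    constructor
    · rw [Matrix.mem_unitaryGroup_iff, Matrix.star_eq_conjTranspose,
        Matrix.diagonal_conjTranspose, Matrix.diagonal_mul_diagonal, ← Matrix.diagonal_one]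
      congr 1
      ext i
      simp only [Pi.star_apply, RCLike.star_def, ← Complex.exp_conj, ← Complex.exp_add]
      simp
    · rw [Matrix.det_diagonal, ← Complex.exp_sum, ← Finset.mul_sum]
      have : (∑ i, (θ i : ℂ)) = 0 := by exact_mod_cast congrArg (fun x : ℝ => (x : ℂ)) h
      rw [this]
      simp⟩

theorem torus_val (θ : Fin 3 → ℝ) (h : ∑ i, θ i = 0) :
    (torus θ h).1 = Matrix.diagonal fun i => Complex.exp (Complex.I * θ i) := rfl

theorem torus_inv_val (θ : Fin 3 → ℝ) (h : ∑ i, θ i = 0) :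
    (torus θ h)⁻¹.1 = Matrix.diagonal fun i => Complex.exp (-(Complex.I * θ i)) := by
  rw [inv_val, torus_val, Matrix.diagonal_conjTranspose]
  congr 1
  ext i
  simp [← Complex.exp_conj]

/-- The torus separates weights. -/
theorem exists_torus_ne_one {δ : Fin 3 → ℤ} (hδ : ∑ i, δ i = 0) (hne : δ ≠ 0) :
    ∃ θ : Fin 3 → ℝ, ∑ i, θ i = 0 ∧
      Complex.exp (Complex.I * ∑ i, (θ i : ℂ) * (δ i : ℂ)) ≠ 1 := by
  set N : ℝ := ∑ i, (δ i : ℝ) ^ 2 with hN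
  have hNpos : 0 < N := by
    obtain ⟨i, hi⟩ := Function.ne_iff.1 hne
    exact Finset.sum_pos' (fun _ _ => sq_nonneg _)
      ⟨i, Finset.mem_univ _, by have : (δ i : ℝ) ≠ 0 := Int.cast_ne_zero.2 hi
                                positivity⟩
  -- Phases proportional to `δ` have sum zero because `δ` does, and the scale makes their pairing
  -- with `δ` equal to `π`, so that the character takes the value `-1`.
  refine ⟨fun i => Real.pi / N * δ i, ?_, ?_⟩
  · rw [← Finset.mul_sum, ← Int.cast_sum, hδ]; simp
  · have : ∑ i, ((Real.pi / N * δ i : ℝ) : ℂ) * (δ i : ℂ) = (Real.pi : ℂ) := by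
      have h1 : ∑ i, (Real.pi / N * (δ i : ℝ)) * (δ i : ℝ) = Real.pi := by
        have : ∑ i, (Real.pi / N * (δ i : ℝ)) * (δ i : ℝ) = Real.pi / N * N := by
          rw [hN, Finset.mul_sum]
          exact Finset.sum_congr rfl fun i _ => by ring
        rw [this]; field_simp
      exact_mod_cast congrArg (fun x : ℝ => (x : ℂ)) h1
    rw [this, mul_comm, Complex.exp_pi_mul_I]
    norm_num

/-- Every unit vector is the first column of an element of `SU(3)`. -/
theorem exists_col (z : Fin 3 → ℂ) (hz : ∑ i, ‖z i‖ ^ 2 = 1) : ∃ g : SU3, col g = z := by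
  let v : EuclideanSpace ℂ (Fin 3) := WithLp.toLp 2 z
  have hv : ‖v‖ = 1 := by
    rw [EuclideanSpace.norm_eq, hz, Real.sqrt_one]
  have hon : Orthonormal ℂ (({0} : Set (Fin 3)).domRestrict fun _ => v) := by
    constructor
    · intro i; exact hv
    · intro i j hij
      exact absurd (Subsingleton.elim i j) hij
  obtain ⟨b, hb⟩ := hon.exists_orthonormalBasis_extension_of_card_eq (by simp)
  have hb0 : b 0 = v := hb 0 rfl
  let U := (EuclideanSpace.basisFun (Fin 3) ℂ).toBasis.toMatrix b
  have hU : U ∈ Matrix.unitaryGroup (Fin 3) ℂ :=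
    (EuclideanSpace.basisFun (Fin 3) ℂ).toMatrix_orthonormalBasis_mem_unitary b
  have hUc : ∀ i, U i 0 = z i := by
    intro i
    simp [U, Module.Basis.toMatrix_apply, hb0, v]
  have hdet : ‖U.det‖ = 1 := by
    have := Matrix.det_of_mem_unitary hU
    exact CStarRing.norm_of_mem_unitary this
  have hdet0 : U.det ≠ 0 := by intro h; simp [h] at hdet
  -- The determinant is corrected on the last column, which leaves the first one alone.
  let d : Fin 3 → ℂ := ![1, 1, (U.det)⁻¹]
  have hd : Matrix.diagonal d ∈ Matrix.unitaryGroup (Fin 3) ℂ := by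
    rw [Matrix.mem_unitaryGroup_iff, Matrix.star_eq_conjTranspose,
        Matrix.diagonal_conjTranspose, Matrix.diagonal_mul_diagonal, ← Matrix.diagonal_one]
    congr 1
    ext i
    fin_cases i
    · simp [d]
    · simp [d]
    · simp only [d, Pi.star_apply]
      simp [← mul_inv, Complex.mul_conj, Complex.normSq_eq_norm_sq, hdet]
  refine ⟨⟨U * Matrix.diagonal d, ?_⟩, ?_⟩
  · rw [Matrix.mem_specialUnitaryGroup_iff]
    refine ⟨mul_mem hU hd, ?_⟩
    rw [Matrix.det_mul, Matrix.det_diagonal, Fin.prod_univ_three]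
    simp [d, hdet0]
  · ext i
    simp [col, Matrix.mul_diagonal, d, hUc]

/-- Homogeneous identities on unit vectors extend to `ℂ³` in this way. The factor is real, so
conjugating the vector does not change it. -/
theorem exists_smul_col (z : Fin 3 → ℂ) : ∃ (r : ℝ) (g : SU3), z = (r : ℂ) • col g := by
  by_cases hz : z = 0
  · exact ⟨0, 1, by simp [hz]⟩
  · set N : ℝ := ∑ i, ‖z i‖ ^ 2 with hN
    have hNpos : 0 < N := by
      obtain ⟨i, hi⟩ := Function.ne_iff.1 hz
      exact Finset.sum_pos' (fun _ _ => sq_nonneg _)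
        ⟨i, Finset.mem_univ _, by have : 0 < ‖z i‖ := norm_pos_iff.2 hi
                                  positivity⟩
    obtain ⟨g, hg⟩ := exists_col (((√N)⁻¹ : ℝ) • z) (by
      simp only [Pi.smul_apply, norm_smul, mul_pow, ← Finset.mul_sum, ← hN]
      rw [Real.norm_eq_abs, sq_abs, inv_pow, Real.sq_sqrt hNpos.le, inv_mul_cancel₀ hNpos.ne'])
    refine ⟨√N, g, ?_⟩
    rw [hg]
    ext i
    have : ((√N : ℝ) : ℂ) ≠ 0 := by exact_mod_cast (Real.sqrt_pos.2 hNpos).ne'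
    simp [this]

/-- A polynomial in `z` and `z̄` which vanishes identically is zero. -/
theorem eq_zero_of_eval_conj (F : MvPolynomial (Fin 3 ⊕ Fin 3) ℂ)
    (h : ∀ z : Fin 3 → ℂ, eval (Sum.elim z fun i => starRingEnd ℂ (z i)) F = 0) : F = 0 := by
  -- The change of variables `z = x + iy`, `w = x - iy`: at real points it gives `w = z̄`, and a
  -- complex polynomial that vanishes at all real points is zero.
  let s : Fin 3 ⊕ Fin 3 → MvPolynomial (Fin 3 ⊕ Fin 3) ℂ := Sum.elim
    (fun i => MvPolynomial.X (Sum.inl i) + MvPolynomial.C Complex.I * MvPolynomial.X (Sum.inr i))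
    (fun i => MvPolynomial.X (Sum.inl i) - MvPolynomial.C Complex.I * MvPolynomial.X (Sum.inr i))
  have hs : ∀ x, eval x (MvPolynomial.bind₁ s F) = eval (fun j => eval x (s j)) F := by
    intro x
    rw [← MvPolynomial.aeval_eq_eval, ← MvPolynomial.aeval_eq_eval]
    exact MvPolynomial.aeval_bind₁ x s F
  have h0 : MvPolynomial.bind₁ s F = 0 := by
    apply MvPolynomial.funext_set (fun _ => Set.range ((↑) : ℝ → ℂ))
      (fun _ => Set.infinite_range_of_injective Complex.ofReal_injective)
    intro x hx
    choose y hy using fun j => hx j (Set.mem_univ j)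
    rw [map_zero, hs]
    convert h fun i => x (Sum.inl i) + Complex.I * x (Sum.inr i) using 2
    congr 1
    ext (i | i)
    · simp [s]
    · simp [s, ← hy, sub_eq_add_neg]
  apply MvPolynomial.funext
  intro x
  -- The change of variables is invertible, so `F` itself is zero.
  have := hs (Sum.elim (fun i => (x (Sum.inl i) + x (Sum.inr i)) / 2)
    (fun i => (x (Sum.inl i) - x (Sum.inr i)) / (2 * Complex.I)))
  rw [h0, map_zero] at this
  rw [map_zero, this]
  congr 2
  ext (i | i)
  · simp [s]; field_simp; ring
  · simp [s]; field_simp; ring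

/-- The matrix elements of an operator between coherent vectors are polynomial. -/
theorem exists_polynomial_coh {p : ℕ} (A : Module.End ℂ (H p)) :
    ∃ F : MvPolynomial (Fin 3 ⊕ Fin 3) ℂ, ∀ z w,
      eval (Sum.elim z w) F = eval w (A (coh p z)).1 := by
  let S : Submodule ℂ (Module.End ℂ (H p)) :=
    { carrier := {A | ∃ F : MvPolynomial (Fin 3 ⊕ Fin 3) ℂ, ∀ z w,
        eval (Sum.elim z w) F = eval w (A (coh p z)).1}
      zero_mem' := ⟨0, by simp⟩
      add_mem' := by
        rintro A B ⟨F, hF⟩ ⟨G, hG⟩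
        exact ⟨F + G, fun z w => by simp [hF, hG]⟩
      smul_mem' := by
        rintro r A ⟨F, hF⟩
        exact ⟨MvPolynomial.C r * F, fun z w => by simp [hF, MvPolynomial.smul_eval]⟩ }
  refine end_induction S (fun a b => ?_) A
  refine ⟨((∑ i, MvPolynomial.C (b i) * MvPolynomial.X (Sum.inl i)) *
    ∑ i, MvPolynomial.C (a i) * MvPolynomial.X (Sum.inr i)) ^ p, fun z w => ?_⟩
  simp only [rankOneOp, LinearMap.smulRight_apply, evalAt_apply, coh_val, Submodule.coe_smul,
    MvPolynomial.smul_eval, map_pow, eval_lin, map_mul, map_sum, MvPolynomial.eval_C,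
    MvPolynomial.eval_X, Sum.elim_inl, Sum.elim_inr, mul_pow]
  rw [dotProduct_comm z b]
  rfl

theorem coh_smul (p : ℕ) (r : ℂ) (a : Fin 3 → ℂ) : coh p (r • a) = r ^ p • coh p a := by
  apply Subtype.ext
  rw [coh_val, lin_smul, mul_pow, Submodule.coe_smul, coh_val, ← map_pow,
    MvPolynomial.C_mul']

theorem eval_smul_H {p : ℕ} (r : ℂ) (b : Fin 3 → ℂ) (f : H p) :
    eval (r • b) f.1 = r ^ p * eval b f.1 := by
  have : f ∈ Submodule.span ℂ (Set.range (coh p)) := by rw [span_coh]; trivial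
  induction this using Submodule.span_induction with
  | mem x hx => obtain ⟨a, rfl⟩ := hx; simp [mul_pow]
  | zero => simp
  | add x y _ _ hx hy => simp [hx, hy, mul_add]
  | smul s x _ hx => simp only [Submodule.coe_smul, MvPolynomial.smul_eval, hx]; ring

/-- An operator is determined by its symbol `tr (A Π^g)`. -/
theorem eq_zero_of_symbol_eq_zero {p : ℕ} (A : Module.End ℂ (H p))
    (h : ∀ g : SU3, eval (colBar g) (A (coh p (col g))).1 = 0) : A = 0 := by
  obtain ⟨F, hF⟩ := exists_polynomial_coh A
  -- The hypothesis covers only `w = z̄` with `z` a unit vector. Homogeneity removes the second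
  -- restriction, and independence of `z` and `z̄` the first.
  have hF0 : F = 0 := by
    apply eq_zero_of_eval_conj
    intro z
    obtain ⟨r, g, rfl⟩ := exists_smul_col z
    rw [hF, coh_smul, map_smul]
    have : (fun i => starRingEnd ℂ (((r : ℂ) • col g) i)) = (r : ℂ) • colBar g := by
      ext i; simp [col, colBar]
    rw [this, Submodule.coe_smul, MvPolynomial.smul_eval, eval_smul_H, h, mul_zero, mul_zero]
  apply end_ext_coh
  intro a
  apply ext_evalAt
  intro b
  rw [← hF, hF0]
  simp

/-- Monomials are the weight vectors of the diagonal torus. -/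
theorem coeff_subst_diagonal (t : Fin 3 → ℂ) (f : MvPolynomial (Fin 3) ℂ) (c : Fin 3 →₀ ℕ) :
    (subst (Matrix.diagonal t) f).coeff c = (∏ i, t i ^ c i) * f.coeff c := by
  classical
  have hX : ∀ j, ∑ i, MvPolynomial.C (Matrix.diagonal t i j) * MvPolynomial.X i
      = (MvPolynomial.C (t j) * MvPolynomial.X j : MvPolynomial (Fin 3) ℂ) := by
    intro j
    rw [Finset.sum_eq_single j]
    · simp
    · intro i _ hi; simp [Matrix.diagonal_apply_ne _ hi]
    · simp
  induction f using MvPolynomial.induction_on' with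
  | monomial d r =>
    have : subst (Matrix.diagonal t) (MvPolynomial.monomial d r)
        = MvPolynomial.monomial d ((∏ i, t i ^ d i) * r) := by
      rw [subst, MvPolynomial.aeval_monomial, Finsupp.prod_fintype _ _ (by simp)]
      simp only [hX, mul_pow, Finset.prod_mul_distrib]
      rw [MvPolynomial.monomial_eq, Finsupp.prod_fintype _ _ (by simp)]
      simp only [MvPolynomial.algebraMap_eq, map_mul, map_prod, map_pow]
      ring
    rw [this, MvPolynomial.coeff_monomial, MvPolynomial.coeff_monomial]
    split_ifs with hdc
    · rw [hdc]
    · rw [mul_zero]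
  | add f g hf hg => rw [map_add, MvPolynomial.coeff_add, hf, hg, MvPolynomial.coeff_add, mul_add]

/-- A functional on operators which is invariant under conjugation is a multiple of the trace. -/
theorem exists_eq_smul_trace {p : ℕ} (τ : Module.End ℂ (H p) →ₗ[ℂ] ℂ)
    (hτ : ∀ g A, τ (conj g A) = τ A) : ∃ m : ℂ, ∀ A, τ A = m * LinearMap.trace ℂ (H p) A := by
  let e0 : Fin 3 → ℂ := Pi.single 0 1
  -- By biduality the values of `τ` on operators with image in the highest weight line are those of
  -- a form `h` in the evaluation point.
  let Ψ : Module.Dual ℂ (Module.Dual ℂ (H p)) :=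
    { toFun := fun φ => τ (LinearMap.smulRight φ (coh p e0))
      map_add' := fun φ ψ => by
        rw [← map_add]; congr 1; ext1 x; simp [add_smul]
      map_smul' := fun r φ => by
        rw [RingHom.id_apply, ← map_smul]; congr 1; ext1 x; simp [mul_smul] }
  let h := (Module.evalEquiv ℂ (H p)).symm Ψ
  have hh : ∀ b, eval b h.1 = τ (rankOneOp p e0 b) := by
    intro b
    have h2 : evalAt p b ((Module.evalEquiv ℂ (H p)).symm Ψ) = Ψ (evalAt p b) :=
      Module.apply_evalEquiv_symm_apply ℂ (H p) (evalAt p b) Ψ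
    rw [evalAt_apply] at h2
    exact h2
  have hrank : ∀ (r : ℂ) (a b : Fin 3 → ℂ), rankOneOp p (r • a) b = r ^ p • rankOneOp p a b := by
    intro r a b
    ext1 f
    simp only [rankOneOp, coh_smul, LinearMap.smulRight_apply, LinearMap.smul_apply]
    rw [smul_comm]
  -- Torus invariance leaves only the monomial `X₀^p` in `h`, since all other monomials of degree
  -- `p` have a different weight.
  have hcoef : ∀ c : Fin 3 →₀ ℕ, c ≠ Finsupp.single 0 p → h.1.coeff c = 0 := by
    intro c hc
    by_cases hd : c.degree = p
    swap
    · exact h.2.coeff_eq_zero hd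
    let δ : Fin 3 → ℤ := fun i => (c i : ℤ) - (Finsupp.single (0 : Fin 3) p i : ℕ)
    have hδ0 : ∑ i, δ i = 0 := by
      rw [Finsupp.degree_eq_sum] at hd
      simp only [δ, Finset.sum_sub_distrib, ← Nat.cast_sum, hd]
      simp [Finsupp.single_apply]
    have hδ : δ ≠ 0 := by
      intro h0
      apply hc
      ext i
      have := congrFun h0 i
      simp only [δ, Pi.zero_apply] at this
      omega
    obtain ⟨θ, hθ, hne⟩ := exists_torus_ne_one hδ0 hδ
    set t := torus θ hθ with ht
    have hpoly : h.1 = MvPolynomial.C (Complex.exp (Complex.I * θ 0) ^ p) * subst (t⁻¹).1 h.1 := by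
      apply MvPolynomial.funext
      intro b
      rw [map_mul, MvPolynomial.eval_C, eval_subst, hh, hh, ← hτ t, conj_rankOneOp]
      have : t.1.mulVec e0 = Complex.exp (Complex.I * θ 0) • e0 := by
        rw [ht, torus_val]
        ext i
        fin_cases i <;> simp [e0, Matrix.mulVec_diagonal]
      rw [this, hrank, map_smul, smul_eq_mul]
    have hcc := congrArg (fun f => MvPolynomial.coeff c f) hpoly
    simp only [MvPolynomial.coeff_C_mul] at hcc
    rw [ht, torus_inv_val, coeff_subst_diagonal] at hcc
    have hprod : Complex.exp (Complex.I * θ 0) ^ p *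
        ∏ i, Complex.exp (-(Complex.I * θ i)) ^ c i
        = (Complex.exp (Complex.I * ∑ i, (θ i : ℂ) * (δ i : ℂ)))⁻¹ := by
      simp only [← Complex.exp_nat_mul, ← Complex.exp_sum, ← Complex.exp_neg, ← Complex.exp_add]
      congr 1
      simp [δ, Fin.sum_univ_three, Finsupp.single_apply]
      ring
    rw [← mul_assoc, hprod] at hcc
    by_contra hne0
    apply hne
    have : (Complex.exp (Complex.I * ∑ i, (θ i : ℂ) * (δ i : ℂ)))⁻¹ = 1 := by
      field_simp at hcc
      rw [hcc, inv_one]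
    exact inv_eq_one.1 this
  set m := h.1.coeff (Finsupp.single 0 p) with hm
  have hval : ∀ b, eval b h.1 = m * b 0 ^ p := by
    intro b
    have : h.1 = MvPolynomial.monomial (Finsupp.single 0 p) m := by
      ext c
      rw [MvPolynomial.coeff_monomial]
      split_ifs with hc
      · rw [hm, hc]
      · exact hcoef c (Ne.symm hc)
    rw [this, MvPolynomial.eval_monomial, Finsupp.prod_single_index (by simp)]
  refine ⟨m, fun A => ?_⟩
  let S : Submodule ℂ (Module.End ℂ (H p)) :=
    LinearMap.ker (τ - m • LinearMap.trace ℂ (H p))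
  have hA : A ∈ S := by
    refine end_induction S (fun a b => ?_) A
    rw [LinearMap.mem_ker, LinearMap.sub_apply, LinearMap.smul_apply, trace_rankOneOp,
      smul_eq_mul, sub_eq_zero]
    -- Transitivity on unit vectors moves `a` to `e₀`. The remaining value `m (bg)₀^p` is `m
    -- (a·b)^p`, up to the scaling of `a`, and this is `m` times the trace.
    obtain ⟨r, g, rfl⟩ := exists_smul_col a
    have h1 : g.1.mulVec e0 = col g := by
      ext i; simp [col, e0]
    have h2 : rankOneOp p (col g) b = conj g (rankOneOp p e0 (Matrix.vecMul b g.1)) := by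
      rw [conj_rankOneOp, h1, Matrix.vecMul_vecMul, mul_inv_val, Matrix.vecMul_one]
    rw [hrank, map_smul, h2, hτ, ← hh, hval, smul_eq_mul, smul_dotProduct, smul_eq_mul, mul_pow]
    have h3 : Matrix.vecMul b g.1 0 = col g ⬝ᵥ b := by
      simp [Matrix.vecMul, dotProduct, col, mul_comm]
    rw [h3]; ring
  rw [LinearMap.mem_ker, LinearMap.sub_apply, LinearMap.smul_apply, sub_eq_zero] at hA
  exact hA


/-! ### Spanning by powers of nilpotent elements of rank one -/

section Spanning

variable {A : Type*} [CommRing A] [Algebra ℂ A]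

/-- If a polynomial curve stays in a linear subspace, so does its derivative at `0`. -/
theorem derivative_eval_zero_mem (S : Submodule ℂ A) (P : Polynomial A)
    (h : ∀ t : ℂ, P.eval (algebraMap ℂ A t) ∈ S) : (Polynomial.derivative P).eval 0 ∈ S := by
  by_contra hne
  obtain ⟨φ, hφ, hker⟩ := Submodule.exists_le_ker_of_notMem hne
  apply hφ
  -- Apply `φ` to the coefficients of `P`: the result vanishes as a function of `t`, and its linear
  -- coefficient is `φ` of the derivative at `0`. The bound `natDegree + 2` makes the index `1`
  -- occur even for constant `P`.
  let Q : Polynomial ℂ := ∑ i ∈ Finset.range (P.natDegree + 2),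
    Polynomial.monomial i (φ (P.coeff i))
  have hQ : Q = 0 := by
    apply Polynomial.funext
    intro t
    have h1 : φ (P.eval (algebraMap ℂ A t)) = 0 := hker (h t)
    rw [Polynomial.eval_eq_sum_range' (show P.natDegree < P.natDegree + 2 by omega), map_sum] at h1
    rw [Polynomial.eval_zero, ← h1, Polynomial.eval_finsetSum]
    refine Finset.sum_congr rfl fun i _ => ?_
    rw [Polynomial.eval_monomial, ← map_pow, mul_comm (P.coeff i), ← Algebra.smul_def, map_smul,
      smul_eq_mul, mul_comm]
  have h2 : Q.coeff 1 = φ (P.coeff 1) := by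
    simp only [Q, Polynomial.finsetSum_coeff, Polynomial.coeff_monomial]
    rw [Finset.sum_ite_eq' (Finset.range _) 1, if_pos (by simp)]
  rw [← Polynomial.coeff_zero_eq_eval_zero, Polynomial.coeff_derivative]
  simp [← h2, hQ]

/-- `z`, `w` are dual systems of coordinates, and the subspace `S` contains the powers up to `m`
of the products `(b·z)(a·w)` with `a·b = 0`. -/
structure Frame (S : Submodule ℂ A) (m : ℕ) (z0 z1 z2 w0 w1 w2 : A) : Prop where
  sum_eq : z0 * w0 + z1 * w1 + z2 * w2 = 1
  mem : ∀ j ≤ m, ∀ a0 a1 a2 b0 b1 b2 : ℂ, a0 * b0 + a1 * b1 + a2 * b2 = 0 →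
    ((b0 • z0 + b1 • z1 + b2 • z2) * (a0 • w0 + a1 • w1 + a2 • w2)) ^ j ∈ S

namespace Frame

variable {S : Submodule ℂ A} {m : ℕ} {z0 z1 z2 w0 w1 w2 : A}

theorem mono {n : ℕ} (h : Frame S m z0 z1 z2 w0 w1 w2) (hn : n ≤ m) :
    Frame S n z0 z1 z2 w0 w1 w2 :=
  ⟨h.1, fun j hj => h.2 j (hj.trans hn)⟩

/-- Dual unipotent changes of coordinates preserve both the relation and the pairing `a·b`, with the
same `S`. Differentiating in `t` at `0` then lets root vectors of `sl(3)` act on members of `S`. -/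
theorem shift21 (h : Frame S m z0 z1 z2 w0 w1 w2) (t : ℂ) :
    Frame S m z0 z1 (z2 + t • z1) w0 (w1 - t • w2) w2 := by
  refine ⟨?_, fun j hj a0 a1 a2 b0 b1 b2 hab => ?_⟩
  · rw [← h.sum_eq]; simp only [Algebra.smul_def]; ring
  · convert h.mem j hj a0 a1 (a2 - t * a1) b0 (b1 + t * b2) b2 (by linear_combination hab) using 2
    simp only [Algebra.smul_def, map_sub, map_add, map_mul]; ring

theorem shift10 (h : Frame S m z0 z1 z2 w0 w1 w2) (t : ℂ) :
    Frame S m z0 (z1 - t • z0) z2 (w0 + t • w1) w1 w2 := by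
  refine ⟨?_, fun j hj a0 a1 a2 b0 b1 b2 hab => ?_⟩
  · rw [← h.sum_eq]; simp only [Algebra.smul_def]; ring
  · convert h.mem j hj a0 (a1 + t * a0) a2 (b0 - t * b1) b1 b2 (by linear_combination hab) using 2
    simp only [Algebra.smul_def, map_sub, map_add, map_mul]; ring

theorem shift20 (h : Frame S m z0 z1 z2 w0 w1 w2) (t : ℂ) :
    Frame S m z0 z1 (z2 + t • z0) (w0 - t • w2) w1 w2 := by
  refine ⟨?_, fun j hj a0 a1 a2 b0 b1 b2 hab => ?_⟩
  · rw [← h.sum_eq]; simp only [Algebra.smul_def]; ring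
  · convert h.mem j hj a0 a1 (a2 - t * a0) (b0 + t * b2) b1 b2 (by linear_combination hab) using 2
    simp only [Algebra.smul_def, map_sub, map_add, map_mul]; ring

theorem of_natCast_mul {n : ℕ} (hn : n ≠ 0) {x : A} (h : (n : A) * x ∈ S) : x ∈ S := by
  have h1 : ((n : ℂ)⁻¹) • ((n : A) * x) ∈ S := S.smul_mem _ h
  rwa [show ((n : A) * x) = (n : ℂ) • x by rw [Algebra.smul_def, map_natCast], smul_smul,
    inv_mul_cancel₀ (Nat.cast_ne_zero.2 hn), one_smul] at h1

theorem natCast_mul_mem (n : ℕ) {x : A} (h : x ∈ S) : (n : A) * x ∈ S := by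
  rw [show ((n : A) * x) = (n : ℂ) • x by rw [Algebra.smul_def, map_natCast]]
  exact S.smul_mem _ h

theorem mem20 (h : Frame S m z0 z1 z2 w0 w1 w2) {j : ℕ} (hj : j ≤ m) : z2 ^ j * w0 ^ j ∈ S := by
  have := h.mem j hj 1 0 0 0 0 1 (by norm_num)
  simpa [mul_pow] using this

open Polynomial in
theorem mem10 {k : ℕ} (h : Frame S (k + 1) z0 z1 z2 w0 w1 w2) :
    z2 ^ k * w0 ^ k * (z1 * w0) ∈ S := by
  have := derivative_eval_zero_mem S ((C z2 + X * C z1) ^ (k + 1) * C (w0 ^ (k + 1))) fun t => by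
    have := (h.shift21 t).mem20 le_rfl
    simp only [Algebra.smul_def] at this
    convert this using 1
    simp; ring
  apply of_natCast_mul (n := k + 1) (by omega)
  convert this using 1
  simp [derivative_pow]
  ring

open Polynomial in
theorem mem21 {k : ℕ} (h : Frame S (k + 1) z0 z1 z2 w0 w1 w2) :
    z2 ^ k * w0 ^ k * (z2 * w1) ∈ S := by
  have := derivative_eval_zero_mem S (C (z2 ^ (k + 1)) * (C w0 + X * C w1) ^ (k + 1)) fun t => by
    have := (h.shift10 t).mem20 le_rfl
    simp only [Algebra.smul_def] at this
    convert this using 1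
    simp; ring
  apply of_natCast_mul (n := k + 1) (by omega)
  convert this using 1
  simp [derivative_pow]
  ring

open Polynomial in
-- The three diagonal products satisfy three independent linear relations modulo `S`: two are
-- derivatives along root directions, and the third comes from `∑ z i w i = 1`.
theorem mem_diag_aux {k : ℕ} (h : Frame S (k + 1) z0 z1 z2 w0 w1 w2) :
    z2 ^ k * w0 ^ k * (z0 * w0) ∈ S ∧ z2 ^ k * w0 ^ k * (z1 * w1) ∈ S ∧
      z2 ^ k * w0 ^ k * (z2 * w2) ∈ S := by
  have h1 : z2 ^ k * w0 ^ k * (z0 * w0) - z2 ^ k * w0 ^ k * (z2 * w2) ∈ S := by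
    have := derivative_eval_zero_mem S
      ((C z2 + X * C z0) ^ (k + 1) * (C w0 - X * C w2) ^ (k + 1)) fun t => by
        have := (h.shift20 t).mem20 le_rfl
        simp only [Algebra.smul_def] at this
        convert this using 1
        simp; ring
    apply of_natCast_mul (n := k + 1) (by omega)
    convert this using 1
    simp [derivative_pow]
    ring
  have h2 : ((k + 1 : ℕ) : A) * (z2 ^ k * w0 ^ k * (z1 * w1)) - z2 ^ k * w0 ^ k * (z0 * w0)
      ∈ S := by
    have := derivative_eval_zero_mem S
      (C (z2 ^ k) * (C z1 - X * C z0) * (C w0 + X * C w1) ^ (k + 1)) fun t => by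
        have := (h.shift10 t).mem10
        simp only [Algebra.smul_def] at this
        convert this using 1
        simp; ring
    convert this using 1
    simp [derivative_pow]
    ring
  have h3 : z2 ^ k * w0 ^ k * (z0 * w0) + z2 ^ k * w0 ^ k * (z1 * w1)
      + z2 ^ k * w0 ^ k * (z2 * w2) ∈ S := by
    have := h.mem20 (Nat.le_succ k)
    convert this using 1
    linear_combination (z2 ^ k * w0 ^ k) * h.sum_eq
  have h0 : z2 ^ k * w0 ^ k * (z0 * w0) ∈ S := by
    -- Eliminating the other two unknowns leaves `z0 * w0` with the factor `2k + 3`, which is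
    -- invertible.
    apply of_natCast_mul (n := 2 * (k + 1) + 1) (by omega)
    have := S.add_mem (S.sub_mem (natCast_mul_mem (k + 1) h3) h2) (natCast_mul_mem (k + 1) h1)
    convert this using 1
    push_cast; ring
  refine ⟨h0, ?_, ?_⟩
  · apply of_natCast_mul (n := k + 1) (by omega)
    convert S.add_mem h2 h0 using 1
    ring
  · convert S.sub_mem h0 h1 using 1
    ring

open Polynomial in
theorem mem12 {k : ℕ} (h : Frame S (k + 1) z0 z1 z2 w0 w1 w2) :
    z2 ^ k * w0 ^ k * (z1 * w2) ∈ S := by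
  have := derivative_eval_zero_mem S
    ((C z2 + X * C z1) ^ (k + 1) * C (w2 * w0 ^ k)) fun t => by
      have := (h.shift21 t).mem_diag_aux.2.2
      simp only [Algebra.smul_def] at this
      convert this using 1
      simp; ring
  apply of_natCast_mul (n := k + 1) (by omega)
  convert this using 1
  simp [derivative_pow]
  ring

open Polynomial in
theorem mem01 {k : ℕ} (h : Frame S (k + 1) z0 z1 z2 w0 w1 w2) :
    z2 ^ k * w0 ^ k * (z0 * w1) ∈ S := by
  have := derivative_eval_zero_mem S
    (C (z2 ^ k * z0) * (C w0 + X * C w1) ^ (k + 1)) fun t => by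
      have := (h.shift10 t).mem_diag_aux.1
      simp only [Algebra.smul_def] at this
      convert this using 1
      simp; ring
  apply of_natCast_mul (n := k + 1) (by omega)
  convert this using 1
  simp [derivative_pow]
  ring

open Polynomial in
-- For positive exponent this product, the one with `z1 * w1 * w2` and the one with `w2 ^ 2` again
-- satisfy three relations modulo `S`; elimination leaves a nonzero integer factor. For exponent `0`
-- the product `z0 * w2` is itself nilpotent.
theorem mem02 {k : ℕ} (h : Frame S (k + 1) z0 z1 z2 w0 w1 w2) :
    z2 ^ k * w0 ^ k * (z0 * w2) ∈ S := by
  rcases k with _ | k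
  · have := h.mem 1 (by omega) 0 0 1 1 0 0 (by norm_num)
    simpa using this
  have h1 : ((k + 2 : ℕ) : A) * (z2 ^ (k + 1) * w0 ^ (k + 1) * (z0 * w2))
      - ((k + 1 : ℕ) : A) * (z2 ^ (k + 2) * w0 ^ k * w2 ^ 2) ∈ S := by
    have := derivative_eval_zero_mem S
      ((C z2 + X * C z0) ^ (k + 2) * C w2 * (C w0 - X * C w2) ^ (k + 1)) fun t => by
        have := (h.shift20 t).mem_diag_aux.2.2
        simp only [Algebra.smul_def] at this
        convert this using 1
        simp; ring
    convert this using 1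
    simp [derivative_pow]
    ring
  have h2 : ((k + 1 : ℕ) : A) * (z2 ^ (k + 1) * w0 ^ k * (z1 * w1 * w2))
      - z2 ^ (k + 1) * w0 ^ (k + 1) * (z0 * w2) ∈ S := by
    have := derivative_eval_zero_mem S
      (C (z2 ^ (k + 1) * w2) * (C z1 - X * C z0) * (C w0 + X * C w1) ^ (k + 1)) fun t => by
        have := (h.shift10 t).mem12
        simp only [Algebra.smul_def] at this
        convert this using 1
        simp; ring
    convert this using 1
    simp [derivative_pow]
    ring
  have h3 : z2 ^ (k + 1) * w0 ^ (k + 1) * (z0 * w2) + z2 ^ (k + 1) * w0 ^ k * (z1 * w1 * w2)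
      + z2 ^ (k + 2) * w0 ^ k * w2 ^ 2 ∈ S := by
    have := (h.mono (Nat.le_succ (k + 1))).mem_diag_aux.2.2
    convert this using 1
    linear_combination (z2 ^ (k + 1) * w0 ^ k * w2) * h.sum_eq
  apply of_natCast_mul (n := 2 * (k + 2)) (by omega)
  have := S.add_mem (S.sub_mem (natCast_mul_mem (k + 1) h3) h2) h1
  convert this using 1
  push_cast; ring

/-- The product of the summand `(k,k)` with linear functions, tested on a highest weight vector
only; other vectors are reached by changing the frame. -/
theorem mul_mem {k : ℕ} (h : Frame S (k + 1) z0 z1 z2 w0 w1 w2) (i j : Fin 3) :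
    z2 ^ k * w0 ^ k * (![z0, z1, z2] i * ![w0, w1, w2] j) ∈ S := by
  have h20 : z2 ^ k * w0 ^ k * (z2 * w0) ∈ S := by
    convert h.mem20 le_rfl using 1
    ring
  fin_cases i <;> fin_cases j
  · exact h.mem_diag_aux.1
  · exact h.mem01
  · exact h.mem02
  · exact h.mem10
  · exact h.mem_diag_aux.2.1
  · exact h.mem12
  · exact h20
  · exact h.mem21
  · exact h.mem_diag_aux.2.2

end Frame

/-- The product `(b·z)(a·w)`. -/
def bil (z w : Fin 3 → A) (a b : Fin 3 → ℂ) : A := (∑ i, b i • z i) * ∑ i, a i • w i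

/-- The span of the powers `((b·z)(a·w)) ^ k` with `k ≤ n`, `a·b = 0`. -/
def harmSpan (z w : Fin 3 → A) (n : ℕ) : Submodule ℂ A :=
  Submodule.span ℂ {x | ∃ k ≤ n, ∃ a b : Fin 3 → ℂ, a ⬝ᵥ b = 0 ∧ x = bil z w a b ^ k}

theorem bil_pow_mem_harmSpan (z w : Fin 3 → A) {n k : ℕ} (hk : k ≤ n) {a b : Fin 3 → ℂ}
    (hab : a ⬝ᵥ b = 0) : bil z w a b ^ k ∈ harmSpan z w n :=
  Submodule.subset_span ⟨k, hk, a, b, hab, rfl⟩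

theorem harmSpan_mono (z w : Fin 3 → A) {n m : ℕ} (h : n ≤ m) :
    harmSpan z w n ≤ harmSpan z w m := by
  apply Submodule.span_mono
  rintro _ ⟨k, hk, a, b, hab, rfl⟩
  exact ⟨k, hk.trans h, a, b, hab, rfl⟩

/-- Two orthogonal non-zero vectors extend to dual bases. -/
theorem exists_dual_bases {a b : Fin 3 → ℂ} (ha : a ≠ 0) (hb : b ≠ 0) (hab : a ⬝ᵥ b = 0) :
    ∃ M N : Matrix (Fin 3) (Fin 3) ℂ, M 0 = a ∧ N 2 = b ∧ N * M.transpose = 1 := by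
  obtain ⟨i, hi⟩ := Function.ne_iff.1 ha
  obtain ⟨j, hj⟩ := Function.ne_iff.1 hb
  simp only [Pi.zero_apply] at hi hj
  let β : Fin 3 → ℂ := Pi.single i (a i)⁻¹
  have hβ : β ⬝ᵥ a = 1 := by simp [β, hi]
  let α' : Fin 3 → ℂ := Pi.single j (b j)⁻¹
  have hα' : α' ⬝ᵥ b = 1 := by simp [α', hj]
  let α : Fin 3 → ℂ := α' - (β ⬝ᵥ α') • a
  have hα : α ⬝ᵥ b = 1 := by simp [α, sub_dotProduct, hα', hab]
  have hαβ : β ⬝ᵥ α = 0 := by simp [α, dotProduct_sub, hβ]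
  clear_value α β
  -- The outer vectors pair as `β·a = α·b = 1` and `a·b = β·α = 0`. Cross products supply the middle
  -- ones, and Lagrange's identity gives their pairing `1`.
  refine ⟨Matrix.of ![a, crossProduct β b, α], Matrix.of ![β, crossProduct a α, b],
    rfl, rfl, ?_⟩
  have hcc : (crossProduct a α) ⬝ᵥ (crossProduct β b) = 1 := by
    rw [cross_dot_cross, hab, dotProduct_comm a β, hβ, hα]; ring
  rw [dotProduct_comm] at hα
  have hab' : b ⬝ᵥ a = 0 := by rw [dotProduct_comm, hab]
  ext k l
  rw [Matrix.mul_apply']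
  change (![β, crossProduct a α, b] k) ⬝ᵥ (![a, crossProduct β b, α] l) = _
  fin_cases k <;> fin_cases l
  · simpa using hβ
  · simp
  · simpa using hαβ
  · simp [dotProduct_comm]
  · simp [hcc]
  · simp [dotProduct_comm]
  · simpa using hab'
  · simp
  · simpa using hα

/-- In dual coordinates adapted to `a` and `b` the product `bil` becomes `Z 2 * W 0`, while `z i * w
j` expands into the nine products treated by `Frame.mul_mem`. -/
theorem mul_bil_pow_mem_harmSpan {z w : Fin 3 → A} (h : ∑ i, z i * w i = 1) (k : ℕ)
    {a b : Fin 3 → ℂ} (hab : a ⬝ᵥ b = 0) (i j : Fin 3) :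
    bil z w a b ^ k * (z i * w j) ∈ harmSpan z w (k + 1) := by
  have key : ∀ a b : Fin 3 → ℂ, a ≠ 0 → b ≠ 0 → a ⬝ᵥ b = 0 →
      bil z w a b ^ k * (z i * w j) ∈ harmSpan z w (k + 1) := by
    intro a b ha hb hab
    obtain ⟨M, N, hM, hN, hNM⟩ := exists_dual_bases ha hb hab
    have hMN : M.transpose * N = 1 := mul_eq_one_comm.1 hNM
    let Z : Fin 3 → A := fun p => ∑ q, N p q • z q
    let W : Fin 3 → A := fun p => ∑ q, M p q • w q
    have hMN' : ∀ q r, ∑ p, M p q * N p r = if q = r then 1 else 0 := by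
      intro q r
      have := congrFun (congrFun hMN q) r
      simpa [Matrix.mul_apply, Matrix.one_apply] using this
    have hNM' : ∀ q r, ∑ p, N q p * M r p = if q = r then 1 else 0 := by
      intro q r
      have := congrFun (congrFun hNM q) r
      simpa [Matrix.mul_apply, Matrix.one_apply] using this
    have hz : ∀ q, z q = ∑ p, M p q • Z p := by
      intro q
      simp only [Z, Finset.smul_sum, smul_smul]
      rw [Finset.sum_comm]
      simp only [← Finset.sum_smul, hMN']
      simp
    have hw : ∀ q, w q = ∑ p, N p q • W p := by
      intro q
      simp only [W, Finset.smul_sum, smul_smul]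
      rw [Finset.sum_comm]
      simp only [← Finset.sum_smul, mul_comm (N _ _), hMN']
      simp
    have hframe : Frame (harmSpan z w (k + 1)) (k + 1) (Z 0) (Z 1) (Z 2) (W 0) (W 1) (W 2) := by
      refine ⟨?_, fun l hl a0 a1 a2 b0 b1 b2 hab => ?_⟩
      · rw [← h]
        have : ∑ p, Z p * W p = ∑ q, z q * w q := by
          simp only [hz, Finset.sum_mul]
          rw [Finset.sum_comm]
          refine Finset.sum_congr rfl fun p _ => ?_
          simp only [smul_mul_assoc, W, Finset.mul_sum, mul_smul_comm]
        rw [Fin.sum_univ_three] at this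
        exact this
      · have hdot : (fun q => ∑ p, ![a0, a1, a2] p * M p q) ⬝ᵥ
            (fun q => ∑ p, ![b0, b1, b2] p * N p q) = 0 := by
          have h1 : ∀ p r, ∑ q, M p q * N r q = if r = p then 1 else 0 := by
            intro p r; rw [← hNM' r p]; exact Finset.sum_congr rfl fun _ _ => mul_comm _ _
          have e : (fun q => ∑ p, ![a0, a1, a2] p * M p q) = Matrix.vecMul ![a0, a1, a2] M := rfl
          have e' : (fun q => ∑ p, ![b0, b1, b2] p * N p q)
              = Matrix.mulVec N.transpose ![b0, b1, b2] := by
            ext q; simp [Matrix.mulVec, dotProduct, mul_comm]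
          rw [e, e', Matrix.dotProduct_mulVec, Matrix.vecMul_vecMul]
          have : M * N.transpose = 1 := by
            rw [← Matrix.transpose_transpose M, ← Matrix.transpose_mul, hNM,
              Matrix.transpose_one]
          rw [this, Matrix.vecMul_one]
          simpa [dotProduct, Fin.sum_univ_three] using hab
        convert bil_pow_mem_harmSpan z w hl hdot using 2
        simp only [bil, Z, W, Fin.sum_univ_three, smul_smul,
          Matrix.cons_val_zero, Matrix.cons_val_one, Matrix.cons_val_two, Matrix.head_cons,
          Matrix.tail_cons, add_smul, smul_add]
        congr 1 <;> abel
    have hb : bil z w a b = Z 2 * W 0 := by simp only [bil, Z, W, hM, hN]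
    have hexp : bil z w a b ^ k * (z i * w j)
        = ∑ p, ∑ q, (Z 2 * W 0) ^ k * ((M p i • Z p) * (N q j • W q)) := by
      have e : z i * w j = ∑ p, ∑ q, (M p i • Z p) * (N q j • W q) := by
        rw [hz i, hw j]; exact Finset.sum_mul_sum _ _ _ _
      rw [hb, e, Finset.mul_sum]
      refine Finset.sum_congr rfl fun p _ => ?_
      rw [Finset.mul_sum]
    rw [hexp]
    refine Submodule.sum_mem _ fun p _ => Submodule.sum_mem _ fun q _ => ?_
    have h1 := hframe.mul_mem p q
    have h2 : ![Z 0, Z 1, Z 2] p = Z p := by fin_cases p <;> rfl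
    have h3 : ![W 0, W 1, W 2] q = W q := by fin_cases q <;> rfl
    rw [h2, h3] at h1
    rw [smul_mul_smul_comm, mul_smul_comm, mul_pow]
    exact Submodule.smul_mem _ _ h1
  -- Without adapted coordinates only the power `k = 0` is not trivially zero, and it does not
  -- depend on the orthogonal pair.
  by_cases hzero : a = 0 ∨ b = 0
  · have hbil : bil z w a b = 0 := by
      rcases hzero with rfl | rfl <;> simp [bil]
    rcases k with _ | k
    · have := key ![1, 0, 0] ![0, 1, 0] (fun h => by simpa using congrFun h 0)
        (fun h => by simpa using congrFun h 1) (by simp)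
      simpa using this
    · rw [hbil, zero_pow (by omega), zero_mul]; exact Submodule.zero_mem _
  · push Not at hzero
    exact key a b hzero.1 hzero.2 hab

theorem mul_mem_harmSpan {z w : Fin 3 → A} (h : ∑ i, z i * w i = 1) {n : ℕ} {x : A}
    (hx : x ∈ harmSpan z w n) (i j : Fin 3) : x * (z i * w j) ∈ harmSpan z w (n + 1) := by
  induction hx using Submodule.span_induction with
  | mem x hx =>
    obtain ⟨k, hk, a, b, hab, rfl⟩ := hx
    exact harmSpan_mono z w (by omega) (mul_bil_pow_mem_harmSpan h k hab i j)
  | zero => rw [zero_mul]; exact Submodule.zero_mem _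
  | add x y _ _ hx hy => rw [add_mul]; exact Submodule.add_mem _ hx hy
  | smul r x _ hx => rw [smul_mul_assoc]; exact Submodule.smul_mem _ _ hx

end Spanning


/-! ### Functions on the orbit -/

theorem sqrt_two_sq : ((√2 : ℝ) : ℂ) * ((√2 : ℝ) : ℂ) = 2 := by
  rw [← Complex.ofReal_mul, Real.mul_self_sqrt (by norm_num)]; norm_num

theorem sqrt_six_sq : ((√6 : ℝ) : ℂ) * ((√6 : ℝ) : ℂ) = 6 := by
  rw [← Complex.ofReal_mul, Real.mul_self_sqrt (by norm_num)]; norm_num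

theorem sqrt_three_sq : ((√3 : ℝ) : ℂ) * ((√3 : ℝ) : ℂ) = 3 := by
  rw [← Complex.ofReal_mul, Real.mul_self_sqrt (by norm_num)]; norm_num

theorem sqrt_six_ne : ((√6 : ℝ) : ℂ) ≠ 0 := by
  intro h; have := sqrt_six_sq; rw [h] at this; norm_num at this

theorem sqrt_two_ne : ((√2 : ℝ) : ℂ) ≠ 0 := by
  intro h; have := sqrt_two_sq; rw [h] at this; norm_num at this

theorem sqrt_three_ne : ((√3 : ℝ) : ℂ) ≠ 0 := by
  intro h; have := sqrt_three_sq; rw [h] at this; norm_num at this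

theorem gellMann_conjTranspose (j : Fin 8) : (gellMann j).conjTranspose = gellMann j := by
  ext a b
  fin_cases j <;> fin_cases a <;> fin_cases b <;> simp [gellMann]

theorem E_conjTranspose (j : Fin 8) : (E j).conjTranspose = -E j := by
  rw [E, Matrix.conjTranspose_smul, gellMann_conjTranspose, ← neg_smul]
  congr 1
  simp [neg_div]

theorem coord_eq (j : Fin 8) (X : Matrix (Fin 3) (Fin 3) ℂ) : coord j X = -(E j * X).trace := by
  rw [coord, E_conjTranspose, neg_mul, Matrix.trace_neg]

theorem trace_E (j : Fin 8) : (E j).trace = 0 := by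
  rw [E, Matrix.trace_smul]
  have : (gellMann j).trace = 0 := by
    rw [Matrix.trace_fin_three]
    fin_cases j <;> simp [gellMann]
    ring
  rw [this, smul_zero]

/-- Clears `√2`, which occurs quadratically, before entries are compared. -/
theorem E_smul_E (j : Fin 8) (X : Matrix (Fin 3) (Fin 3) ℂ) :
    (E j * X).trace • E j = -((1 / 2 : ℂ) * (gellMann j * X).trace) • gellMann j := by
  rw [E, smul_mul_assoc, Matrix.trace_smul, smul_smul, smul_eq_mul]
  congr 1
  have := sqrt_two_sq
  have h2 := sqrt_two_ne
  field_simp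
  rw [Complex.I_sq, sq, sqrt_two_sq]
  ring

/-- The Gell-Mann matrices span the traceless matrices. -/
theorem sum_trace_smul_E (X : Matrix (Fin 3) (Fin 3) ℂ) :
    ∑ j, (E j * X).trace • E j = (X.trace / 3) • 1 - X := by
  simp only [E_smul_E]
  have h3 := sqrt_three_sq
  have h3' : (((√3 : ℝ) : ℂ))⁻¹ * (((√3 : ℝ) : ℂ))⁻¹ = 1 / 3 := by
    rw [← mul_inv, h3]; norm_num
  generalize hs : (((√3 : ℝ) : ℂ))⁻¹ = s at h3'
  have hI := Complex.I_mul_I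
  ext a b
  rw [Matrix.sum_apply]
  simp only [Fin.sum_univ_eight, Matrix.smul_apply, Matrix.sub_apply, smul_eq_mul,
    Matrix.trace_fin_three, Matrix.mul_apply, Fin.sum_univ_three]
  fin_cases a <;> fin_cases b <;> simp [gellMann, hs]
  · linear_combination (-(X 0 0 + X 1 1 - 2 * X 2 2) / 2) * h3'
  · linear_combination ((X 0 1 - X 1 0) / 2) * hI
  · linear_combination ((X 0 2 - X 2 0) / 2) * hI
  · linear_combination (-(X 0 1 - X 1 0) / 2) * hI
  · linear_combination (-(X 0 0 + X 1 1 - 2 * X 2 2) / 2) * h3'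
  · linear_combination ((X 1 2 - X 2 1) / 2) * hI
  · linear_combination (-(X 0 2 - X 2 0) / 2) * hI
  · linear_combination (-(X 1 2 - X 2 1) / 2) * hI
  · linear_combination (X 0 0 + X 1 1 - 2 * X 2 2) * h3'

/-- The rank one projection `g e₀₀ g⁻¹` attached to the point `g ξ g⁻¹`. -/
def proj (x : Orbit) : Matrix (Fin 3) (Fin 3) ℂ :=
  (1 / 3 : ℂ) • (1 - (Complex.I * ((√6 : ℝ) : ℂ)) • x.1)

theorem orbit_cases (x : Orbit) : ∃ g : SU3, x = act g base := by
  obtain ⟨g, hg⟩ := x.2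
  exact ⟨g, Subtype.ext hg⟩

theorem act_mul (g h : SU3) (x : Orbit) : act (g * h) x = act g (act h x) := by
  apply Subtype.ext
  simp only [act, mul_inv_rev, Submonoid.coe_mul, mul_assoc]

theorem act_one (x : Orbit) : act 1 x = x := by
  apply Subtype.ext
  simp [act]

/-- The affine expression in `proj` inverts `ξ = (i/√6)(3 e₀₀ - 1)`. -/
theorem proj_base : proj base = Matrix.single 0 0 1 := by
  have h6 := sqrt_six_ne
  ext i j
  simp only [proj, base, xi]
  fin_cases i <;> fin_cases j <;> simp [Matrix.single]
  all_goals (field_simp; rw [Complex.I_sq]; norm_num)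

theorem proj_act (g : SU3) (x : Orbit) : proj (act g x) = g.1 * proj x * g⁻¹.1 := by
  simp only [proj, act, Matrix.mul_smul, Matrix.smul_mul, Matrix.mul_sub, Matrix.sub_mul, mul_one,
    mul_inv_val]

theorem proj_act_base (g : SU3) :
    proj (act g base) = Matrix.vecMulVec (col g) (colBar g) := by
  rw [proj_act, proj_base]
  ext i j
  rw [Matrix.mul_apply, Matrix.vecMulVec_apply]
  simp [Matrix.mul_apply, Matrix.single, inv_apply, col, colBar, Fin.sum_univ_three]

theorem trace_orbit (x : Orbit) : x.1.trace = 0 := by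
  obtain ⟨g, hg⟩ := x.2
  rw [hg, Matrix.trace_mul_cycle, inv_mul_val, one_mul, xi, Matrix.trace_smul,
    Matrix.trace_diagonal]
  simp [Fin.sum_univ_three]
  norm_num

/-- The affine polynomial that restricts to `x ↦ tr (M P)`, for the projection `P` at `x`. -/
def Lpoly (M : Matrix (Fin 3) (Fin 3) ℂ) : MvPolynomial (Fin 8) ℂ :=
  MvPolynomial.C (M.trace / 3) -
    ∑ j, MvPolynomial.C (Complex.I * ((√6 : ℝ) : ℂ) / 3 * (M * E j).trace) * MvPolynomial.X j

theorem restrict_apply (F : MvPolynomial (Fin 8) ℂ) (x : Orbit) :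
    restrict F x = eval (fun j => coord j x.1) F := by
  rw [restrict, ← MvPolynomial.aeval_eq_eval]
  have : (Pi.evalAlgHom ℂ (fun _ : Orbit => ℂ) x).comp
      (MvPolynomial.aeval fun j (x : Orbit) => coord j x.1)
      = MvPolynomial.aeval fun j => coord j x.1 := by
    apply MvPolynomial.algHom_ext; intro j; simp
  exact DFunLike.congr_fun this F

@[simp] theorem toPoly_val (F : MvPolynomial (Fin 8) ℂ) (x : Orbit) :
    (toPoly F).1 x = eval (fun j => coord j x.1) F := restrict_apply F x

theorem sum_coord_smul_E (x : Orbit) : ∑ j, coord j x.1 • E j = x.1 := by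
  have := sum_trace_smul_E x.1
  rw [trace_orbit, zero_div, zero_smul, zero_sub] at this
  simp only [coord_eq, neg_smul, Finset.sum_neg_distrib, this, neg_neg]

/-- The function `x ↦ tr (M P)`. -/
def fpoly (M : Matrix (Fin 3) (Fin 3) ℂ) : PolyOrbit := toPoly (Lpoly M)

theorem fpoly_val (M : Matrix (Fin 3) (Fin 3) ℂ) (x : Orbit) :
    (fpoly M).1 x = (M * proj x).trace := by
  rw [fpoly, toPoly_val]
  have h : (M * x.1).trace = ∑ j, coord j x.1 * (M * E j).trace := by
    conv_lhs => rw [← sum_coord_smul_E x]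
    simp [Finset.mul_sum, Matrix.trace_sum]
  simp only [Lpoly, map_sub, map_sum, map_mul, MvPolynomial.eval_C, MvPolynomial.eval_X, proj,
    Matrix.mul_smul, Matrix.mul_sub, Matrix.trace_smul, Matrix.trace_sub, mul_one, smul_eq_mul, h]
  rw [Finset.mul_sum, mul_sub, Finset.mul_sum]
  congr 1
  · ring
  · exact Finset.sum_congr rfl fun j _ => by ring

theorem fpoly_act_base (M : Matrix (Fin 3) (Fin 3) ℂ) (g : SU3) :
    (fpoly M).1 (act g base) = colBar g ⬝ᵥ M.mulVec (col g) := by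
  rw [fpoly_val, proj_act_base, Matrix.mul_vecMulVec, Matrix.trace_vecMulVec, dotProduct_comm]

/-- The function with value `(a·z̄)(b·z)` at the point of the unit vector `z`. -/
def fvec (a b : Fin 3 → ℂ) : PolyOrbit := fpoly (Matrix.vecMulVec a b)

theorem fvec_act_base (a b : Fin 3 → ℂ) (g : SU3) :
    (fvec a b).1 (act g base) = (a ⬝ᵥ colBar g) * (b ⬝ᵥ col g) := by
  rw [fvec, fpoly_act_base, Matrix.vecMulVec_mulVec, dotProduct_smul, dotProduct_comm a]
  simp

theorem fvec_act (a b : Fin 3 → ℂ) (g : SU3) (x : Orbit) :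
    (fvec a b).1 (act g x) = (fvec (g⁻¹.1.mulVec a) (Matrix.vecMul b g.1)).1 x := by
  rw [fvec, fvec, fpoly_val, fpoly_val, proj_act, ← Matrix.mul_vecMulVec, ← Matrix.vecMulVec_mul,
    ← mul_assoc, Matrix.trace_mul_comm]
  simp only [mul_assoc]

theorem fpoly_add (M N : Matrix (Fin 3) (Fin 3) ℂ) : fpoly (M + N) = fpoly M + fpoly N := by
  apply Subtype.ext; ext x
  rw [fpoly_val, add_mul, Matrix.trace_add, ← fpoly_val, ← fpoly_val]; rfl

theorem fpoly_smul (r : ℂ) (M : Matrix (Fin 3) (Fin 3) ℂ) : fpoly (r • M) = r • fpoly M := by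
  apply Subtype.ext; ext x
  rw [fpoly_val, Matrix.smul_mul, Matrix.trace_smul, ← fpoly_val]; rfl

theorem fpoly_sub (M N : Matrix (Fin 3) (Fin 3) ℂ) : fpoly (M - N) = fpoly M - fpoly N := by
  apply Subtype.ext; ext x
  rw [fpoly_val, sub_mul, Matrix.trace_sub, ← fpoly_val, ← fpoly_val]; rfl

/-- `fpoly` as a linear map. -/
def fpolyL : Matrix (Fin 3) (Fin 3) ℂ →ₗ[ℂ] PolyOrbit where
  toFun := fpoly
  map_add' := fpoly_add
  map_smul' := fpoly_smul

theorem fpoly_eq_sum (M : Matrix (Fin 3) (Fin 3) ℂ) :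
    fpoly M = ∑ i, ∑ j, M i j • fvec (Pi.single i 1) (Pi.single j 1) := by
  conv_lhs => rw [Matrix.matrix_eq_sum_single M]
  change fpolyL _ = _
  rw [map_sum]
  refine Finset.sum_congr rfl fun i _ => ?_
  rw [map_sum]
  refine Finset.sum_congr rfl fun j _ => ?_
  rw [← mul_one (M i j), ← smul_eq_mul, ← Matrix.smul_single, map_smul, smul_eq_mul, mul_one]
  rw [fvec, ← Matrix.single_eq_single_vecMulVec_single]
  rfl

theorem toPoly_X (j : Fin 8) :
    toPoly (MvPolynomial.X j) = (3 * Complex.I / ((√6 : ℝ) : ℂ)) • fpoly (-E j) := by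
  apply Subtype.ext; ext x
  change (toPoly (MvPolynomial.X j)).1 x = (3 * Complex.I / ((√6 : ℝ) : ℂ)) * (fpoly (-E j)).1 x
  have h6 := sqrt_six_ne
  rw [toPoly_val, MvPolynomial.eval_X, coord_eq, fpoly_val, proj]
  simp only [Matrix.mul_smul, Matrix.mul_sub, mul_one, Matrix.trace_smul, Matrix.trace_sub,
    neg_mul, Matrix.trace_neg, trace_E, smul_eq_mul]
  field_simp
  linear_combination (-((E j * x.1).trace * ((√6 : ℝ) : ℂ))) * Complex.I_sq

/-- Powers of functions `(a·z̄)(b·z)` with `a·b = 0`, up to the `n`-th. -/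
def polySpan (n : ℕ) : Submodule ℂ PolyOrbit :=
  Submodule.span ℂ {x | ∃ k ≤ n, ∃ a b : Fin 3 → ℂ, a ⬝ᵥ b = 0 ∧ x = fvec a b ^ k}

theorem fvec_pow_mem {n k : ℕ} (hk : k ≤ n) {a b : Fin 3 → ℂ} (hab : a ⬝ᵥ b = 0) :
    fvec a b ^ k ∈ polySpan n :=
  Submodule.subset_span ⟨k, hk, a, b, hab, rfl⟩

theorem polySpan_mono {n m : ℕ} (h : n ≤ m) : polySpan n ≤ polySpan m := by
  apply Submodule.span_mono
  rintro _ ⟨k, hk, a, b, hab, rfl⟩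
  exact ⟨k, hk.trans h, a, b, hab, rfl⟩

theorem one_mem_polySpan (n : ℕ) : (1 : PolyOrbit) ∈ polySpan n := by
  have := fvec_pow_mem (Nat.zero_le n) (a := 0) (b := 0) (by simp)
  simpa using this

/-- Functions on the orbit, seen on the group. -/
def pull : PolyOrbit →ₐ[ℂ] (SU3 → ℂ) where
  toFun f g := f.1 (act g base)
  map_one' := rfl
  map_mul' _ _ := rfl
  map_zero' := rfl
  map_add' _ _ := rfl
  commutes' _ := rfl

theorem pull_injective : Function.Injective pull := by
  intro f h hfh
  apply Subtype.ext; ext x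
  obtain ⟨g, rfl⟩ := orbit_cases x
  exact congrFun hfh g

/-- The coordinates of the unit vector, and their conjugates. -/
def zc (i : Fin 3) : SU3 → ℂ := fun g => col g i

/-- The conjugates of the coordinates of the unit vector. -/
def wc (i : Fin 3) : SU3 → ℂ := fun g => colBar g i

theorem sum_zc_wc : ∑ i, zc i * wc i = 1 := by
  ext g
  simpa [zc, wc, dotProduct] using col_dot_colBar g

theorem pull_fvec (a b : Fin 3 → ℂ) : pull (fvec a b) = bil zc wc a b := by
  ext g
  change (fvec a b).1 (act g base) = _
  rw [fvec_act_base, mul_comm]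
  simp [bil, zc, wc, dotProduct]

/-- On the group the coordinates of `z` and `z̄` are available separately, though only their
products descend to the orbit. The algebraic spanning result therefore applies there and is carried
back by injectivity of `pull`. -/
theorem map_pull_polySpan (n : ℕ) : (polySpan n).map pull.toLinearMap = harmSpan zc wc n := by
  rw [polySpan, Submodule.map_span, harmSpan]
  congr 1
  ext x
  constructor
  · rintro ⟨_, ⟨k, hk, a, b, hab, rfl⟩, rfl⟩
    exact ⟨k, hk, a, b, hab, by simp [pull_fvec]⟩
  · rintro ⟨k, hk, a, b, hab, rfl⟩
    exact ⟨_, ⟨k, hk, a, b, hab, rfl⟩, by simp [pull_fvec]⟩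

theorem mem_polySpan_iff {n : ℕ} {f : PolyOrbit} :
    f ∈ polySpan n ↔ pull f ∈ harmSpan zc wc n := by
  rw [← map_pull_polySpan, Submodule.mem_map]
  constructor
  · intro h; exact ⟨f, h, rfl⟩
  · rintro ⟨f', h, hf⟩
    rwa [← pull_injective hf]

theorem mul_fvec_mem {n : ℕ} {f : PolyOrbit} (hf : f ∈ polySpan n) (i j : Fin 3) :
    f * fvec (Pi.single i 1) (Pi.single j 1) ∈ polySpan (n + 1) := by
  rw [mem_polySpan_iff] at hf ⊢
  rw [map_mul, pull_fvec]
  have := mul_mem_harmSpan sum_zc_wc hf j i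
  convert this using 2
  simp only [bil]
  congr 1
  · rw [Finset.sum_eq_single j] <;> simp +contextual
  · rw [Finset.sum_eq_single i] <;> simp +contextual

theorem mul_fpoly_mem {n : ℕ} {f : PolyOrbit} (hf : f ∈ polySpan n)
    (M : Matrix (Fin 3) (Fin 3) ℂ) : f * fpoly M ∈ polySpan (n + 1) := by
  rw [fpoly_eq_sum, Finset.mul_sum]
  refine Submodule.sum_mem _ fun i _ => ?_
  rw [Finset.mul_sum]
  refine Submodule.sum_mem _ fun j _ => ?_
  rw [mul_smul_comm]
  exact Submodule.smul_mem _ _ (mul_fvec_mem hf i j)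

theorem mul_fpoly_pow_mem {n : ℕ} {f : PolyOrbit} (hf : f ∈ polySpan n)
    (M : Matrix (Fin 3) (Fin 3) ℂ) (k : ℕ) : f * fpoly M ^ k ∈ polySpan (n + k) := by
  induction k with
  | zero => simpa using hf
  | succ k ih => rw [pow_succ, ← mul_assoc, ← add_assoc]; exact mul_fpoly_mem ih M

/-- Each coordinate is a multiple of some `fpoly M`, and multiplication by it raises the filtration
by one step. This plays the role of the decomposition of `Poly(𝒪)` into the summands `(n,n)`. -/
theorem exists_mem_polySpan (f : PolyOrbit) : ∃ n, f ∈ polySpan n := by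
  obtain ⟨F, rfl⟩ : ∃ F, toPoly F = f := by
    obtain ⟨F, hF⟩ := f.2
    exact ⟨F, Subtype.ext hF⟩
  induction F using MvPolynomial.induction_on with
  | C r =>
    refine ⟨0, ?_⟩
    rw [← mul_one (MvPolynomial.C r), MvPolynomial.C_mul', map_smul, map_one]
    exact Submodule.smul_mem _ _ (one_mem_polySpan 0)
  | add F G hF hG =>
    obtain ⟨n, hn⟩ := hF
    obtain ⟨m, hm⟩ := hG
    refine ⟨max n m, ?_⟩
    rw [map_add]
    exact Submodule.add_mem _ (polySpan_mono (le_max_left _ _) hn)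
      (polySpan_mono (le_max_right _ _) hm)
  | mul_X F j hF =>
    obtain ⟨n, hn⟩ := hF
    refine ⟨n + 1, ?_⟩
    rw [map_mul, toPoly_X, mul_smul_comm]
    exact Submodule.smul_mem _ _ (mul_fpoly_mem hn _)


/-! ### The Berezin correspondence -/

/-- By linearity it is enough to treat operators of rank one, whose symbol is `((a·z̄)(b·z))^p`. -/
theorem exists_symbol {p : ℕ} (A : Module.End ℂ (H p)) :
    ∃ f : PolyOrbit, ∀ g : SU3, f.1 (act g base) = eval (colBar g) (A (coh p (col g))).1 := by
  let S : Submodule ℂ (Module.End ℂ (H p)) :=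
    { carrier := {A | ∃ f : PolyOrbit, ∀ g : SU3,
        f.1 (act g base) = eval (colBar g) (A (coh p (col g))).1}
      zero_mem' := ⟨0, by intro g; simp⟩
      add_mem' := by
        rintro A B ⟨f, hf⟩ ⟨h, hh⟩
        refine ⟨f + h, fun g => ?_⟩
        rw [LinearMap.add_apply, Submodule.coe_add, map_add, ← hf, ← hh]; rfl
      smul_mem' := by
        rintro r A ⟨f, hf⟩
        refine ⟨r • f, fun g => ?_⟩
        rw [LinearMap.smul_apply, Submodule.coe_smul, MvPolynomial.smul_eval, ← hf]; rfl }
  refine end_induction S (fun a b => ?_) A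
  refine ⟨fvec a b ^ p, fun g => ?_⟩
  change ((fvec a b).1 (act g base)) ^ p = _
  rw [fvec_act_base]
  simp only [rankOneOp, LinearMap.smulRight_apply, evalAt_apply, coh_val, Submodule.coe_smul,
    MvPolynomial.smul_eval, map_pow, eval_lin, mul_pow]
  rw [dotProduct_comm b]; ring

/-- The Berezin correspondence. -/
def berezin (p : ℕ) : Module.End ℂ (H p) →ₗ[ℂ] PolyOrbit where
  toFun A := (exists_symbol A).choose
  map_add' A B := by
    apply pull_injective; ext g
    change (exists_symbol (A + B)).choose.1 (act g base) =
      (exists_symbol A).choose.1 (act g base) + (exists_symbol B).choose.1 (act g base)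
    rw [(exists_symbol (A + B)).choose_spec, (exists_symbol A).choose_spec,
      (exists_symbol B).choose_spec, LinearMap.add_apply, Submodule.coe_add, map_add]
  map_smul' r A := by
    apply pull_injective; ext g
    change (exists_symbol (r • A)).choose.1 (act g base) =
      r * (exists_symbol A).choose.1 (act g base)
    rw [(exists_symbol (r • A)).choose_spec, (exists_symbol A).choose_spec,
      LinearMap.smul_apply, Submodule.coe_smul, MvPolynomial.smul_eval]

theorem berezin_act_base {p : ℕ} (A : Module.End ℂ (H p)) (g : SU3) :
    (berezin p A).1 (act g base) = eval (colBar g) (A (coh p (col g))).1 :=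
  (exists_symbol A).choose_spec g

theorem isBerezin_berezin (p : ℕ) : IsBerezin p (berezin p) := fun A g => by
  rw [berezin_act_base, trace_mul_conj_highestProj]

theorem berezin_injective (p : ℕ) : Function.Injective (berezin p) := by
  rw [injective_iff_map_eq_zero]
  intro A hA
  apply eq_zero_of_symbol_eq_zero
  intro g
  rw [← berezin_act_base, hA]; rfl

theorem colBar_vecMul (g h : SU3) : Matrix.vecMul (colBar (g * h)) g.1 = colBar h := by
  have h1 : ∀ k : SU3, colBar k = Matrix.vecMul (Pi.single 0 1) k⁻¹.1 := by
    intro k; ext i; simp [colBar, inv_apply]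
  rw [h1, h1, Matrix.vecMul_vecMul, mul_inv_rev, Submonoid.coe_mul, mul_assoc, inv_mul_val, mul_one]

theorem berezin_conj {p : ℕ} (g : SU3) (A : Module.End ℂ (H p)) (x : Orbit) :
    (berezin p (conj g A)).1 (act g x) = (berezin p A).1 x := by
  obtain ⟨h, rfl⟩ := orbit_cases x
  rw [← act_mul, berezin_act_base, berezin_act_base]
  simp only [conj, Module.End.mul_apply, rep_val, eval_subst, rep_coh, mulVec_col,
    colBar_vecMul, inv_mul_cancel_left]

theorem berezin_one (p : ℕ) : berezin p 1 = 1 := by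
  apply pull_injective; ext g
  change (berezin p 1).1 (act g base) = 1
  rw [berezin_act_base]
  simp [col_dot_colBar]

/-! ### The invariant integral -/

theorem continuous_pull (f : PolyOrbit) : Continuous fun g : SU3 => f.1 (act g base) := by
  obtain ⟨F, hF⟩ := f.2
  have : (fun g : SU3 => f.1 (act g base))
      = fun g => eval (fun j => coord j (act g base).1) F := by
    ext g; rw [← hF]; exact restrict_apply F _
  rw [this]
  refine (MvPolynomial.continuous_eval F).comp (continuous_pi fun j => ?_)
  have hval : Continuous fun g : SU3 => (g.1 : Matrix (Fin 3) (Fin 3) ℂ) := continuous_subtype_val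
  have hinv : Continuous fun g : SU3 => ((g⁻¹).1 : Matrix (Fin 3) (Fin 3) ℂ) :=
    continuous_subtype_val.comp continuous_inv
  have hact : Continuous fun g : SU3 => (act g base).1 :=
    (hval.matrix_mul continuous_const).matrix_mul hinv
  exact (continuous_const.matrix_mul hact).matrix_trace

instance : IsProbabilityMeasure haar := ⟨Measure.haarMeasure_self⟩

instance : haar.IsMulLeftInvariant := by unfold haar; infer_instance

theorem integrable_pull (f : PolyOrbit) : Integrable (fun g : SU3 => f.1 (act g base)) haar :=
  (continuous_pull f).integrable_of_hasCompactSupport (HasCompactSupport.of_compactSpace _)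

/-- The invariant integral as a linear form on `Poly(𝒪)`. -/
def orbitIntegralL : PolyOrbit →ₗ[ℂ] ℂ where
  toFun f := orbitIntegral f.1
  map_add' f h := integral_add (integrable_pull f) (integrable_pull h)
  map_smul' r _ := integral_const_mul r _

theorem orbitIntegral_act (f f' : PolyOrbit) (g : SU3) (h : ∀ x, f'.1 (act g x) = f.1 x) :
    orbitIntegral f'.1 = orbitIntegral f.1 := by
  rw [orbitIntegral, orbitIntegral, ← integral_mul_left_eq_self _ g]
  simp only [act_mul, h]

/-- The integral of the symbol is an invariant functional of the operator, hence a multiple of the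
trace, and the identity operator fixes the factor. -/
theorem berezin_normalized {p : ℕ} (A : Module.End ℂ (H p)) :
    orbitIntegral (berezin p A).1 = LinearMap.trace ℂ (H p) A / (Module.finrank ℂ (H p) : ℂ) := by
  obtain ⟨m, hm⟩ := exists_eq_smul_trace (orbitIntegralL.comp (berezin p)) fun g A =>
    orbitIntegral_act (berezin p A) (berezin p (conj g A)) g (berezin_conj g A)
  have h1 : ∀ A, orbitIntegral (berezin p A).1 = m * LinearMap.trace ℂ (H p) A := hm
  have h2 := h1 1
  rw [berezin_one, LinearMap.trace_one] at h2
  have h3 : orbitIntegral (1 : PolyOrbit).1 = 1 := by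
    change ∫ _, (1 : ℂ) ∂haar = 1
    simp
  rw [h3] at h2
  rw [h1, div_eq_mul_inv, mul_comm]
  congr 1
  rw [eq_comm, inv_eq_iff_eq_inv, ← one_div]
  rw [eq_div_iff (by rintro rfl; simp at h2), mul_comm, h2]

/-! ### Adjoints -/

theorem herm_eq_sum {p : ℕ} (f h : H p) {s : Finset (Fin 3 →₀ ℕ)} (hs : f.1.support ⊆ s) :
    herm f h = ∑ a ∈ s, ((∏ i, (a i).factorial : ℕ) : ℂ) * starRingEnd ℂ (f.1.coeff a) *
      h.1.coeff a := by
  rw [herm]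
  refine Finset.sum_subset hs fun a _ ha => ?_
  rw [MvPolynomial.notMem_support_iff.1 ha]; simp

theorem herm_symm {p : ℕ} (f h : H p) : starRingEnd ℂ (herm f h) = herm h f := by
  classical
  rw [herm_eq_sum f h Finset.subset_union_left, herm_eq_sum h f Finset.subset_union_right, map_sum]
  refine Finset.sum_congr rfl fun a _ => ?_
  simp only [map_mul, Complex.conj_conj, map_natCast]
  ring

theorem herm_add_right {p : ℕ} (f h h' : H p) : herm f (h + h') = herm f h + herm f h' := by
  simp [herm, mul_add, Finset.sum_add_distrib]

theorem herm_smul_right {p : ℕ} (r : ℂ) (f h : H p) : herm f (r • h) = r * herm f h := by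
  simp only [herm, Submodule.coe_smul, MvPolynomial.coeff_smul, smul_eq_mul, Finset.mul_sum]
  exact Finset.sum_congr rfl fun _ _ => by ring

theorem herm_add_left {p : ℕ} (f f' h : H p) : herm (f + f') h = herm f h + herm f' h := by
  rw [← herm_symm, herm_add_right, map_add, herm_symm, herm_symm]

theorem herm_smul_left {p : ℕ} (r : ℂ) (f h : H p) :
    herm (r • f) h = starRingEnd ℂ r * herm f h := by
  rw [← herm_symm, herm_smul_right, map_mul, herm_symm]

/-- The conjugate of a vector. -/
def conjVec (z : Fin 3 → ℂ) : Fin 3 → ℂ := fun i => starRingEnd ℂ (z i)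

/-- The reproducing property: the weights `a!` cancel the denominators of the multinomial
coefficients of `(z·X)^p`, so a coherent vector represents evaluation at the conjugate point. -/
theorem herm_coh_right {p : ℕ} (f : H p) (z : Fin 3 → ℂ) :
    herm f (coh p z) = (p.factorial : ℂ) * starRingEnd ℂ (eval (conjVec z) f.1) := by
  rw [herm, MvPolynomial.eval_eq', map_sum, Finset.mul_sum]
  refine Finset.sum_congr rfl fun a ha => ?_
  have hd : a.degree = p := by
    by_contra hne
    exact (MvPolynomial.mem_support_iff.1 ha) (f.2.coeff_eq_zero hne)
  have hspec : (p.factorial : ℂ) =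
      (∏ i, (a i).factorial : ℕ) * (Nat.multinomial Finset.univ a : ℂ) := by
    have := Nat.multinomial_spec Finset.univ a
    rw [← hd, Finsupp.degree_eq_sum, ← this, Nat.cast_mul]
  rw [coh_val, coeff_lin_pow z a hd, hspec]
  simp only [map_mul, map_prod, map_pow, conjVec, Complex.conj_conj]
  ring

theorem herm_coh_left {p : ℕ} (h : H p) (z : Fin 3 → ℂ) :
    herm (coh p z) h = (p.factorial : ℂ) * eval (conjVec z) h.1 := by
  rw [← herm_symm, herm_coh_right]
  simp

theorem isDagger_of_coh {p : ℕ} {A A' : Module.End ℂ (H p)}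
    (h : ∀ u z, herm (A (coh p u)) (coh p z) = herm (coh p u) (A' (coh p z))) : IsDagger A A' := by
  have h1 : ∀ u f, herm (A (coh p u)) f = herm (coh p u) (A' f) := by
    intro u f
    have : f ∈ Submodule.span ℂ (Set.range (coh p)) := by rw [span_coh]; trivial
    induction this using Submodule.span_induction with
    | mem x hx => obtain ⟨a, rfl⟩ := hx; exact h u a
    | zero => rw [map_zero, ← zero_smul ℂ (0 : H p), herm_smul_right, herm_smul_right]; simp
    | add x y _ _ hx hy => rw [map_add, herm_add_right, herm_add_right, hx, hy]
    | smul s x _ hx => rw [map_smul, herm_smul_right, herm_smul_right, hx]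
  intro f k
  have : f ∈ Submodule.span ℂ (Set.range (coh p)) := by rw [span_coh]; trivial
  induction this using Submodule.span_induction with
  | mem x hx => obtain ⟨a, rfl⟩ := hx; exact h1 a k
  | zero => rw [map_zero, ← zero_smul ℂ (0 : H p), herm_smul_left, herm_smul_left]; simp
  | add x y _ _ hx hy => rw [map_add, herm_add_left, herm_add_left, hx, hy]
  | smul s x _ hx => rw [map_smul, herm_smul_left, herm_smul_left, hx]

theorem berezin_real {p : ℕ} {A A' : Module.End ℂ (H p)} (h : IsDagger A A') (x : Orbit) :
    (berezin p A').1 x = starRingEnd ℂ ((berezin p A).1 x) := by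
  obtain ⟨g, rfl⟩ := orbit_cases x
  rw [berezin_act_base, berezin_act_base]
  have := h (coh p (col g)) (coh p (col g))
  rw [herm_coh_right, herm_coh_left] at this
  exact (mul_left_cancel₀ (Nat.cast_ne_zero.2 (Nat.factorial_ne_zero p)) this).symm

theorem IsDagger.pow {p : ℕ} {A A' : Module.End ℂ (H p)} (h : IsDagger A A') (n : ℕ) :
    IsDagger (A ^ n) (A' ^ n) := by
  induction n with
  | zero => intro f k; simp
  | succ n ih =>
    intro f k
    rw [pow_succ', pow_succ, Module.End.mul_apply, Module.End.mul_apply, h, ih]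

theorem isSymbolCorrespondence_berezin (p : ℕ) : IsSymbolCorrespondence p (berezin p) where
  injective := berezin_injective p
  equivariant := berezin_conj
  real _ _ h x := berezin_real h x
  normalized := berezin_normalized

/-! ### The operators `(∑ a i X i) (∑ b j ∂ j)` -/

/-- The derivation `(∑ a i X i) (∑ b j ∂ j)`. -/
def der (a b : Fin 3 → ℂ) : Derivation ℂ (MvPolynomial (Fin 3) ℂ) (MvPolynomial (Fin 3) ℂ) :=
  ∑ i, ∑ j, (a i * b j) • (MvPolynomial.X i : MvPolynomial (Fin 3) ℂ) • MvPolynomial.pderiv j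

/-- The operator on `H p` by which the matrix with entries `a i * b j` acts. -/
def dop (p : ℕ) (a b : Fin 3 → ℂ) : Module.End ℂ (H p) :=
  ∑ i, ∑ j, (a i * b j) • matrixUnitOp p i j

theorem matrixUnitOp_val {p : ℕ} (i j : Fin 3) (f : H p) :
    (matrixUnitOp p i j f).1 = MvPolynomial.X i * MvPolynomial.pderiv j f.1 := rfl

theorem dop_val {p : ℕ} (a b : Fin 3 → ℂ) (f : H p) : (dop p a b f).1 = der a b f.1 := by
  simp only [dop, der, LinearMap.sum_apply, LinearMap.smul_apply, Submodule.coe_sum,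
    Submodule.coe_smul, matrixUnitOp_val]
  simp [Fin.sum_univ_three]

theorem dop_pow_val {p : ℕ} (a b : Fin 3 → ℂ) (n : ℕ) (f : H p) :
    ((dop p a b ^ n) f).1 = (der a b)^[n] f.1 := by
  induction n with
  | zero => rfl
  | succ n ih =>
    rw [pow_succ', Module.End.mul_apply, dop_val, ih, Function.iterate_succ_apply']

theorem der_lin (a b c : Fin 3 → ℂ) : der a b (lin c) = (b ⬝ᵥ c) • lin a := by
  simp [der, lin, Fin.sum_univ_three, dotProduct, MvPolynomial.pderiv_X, MvPolynomial.smul_eq_C_mul]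
  ring

theorem iterate_derivation_mul {R : Type*} [CommRing R] [Algebra ℂ R] (D : Derivation ℂ R R)
    (n : ℕ) (x y : R) : D^[n] (x * y)
      = ∑ kl ∈ Finset.HasAntidiagonal.antidiagonal n, (n.choose kl.1 : R) * (D^[kl.1] x * D^[kl.2] y) := by
  induction n with
  | zero => simp
  | succ n ih =>
    rw [Finset.sum_antidiagonal_choose_succ_mul (fun i j => D^[i] x * D^[j] y),
      Function.iterate_succ_apply', ih, map_sum, ← Finset.sum_add_distrib]
    refine Finset.sum_congr rfl fun kl hkl => ?_
    rw [Finset.HasAntidiagonal.mem_antidiagonal] at hkl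
    rw [Function.iterate_succ_apply', Function.iterate_succ_apply',
      show n.choose kl.2 = n.choose kl.1 by rw [← hkl]; exact (Nat.choose_symm_add).symm,
      Derivation.leibniz, Derivation.leibniz, Derivation.map_natCast]
    simp only [smul_eq_mul]
    ring

/-- Since `D α = 0`, the element `D u` is a constant for `D`, and the rule is that of one variable.
-/
theorem iterate_derivation_pow {R : Type*} [CommRing R] [Algebra ℂ R] (D : Derivation ℂ R R)
    {α u : R} {μ : ℂ} (hα : D α = 0) (hu : D u = μ • α) (n m : ℕ) :
    D^[n] (u ^ m) = (m.descFactorial n : R) * (algebraMap ℂ R μ * α) ^ n * u ^ (m - n) := by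
  induction n with
  | zero => simp
  | succ n ih =>
    rw [Function.iterate_succ_apply', ih, Nat.descFactorial_succ]
    have h1 : D (algebraMap ℂ R μ * α) = 0 := by simp [hα]
    have hu' : D u = algebraMap ℂ R μ * α := by rw [hu, Algebra.smul_def]
    rw [Derivation.leibniz, Derivation.leibniz, Derivation.map_natCast, Derivation.leibniz_pow,
      Derivation.leibniz_pow, h1, hu']
    rw [show m - (n + 1) = m - n - 1 by omega]
    simp only [smul_eq_mul, nsmul_eq_mul, Nat.cast_mul]
    ring

theorem iterate_derivation_smul {R : Type*} [CommRing R] [Algebra ℂ R] (D : Derivation ℂ R R)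
    (r : ℂ) (n : ℕ) (x : R) : D^[n] (r • x) = r • D^[n] x := by
  induction n with
  | zero => rfl
  | succ n ih =>
    rw [Function.iterate_succ_apply', ih, Derivation.map_smul, Function.iterate_succ_apply']

theorem dop_pow_coh {p : ℕ} {a b : Fin 3 → ℂ} (hab : a ⬝ᵥ b = 0) (n : ℕ) (z : Fin 3 → ℂ) :
    ((dop p a b ^ n) (coh p z)).1 = MvPolynomial.C ((p.descFactorial n : ℂ) * (b ⬝ᵥ z) ^ n) *
      (lin a ^ n * lin z ^ (p - n)) := by
  have h0 : der a b (lin a) = 0 := by rw [der_lin, dotProduct_comm, hab, zero_smul]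
  rw [dop_pow_val, coh_val, iterate_derivation_pow (der a b) h0 (der_lin a b z)]
  simp only [map_mul, map_pow, map_natCast, MvPolynomial.algebraMap_eq]
  ring

/-- With `a·b = 0` the form `a·X` is a constant for the derivation, so one term remains; its factor
`(z·X)^{p-n}` takes the value `1` at `z̄`. -/
theorem berezin_dop_pow {p : ℕ} {a b : Fin 3 → ℂ} (hab : a ⬝ᵥ b = 0) (n : ℕ) :
    berezin p (dop p a b ^ n) = (p.descFactorial n : ℂ) • fvec a b ^ n := by
  apply pull_injective; ext g
  change (berezin p _).1 (act g base) = (p.descFactorial n : ℂ) * ((fvec a b).1 (act g base)) ^ n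
  rw [berezin_act_base, dop_pow_coh hab, fvec_act_base]
  simp only [map_mul, map_pow, MvPolynomial.eval_C, eval_lin, col_dot_colBar, one_pow]
  ring

/-- The Berezin symbol of a product. -/
theorem berezin_dop_pow_mul_dop_pow {p : ℕ} {a b c d : Fin 3 → ℂ} (hab : a ⬝ᵥ b = 0)
    (hcd : c ⬝ᵥ d = 0) (n m : ℕ) :
    berezin p (dop p a b ^ n * dop p c d ^ m) =
      ∑ kl ∈ Finset.HasAntidiagonal.antidiagonal n,
        ((n.choose kl.1 : ℂ) * m.descFactorial kl.1 * p.descFactorial (m + kl.2)) •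
          (fvec a b ^ kl.2 * fvec c d ^ (m - kl.1) * ((b ⬝ᵥ c) • fvec a d) ^ kl.1) := by
  apply pull_injective; ext g
  have hR : pull (∑ kl ∈ Finset.HasAntidiagonal.antidiagonal n,
        ((n.choose kl.1 : ℂ) * m.descFactorial kl.1 * p.descFactorial (m + kl.2)) •
          (fvec a b ^ kl.2 * fvec c d ^ (m - kl.1) * ((b ⬝ᵥ c) • fvec a d) ^ kl.1)) g
      = ∑ kl ∈ Finset.HasAntidiagonal.antidiagonal n,
        ((n.choose kl.1 : ℂ) * m.descFactorial kl.1 * p.descFactorial (m + kl.2)) *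
          (((a ⬝ᵥ colBar g) * (b ⬝ᵥ col g)) ^ kl.2 *
            ((c ⬝ᵥ colBar g) * (d ⬝ᵥ col g)) ^ (m - kl.1) *
            ((b ⬝ᵥ c) * ((a ⬝ᵥ colBar g) * (d ⬝ᵥ col g))) ^ kl.1) := by
    rw [map_sum, Finset.sum_apply]
    refine Finset.sum_congr rfl fun kl _ => ?_
    rw [← fvec_act_base, ← fvec_act_base, ← fvec_act_base]
    rfl
  rw [hR]
  change (berezin p _).1 (act g base) = _
  have h0 : der a b (lin a) = 0 := by rw [der_lin, dotProduct_comm, hab, zero_smul]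
  rw [berezin_act_base, Module.End.mul_apply, dop_pow_val, dop_pow_coh hcd,
    MvPolynomial.C_mul', iterate_derivation_smul, iterate_derivation_mul,
    MvPolynomial.smul_eval, map_sum, Finset.mul_sum]
  refine Finset.sum_congr rfl fun kl _ => ?_
  rw [iterate_derivation_pow (der a b) h0 (der_lin a b c),
    iterate_derivation_pow (der a b) h0 (der_lin a b (col g))]
  simp only [map_mul, map_pow, map_natCast, MvPolynomial.algebraMap_eq, MvPolynomial.eval_C,
    eval_lin, col_dot_colBar, one_pow, mul_one]
  -- For more than `m` contractions the truncated exponent `m - kl.1` is meaningless, but the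
  -- falling factorial in front is zero. Otherwise the falling factorials of `p` and of `p - m` join
  -- into one.
  rcases Nat.lt_or_ge m kl.1 with hk | hk
  · rw [Nat.descFactorial_eq_zero_iff_lt.2 hk]; simp
  · have h1 : (p.descFactorial (m + kl.2) : ℂ)
        = p.descFactorial m * (p - m).descFactorial kl.2 := by
      rw [← Nat.descFactorial_mul_descFactorial (Nat.le_add_right m kl.2), Nat.add_sub_cancel_left,
        Nat.cast_mul, mul_comm]
    have h2 : (d ⬝ᵥ col g) ^ m = (d ⬝ᵥ col g) ^ (m - kl.1) * (d ⬝ᵥ col g) ^ kl.1 := by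
      rw [← pow_add, Nat.sub_add_cancel hk]
    rw [h1, h2]
    ring


/-! ### Equivariant maps on the summands -/

/-- The basis vectors of `ℂ³`. -/
abbrev ee (i : Fin 3) : Fin 3 → ℂ := Pi.single i 1

theorem descFactorial_ne {p n : ℕ} (h : n ≤ p) : (p.descFactorial n : ℂ) ≠ 0 :=
  Nat.cast_ne_zero.2 fun h0 => by
    rw [Nat.descFactorial_eq_zero_iff_lt] at h0; omega

theorem polySpan_le_range_berezin {p n : ℕ} (h : n ≤ p) :
    polySpan n ≤ LinearMap.range (berezin p) := by
  rw [polySpan, Submodule.span_le]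
  rintro _ ⟨k, hk, a, b, hab, rfl⟩
  refine ⟨(p.descFactorial k : ℂ)⁻¹ • dop p a b ^ k, ?_⟩
  rw [map_smul, berezin_dop_pow hab, smul_smul, inv_mul_cancel₀ (descFactorial_ne (hk.trans h)),
    one_smul]

theorem act_base_of_commute {k : SU3} (h : k.1 * xi = xi * k.1) : act k base = base := by
  apply Subtype.ext
  change k.1 * xi * k⁻¹.1 = xi
  rw [h, mul_assoc, mul_inv_val, mul_one]

theorem torus_act_base (θ : Fin 3 → ℝ) (h : ∑ i, θ i = 0) : act (torus θ h) base = base := by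
  apply act_base_of_commute
  rw [torus_val, xi, mul_smul_comm, smul_mul_assoc, Matrix.diagonal_mul_diagonal,
    Matrix.diagonal_mul_diagonal]
  simp only [mul_comm]

theorem fvec_smul_smul (r s : ℂ) (a b : Fin 3 → ℂ) :
    fvec (r • a) (s • b) = (r * s) • fvec a b := by
  rw [fvec, Matrix.smul_vecMulVec, Matrix.vecMulVec_smul, smul_smul, fpoly_smul, fvec]

theorem fvec_torus (θ : Fin 3 → ℝ) (h : ∑ i, θ i = 0) (i j : Fin 3) (x : Orbit) :
    (fvec (ee i) (ee j)).1 (act (torus θ h) x)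
      = Complex.exp (Complex.I * (θ j - θ i)) * (fvec (ee i) (ee j)).1 x := by
  rw [fvec_act, torus_inv_val, torus_val]
  have h1 : (Matrix.diagonal fun i => Complex.exp (-(Complex.I * θ i))).mulVec (ee i)
      = Complex.exp (-(Complex.I * θ i)) • ee i := by
    ext l; by_cases hl : l = i
    · subst hl; simp [Matrix.mulVec_diagonal]
    · simp [Matrix.mulVec_diagonal, hl]
  have h2 : Matrix.vecMul (ee j) (Matrix.diagonal fun i => Complex.exp (Complex.I * θ i))
      = Complex.exp (Complex.I * θ j) • ee j := by
    ext l; by_cases hl : l = j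
    · subst hl; simp [Matrix.vecMul_diagonal]
    · simp [Matrix.vecMul_diagonal, hl]
  rw [h1, h2, fvec_smul_smul, ← Complex.exp_add]
  change Complex.exp _ * _ = _
  congr 2
  ring

theorem fvec_eq_sum (a b : Fin 3 → ℂ) :
    fvec a b = ∑ ij : Fin 3 × Fin 3, (a ij.1 * b ij.2) • fvec (ee ij.1) (ee ij.2) := by
  rw [fvec, fpoly_eq_sum, Fintype.sum_prod_type]
  rfl

/-! ### Monomials in the functions `z̄ᵢ zⱼ` and their torus weights -/

theorem prod_fpoly_mem {ι : Type*} (s : Finset ι) (M : ι → Matrix (Fin 3) (Fin 3) ℂ) (c : ι → ℕ) :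
    ∏ x ∈ s, fpoly (M x) ^ c x ∈ polySpan (∑ x ∈ s, c x) := by
  classical
  induction s using Finset.induction with
  | empty => simpa using one_mem_polySpan 0
  | insert x s hx ih =>
    rw [Finset.prod_insert hx, Finset.sum_insert hx, mul_comm, add_comm]
    exact mul_fpoly_pow_mem ih _ _

/-- The monomial with exponents `c` in the functions `z̄ i z j`. -/
def qmon (c : Fin 3 × Fin 3 → ℕ) : PolyOrbit := ∏ ij, fvec (ee ij.1) (ee ij.2) ^ c ij

theorem fvec_pow_eq_sum (a b : Fin 3 → ℂ) (n : ℕ) :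
    fvec a b ^ n = ∑ c ∈ Finset.piAntidiag Finset.univ n,
      ((Nat.multinomial Finset.univ c : ℂ) * ∏ ij, (a ij.1 * b ij.2) ^ c ij) • qmon c := by
  rw [fvec_eq_sum, Finset.sum_pow_eq_sum_piAntidiag]
  refine Finset.sum_congr rfl fun c _ => ?_
  rw [mul_smul, Nat.cast_smul_eq_nsmul, nsmul_eq_mul]
  congr 1
  simp only [smul_pow, qmon]
  rw [Finset.prod_smul]

theorem qmon_mem {c : Fin 3 × Fin 3 → ℕ} {n : ℕ} (hc : c ∈ Finset.piAntidiag Finset.univ n) :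
    qmon c ∈ polySpan n := by
  have := prod_fpoly_mem Finset.univ (fun ij : Fin 3 × Fin 3 =>
    Matrix.vecMulVec (ee ij.1) (ee ij.2)) c
  rwa [(Finset.mem_piAntidiag.1 hc).1] at this

/-- The weight of a monomial. -/
def qweight (c : Fin 3 × Fin 3 → ℕ) (l : Fin 3) : ℤ := ∑ i, (c (i, l) : ℤ) - ∑ j, (c (l, j) : ℤ)

theorem qmon_torus (θ : Fin 3 → ℝ) (h : ∑ i, θ i = 0) (c : Fin 3 × Fin 3 → ℕ) (x : Orbit) :
    (qmon c).1 (act (torus θ h) x)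
      = Complex.exp (Complex.I * ∑ i, (θ i : ℂ) * (qweight c i : ℂ)) * (qmon c).1 x := by
  have hprod : ∀ y : Orbit, (qmon c).1 y = ∏ ij, (fvec (ee ij.1) (ee ij.2)).1 y ^ c ij := by
    intro y
    have : (Pi.evalAlgHom ℂ (fun _ : Orbit => ℂ) y).comp PolyOrbit.val (qmon c)
        = ∏ ij, (Pi.evalAlgHom ℂ (fun _ : Orbit => ℂ) y).comp PolyOrbit.val
            (fvec (ee ij.1) (ee ij.2)) ^ c ij := by
      rw [qmon, map_prod]; simp only [map_pow]
    exact this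
  rw [hprod, hprod]
  simp only [fvec_torus, mul_pow, Finset.prod_mul_distrib]
  congr 1
  simp only [← Complex.exp_nat_mul, ← Complex.exp_sum]
  congr 1
  simp only [Fintype.sum_prod_type, qweight, Fin.sum_univ_three]
  push_cast
  ring

variable {p : ℕ} {W : Module.End ℂ (H p) →ₗ[ℂ] PolyOrbit}

theorem exists_linear_leftInverse {V V' : Type*} [AddCommGroup V] [Module ℂ V] [AddCommGroup V']
    [Module ℂ V'] (f : V →ₗ[ℂ] V') (hf : Function.Injective f) :
    ∃ h : V' →ₗ[ℂ] V, ∀ x, h (f x) = x := by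
  obtain ⟨h, hh⟩ := LinearMap.exists_leftInverse_of_injective f (LinearMap.ker_eq_bot.2 hf)
  exact ⟨h, fun x => LinearMap.congr_fun hh x⟩

theorem exists_berezin_leftInverse (p : ℕ) :
    ∃ L : PolyOrbit →ₗ[ℂ] Module.End ℂ (H p), ∀ A, L (berezin p A) = A :=
  exists_linear_leftInverse (V := Module.End ℂ (H p)) (V' := PolyOrbit) _ (berezin_injective p)

/-- The composition of the inverse of the Berezin correspondence with a linear map. -/
def fromBerezin (W : Module.End ℂ (H p) →ₗ[ℂ] PolyOrbit) : PolyOrbit →ₗ[ℂ] PolyOrbit :=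
  W.comp (exists_berezin_leftInverse p).choose

theorem fromBerezin_berezin (A : Module.End ℂ (H p)) : fromBerezin W (berezin p A) = W A :=
  congrArg W ((exists_berezin_leftInverse p).choose_spec A)

/-- The left inverse behind `fromBerezin` is arbitrary outside the image of `berezin p`. The bound
`n ≤ p` keeps `u` inside this image, where it is the true inverse and equivariant. -/
theorem fromBerezin_act (hW : IsSymbolCorrespondence p W) {n : ℕ} (hn : n ≤ p) {u u' : PolyOrbit}
    (hu : u ∈ polySpan n) (g : SU3) (h : ∀ x, u'.1 (act g x) = u.1 x) (x : Orbit) :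
    (fromBerezin W u').1 (act g x) = (fromBerezin W u).1 x := by
  obtain ⟨A, rfl⟩ := polySpan_le_range_berezin hn hu
  have : u' = berezin p (conj g A) := by
    apply Subtype.ext; ext y
    obtain ⟨y', rfl⟩ : ∃ y', y = act g y' :=
      ⟨act g⁻¹ y, by rw [← act_mul, mul_inv_cancel, act_one]⟩
    rw [h, berezin_conj]
  rw [this, fromBerezin_berezin, fromBerezin_berezin, hW.equivariant]

/-- The torus fixes the base point, so a vector of nonzero weight must vanish there. -/
theorem fromBerezin_qmon_eq_zero (hW : IsSymbolCorrespondence p W) {n : ℕ} (hn : n ≤ p)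
    {c : Fin 3 × Fin 3 → ℕ} (hc : c ∈ Finset.piAntidiag Finset.univ n) (hne : qweight c ≠ 0) :
    (fromBerezin W (qmon c)).1 base = 0 := by
  have hsum : ∑ i, qweight c i = 0 := by
    simp only [qweight, Fin.sum_univ_three]; ring
  obtain ⟨θ, hθ, hne1⟩ := exists_torus_ne_one hsum hne
  set lam := Complex.exp (Complex.I * ∑ i, (θ i : ℂ) * (qweight c i : ℂ)) with hlam
  have h1 := fromBerezin_act hW hn (u := lam • qmon c) (u' := qmon c)
    (Submodule.smul_mem _ _ (qmon_mem hc)) (torus θ hθ) (fun x => qmon_torus θ hθ c x) base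
  rw [torus_act_base, map_smul] at h1
  change _ = lam * (fromBerezin W (qmon c)).1 base at h1
  by_contra h0
  exact hne1 (mul_right_cancel₀ h0 (by rw [one_mul]; exact h1.symm))

/-- The value at the base point of the image of a power, as a polynomial in the `a i * b i`. -/
def zonal (W : Module.End ℂ (H p) →ₗ[ℂ] PolyOrbit) (n : ℕ) (y : Fin 3 → ℂ) : ℂ :=
  ∑ c ∈ Finset.piAntidiag Finset.univ n, (Nat.multinomial Finset.univ c : ℂ) *
    (∏ i, y i ^ (∑ j, c (i, j))) * (fromBerezin W (qmon c)).1 base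

/-- Only monomials of weight zero contribute. In these each index occurs equally often in `z` and in
`z̄`, so `a i` and `b i` carry the same exponent. -/
theorem fromBerezin_fvec_pow_base (hW : IsSymbolCorrespondence p W) {n : ℕ} (hn : n ≤ p)
    (a b : Fin 3 → ℂ) :
    (fromBerezin W (fvec a b ^ n)).1 base = zonal W n fun i => a i * b i := by
  have heval : ∀ f : PolyOrbit, f.1 base = ((Pi.evalAlgHom ℂ (fun _ : Orbit => ℂ) base).comp
    PolyOrbit.val) f := fun f => rfl
  rw [fvec_pow_eq_sum, map_sum, heval, map_sum, zonal]
  refine Finset.sum_congr rfl fun c hc => ?_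
  rw [map_smul, map_smul, ← heval, smul_eq_mul]
  by_cases hw : qweight c = 0
  swap
  · rw [fromBerezin_qmon_eq_zero hW hn hc hw, mul_zero, mul_zero]
  congr 2
  have hs : ∀ l, ∑ j, c (l, j) = ∑ i, c (i, l) := by
    intro l
    have := congrFun hw l
    simp only [qweight, Pi.zero_apply] at this
    have h2 : ∑ i, (c (i, l) : ℤ) = ∑ j, (c (l, j) : ℤ) := by linarith
    exact_mod_cast h2.symm
  simp only [mul_pow, Finset.prod_mul_distrib]
  congr 1
  · rw [Fintype.prod_prod_type]
    exact Finset.prod_congr rfl fun i _ => 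
      Finset.prod_pow_eq_pow_sum Finset.univ (fun j => c (i, j)) (a i)
  · rw [Fintype.prod_prod_type_right]
    refine Finset.prod_congr rfl fun i _ => ?_
    rw [hs]
    exact Finset.prod_pow_eq_pow_sum Finset.univ (fun j => c (j, i)) (b i)

theorem zonal_smul (W : Module.End ℂ (H p) →ₗ[ℂ] PolyOrbit) (n : ℕ) (r : ℂ) (y : Fin 3 → ℂ) :
    zonal W n (r • y) = r ^ n * zonal W n y := by
  simp only [zonal, Finset.mul_sum]
  refine Finset.sum_congr rfl fun c hc => ?_
  simp only [Pi.smul_apply, smul_eq_mul, mul_pow, Finset.prod_mul_distrib]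
  have h1 := (Finset.mem_piAntidiag.1 hc).1
  rw [Finset.prod_pow_eq_pow_sum, ← Fintype.sum_prod_type (f := c), h1]
  ring

/-- The element of `SU(3)` that fixes `e₀` and rotates the plane of `e₁`, `e₂`. -/
def rot (u v : ℂ) (h : u * starRingEnd ℂ u + v * starRingEnd ℂ v = 1) : SU3 :=
  ⟨!![1, 0, 0; 0, u, v; 0, -starRingEnd ℂ v, starRingEnd ℂ u], by
    rw [Matrix.mem_specialUnitaryGroup_iff, Matrix.mem_unitaryGroup_iff]
    constructor
    · ext i j
      fin_cases i <;> fin_cases j <;>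
        simp [Matrix.mul_apply, Fin.sum_univ_three, Matrix.star_apply]
      · exact h
      · ring
      · ring
      · linear_combination h
    · rw [Matrix.det_fin_three]
      simp
      linear_combination h⟩

theorem rot_act_base (u v : ℂ) (h : u * starRingEnd ℂ u + v * starRingEnd ℂ v = 1) :
    act (rot u v h) base = base := by
  apply act_base_of_commute
  rw [xi, mul_smul_comm, smul_mul_assoc]
  congr 1
  ext i j
  fin_cases i <;> fin_cases j <;> simp [rot, Matrix.mul_apply, Fin.sum_univ_three]

/-- The block of `SU(3)` acting on the last two coordinates fixes the base point and rotates
`(a₁,a₂)` onto the first of these axes, leaving zeroth coordinates alone. -/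
theorem exists_rot (a : Fin 3 → ℂ) : ∃ k : SU3, act k base = base ∧
    (k.1.mulVec a) 2 = 0 ∧ (k.1.mulVec a) 0 = a 0 ∧
      ∀ b, Matrix.vecMul b k⁻¹.1 0 = b 0 := by
  have hk : ∀ u v h, (rot u v h).1.mulVec a 0 = a 0 ∧
      ∀ b, Matrix.vecMul b (rot u v h)⁻¹.1 0 = b 0 := by
    intro u v h
    constructor
    · simp [rot, Matrix.mulVec, dotProduct, Fin.sum_univ_three]
    · intro b
      simp [Matrix.vecMul, dotProduct, Fin.sum_univ_three, inv_apply, rot]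
  by_cases h0 : ‖a 1‖ ^ 2 + ‖a 2‖ ^ 2 = 0
  · have h1 : a 1 = 0 := by
      have : ‖a 1‖ ^ 2 = 0 := by nlinarith [sq_nonneg ‖a 1‖, sq_nonneg ‖a 2‖]
      simpa using this
    have h2 : a 2 = 0 := by
      have : ‖a 2‖ ^ 2 = 0 := by nlinarith [sq_nonneg ‖a 1‖, sq_nonneg ‖a 2‖]
      simpa using this
    refine ⟨rot 1 0 (by simp), rot_act_base _ _ _, ?_, hk _ _ _⟩
    simp [rot, Matrix.mulVec, dotProduct, Fin.sum_univ_three, h2]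
  · set N : ℝ := √(‖a 1‖ ^ 2 + ‖a 2‖ ^ 2) with hN
    have hNN : (N : ℂ) * N = a 1 * starRingEnd ℂ (a 1) + a 2 * starRingEnd ℂ (a 2) := by
      rw [← Complex.ofReal_mul, hN, Real.mul_self_sqrt (by positivity), Complex.mul_conj,
        Complex.mul_conj, Complex.normSq_eq_norm_sq, Complex.normSq_eq_norm_sq]
      push_cast; ring
    have hN0 : (N : ℂ) ≠ 0 := by
      intro h
      apply h0
      have h' : N = 0 := by exact_mod_cast h
      rw [hN] at h'
      exact (Real.sqrt_eq_zero (by positivity)).1 h'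
    refine ⟨rot (starRingEnd ℂ (a 1) / N) (starRingEnd ℂ (a 2) / N) ?_, rot_act_base _ _ _, ?_,
      hk _ _ _⟩
    · simp only [map_div₀, Complex.conj_conj, Complex.conj_ofReal]
      field_simp
      linear_combination -hNN
    · simp [rot, Matrix.mulVec, dotProduct, Fin.sum_univ_three]
      ring

/-- Once `a 2` is rotated to `0`, the relation `a·b = 0` forces the products `a i * b i` to be
proportional to `(1,-1,0)`, and homogeneity does the rest. -/
theorem fromBerezin_fvec_pow_base_eq (hW : IsSymbolCorrespondence p W) {n : ℕ} (hn : n ≤ p)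
    {a b : Fin 3 → ℂ} (hab : a ⬝ᵥ b = 0) :
    (fromBerezin W (fvec a b ^ n)).1 base = zonal W n ![1, -1, 0] * (a 0 * b 0) ^ n := by
  obtain ⟨k, hk, h2, h0, hb⟩ := exists_rot a
  set a' := k.1.mulVec a with ha'
  set b' := Matrix.vecMul b k⁻¹.1 with hb'
  have hab' : a' ⬝ᵥ b' = 0 := by
    rw [dotProduct_comm, ha', hb', ← Matrix.dotProduct_mulVec, Matrix.mulVec_mulVec, inv_mul_val,
      Matrix.one_mulVec, dotProduct_comm, hab]
  have h1 := fromBerezin_act hW hn (u := fvec a b ^ n) (u' := fvec a' b' ^ n)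
    (fvec_pow_mem le_rfl hab) k (fun x => by
      change (fvec a' b').1 (act k x) ^ n = (fvec a b).1 x ^ n
      rw [fvec_act, ha', hb', Matrix.mulVec_mulVec, Matrix.vecMul_vecMul, inv_mul_val,
        Matrix.one_mulVec, Matrix.vecMul_one]) base
  rw [hk, fromBerezin_fvec_pow_base hW hn a' b'] at h1
  rw [← h1]
  have hy : (fun i => a' i * b' i) = (a 0 * b 0) • ![1, -1, 0] := by
    have h3 : a' 0 * b' 0 + a' 1 * b' 1 + a' 2 * b' 2 = 0 := by
      simpa [dotProduct, Fin.sum_univ_three] using hab'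
    ext i
    fin_cases i
    · simp [h0, hb b, hb']
    · simp only [Pi.smul_apply, smul_eq_mul]
      rw [h2, h0, show b' 0 = b 0 from hb b] at h3
      simp
      linear_combination h3
    · simp [h2]
  rw [hy, zonal_smul, mul_comm]

/-- Schur's lemma for the summand `(n,n)`, by hand: equivariance reduces the value at `g ξ g⁻¹` to
the value at the base point for translated `a` and `b`, where it is the `n`-th power of
`(a·z̄)(b·z)` up to one constant. -/
theorem map_dop_pow (hW : IsSymbolCorrespondence p W) {n : ℕ} (hn : n ≤ p)
    {a b : Fin 3 → ℂ} (hab : a ⬝ᵥ b = 0) :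
    W (dop p a b ^ n) = (zonal W n ![1, -1, 0] * p.descFactorial n) • fvec a b ^ n := by
  apply pull_injective; ext g
  change (W (dop p a b ^ n)).1 (act g base) = _ * (fvec a b).1 (act g base) ^ n
  set a' := g⁻¹.1.mulVec a with ha'
  set b' := Matrix.vecMul b g.1 with hb'
  have hab' : a' ⬝ᵥ b' = 0 := by
    rw [dotProduct_comm, ha', hb', ← Matrix.dotProduct_mulVec, Matrix.mulVec_mulVec, mul_inv_val,
      Matrix.one_mulVec, dotProduct_comm, hab]
  have h1 := fromBerezin_act hW hn (u := (p.descFactorial n : ℂ) • fvec a' b' ^ n)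
    (u' := berezin p (dop p a b ^ n))
    (Submodule.smul_mem _ _ (fvec_pow_mem le_rfl hab')) g (fun x => by
      rw [berezin_dop_pow hab]
      change (p.descFactorial n : ℂ) * (fvec a b).1 (act g x) ^ n = (p.descFactorial n : ℂ) *
        (fvec a' b').1 x ^ n
      rw [fvec_act]) base
  rw [fromBerezin_berezin, map_smul] at h1
  rw [h1]
  change (p.descFactorial n : ℂ) * (fromBerezin W (fvec a' b' ^ n)).1 base = _
  rw [fromBerezin_fvec_pow_base_eq hW hn hab', fvec_act_base]
  have ha0 : a' 0 = a ⬝ᵥ colBar g := by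
    simp [ha', Matrix.mulVec, dotProduct, inv_apply, colBar, mul_comm]
  have hb0 : b' 0 = b ⬝ᵥ col g := by
    simp [hb', Matrix.vecMul, dotProduct, col]
  rw [ha0, hb0]
  ring

theorem isDagger_dop (p : ℕ) : IsDagger (dop p (ee 0) (ee 2)) (dop p (ee 2) (ee 0)) := by
  apply isDagger_of_coh
  intro u z
  have h1 := dop_pow_coh (p := p) (a := ee 0) (b := ee 2) (by simp) 1 u
  have h2 := dop_pow_coh (p := p) (a := ee 2) (b := ee 0) (by simp) 1 z
  rw [pow_one] at h1 h2
  rw [herm_coh_right, herm_coh_left, h1, h2]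
  have h3 : starRingEnd ℂ (u ⬝ᵥ conjVec z) = z ⬝ᵥ conjVec u := by
    simp [dotProduct, conjVec, mul_comm]
  simp only [map_mul, map_pow, MvPolynomial.eval_C, eval_lin, h3, map_natCast]
  simp only [conjVec, single_one_dotProduct, Complex.conj_conj]
  ring

theorem fvec_conj (x : Orbit) :
    (fvec (ee 2) (ee 0)).1 x = starRingEnd ℂ ((fvec (ee 0) (ee 2)).1 x) := by
  obtain ⟨g, rfl⟩ := orbit_cases x
  rw [fvec_act_base, fvec_act_base]
  simp [col, colBar, mul_comm]

theorem exists_fvec_ne_zero : ∃ x : Orbit, (fvec (ee 0) (ee 2)).1 x ≠ 0 := by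
  obtain ⟨r, g, hg⟩ := exists_smul_col ![1, 0, 1]
  refine ⟨act g base, ?_⟩
  have h0 : (r : ℂ) * col g 0 = 1 := by simpa using (congrFun hg 0).symm
  have h2 : (r : ℂ) * col g 2 = 1 := by simpa using (congrFun hg 2).symm
  rw [fvec_act_base]
  simp only [single_one_dotProduct]
  refine mul_ne_zero ?_ (right_ne_zero_of_mul_eq_one h2)
  have : col g 0 ≠ 0 := right_ne_zero_of_mul_eq_one h0
  simpa [colBar, col] using this

/-- The number by which a symbol correspondence differs from the Berezin correspondence on the
`n`-th summand. -/
def relChar (W : Module.End ℂ (H p) →ₗ[ℂ] PolyOrbit) (n : ℕ) : ℝ := (zonal W n ![1, -1, 0]).re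

/-- The powers of `E₁₃` and of its adjoint `E₃₁` carry the same scalar, while their symbols are
conjugate to each other. -/
theorem ofReal_relChar (hW : IsSymbolCorrespondence p W) {n : ℕ} (hn : n ≤ p) :
    (relChar W n : ℂ) = zonal W n ![1, -1, 0] := by
  obtain ⟨x, hx⟩ := exists_fvec_ne_zero
  have h1 := hW.real _ _ ((isDagger_dop p).pow n) x
  rw [map_dop_pow hW hn (by simp), map_dop_pow hW hn (by simp)] at h1
  change _ * (fvec (ee 2) (ee 0)).1 x ^ n = starRingEnd ℂ (_ * (fvec (ee 0) (ee 2)).1 x ^ n) at h1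
  rw [fvec_conj, map_mul, map_pow, map_mul, map_natCast] at h1
  have h2 : starRingEnd ℂ ((fvec (ee 0) (ee 2)).1 x) ^ n ≠ 0 := pow_ne_zero _ (by simpa using hx)
  have h3 := mul_right_cancel₀ (descFactorial_ne hn) (mul_right_cancel₀ h2 h1)
  exact Complex.conj_eq_iff_re.1 h3.symm

theorem map_dop_pow_eq (hW : IsSymbolCorrespondence p W) {n : ℕ} (hn : n ≤ p)
    {a b : Fin 3 → ℂ} (hab : a ⬝ᵥ b = 0) :
    W (dop p a b ^ n) = ((relChar W n : ℂ) * p.descFactorial n) • fvec a b ^ n := by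
  rw [map_dop_pow hW hn hab, ofReal_relChar hW hn]

/-- Otherwise injectivity of `W` would make `V₊^n` zero, contradicting its nonzero Berezin symbol.
-/
theorem relChar_ne_zero (hW : IsSymbolCorrespondence p W) {n : ℕ} (hn : n ≤ p) :
    relChar W n ≠ 0 := by
  intro h0
  have h1 := map_dop_pow_eq hW hn (a := ee 0) (b := ee 2) (by simp)
  rw [h0, Complex.ofReal_zero, zero_mul, zero_smul] at h1
  have h2 : dop p (ee 0) (ee 2) ^ n = 0 := hW.injective (by rw [h1, map_zero])
  have h3 := berezin_dop_pow (p := p) (a := ee 0) (b := ee 2) (by simp) n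
  rw [h2, map_zero] at h3
  obtain ⟨x, hx⟩ := exists_fvec_ne_zero
  have h4 : (0 : ℂ) = p.descFactorial n * (fvec (ee 0) (ee 2)).1 x ^ n :=
    congrFun (congrArg Subtype.val h3) x
  exact mul_ne_zero (descFactorial_ne hn) (pow_ne_zero _ hx) h4.symm

theorem fromBerezin_fvec_pow (hW : IsSymbolCorrespondence p W) {n : ℕ} (hn : n ≤ p)
    {a b : Fin 3 → ℂ} (hab : a ⬝ᵥ b = 0) :
    fromBerezin W (fvec a b ^ n) = (relChar W n : ℂ) • fvec a b ^ n := by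
  have h1 := fromBerezin_berezin (W := W) (dop p a b ^ n)
  rw [berezin_dop_pow hab, map_smul, map_dop_pow_eq hW hn hab, mul_comm, mul_smul] at h1
  exact smul_right_injective _ (descFactorial_ne hn) h1


/-! ### Characteristic numbers -/

theorem Vplus_eq (p : ℕ) : Vplus p = dop p (ee 0) (ee 2) := by
  simp [Vplus, dop, Fin.sum_univ_three]

/-- The constant is `(3i/√6)(-i√2) = √3`: the first factor turns matrix functions into coordinates,
the second turns `-(E₄ + iE₅)` into a matrix unit. -/
theorem vplus_eq (x : Orbit) : vplus x = ((√3 : ℝ) : ℂ) * (fvec (ee 0) (ee 2)).1 x := by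
  have h1 : ∀ j, coord j x.1 = (3 * Complex.I / ((√6 : ℝ) : ℂ)) * (fpoly (-E j)).1 x := by
    intro j
    have := congrFun (congrArg Subtype.val (toPoly_X j)) x
    rw [toPoly_val, MvPolynomial.eval_X] at this
    exact this
  have h2 : -E 3 + Complex.I • (-E 4) =
      (-(Complex.I * ((√2 : ℝ) : ℂ))) • Matrix.vecMulVec (ee 0) (ee 2) := by
    have h := sqrt_two_sq
    have h0 := sqrt_two_ne
    ext i j
    fin_cases i <;> fin_cases j <;> simp [E, gellMann, Matrix.vecMulVec_apply]
    all_goals field_simp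
    all_goals try rw [Complex.I_sq]
    all_goals first | ring1 | linear_combination h
  have h3 : (fpoly (-E 3)).1 x + Complex.I * (fpoly (-E 4)).1 x
      = -(Complex.I * ((√2 : ℝ) : ℂ)) * (fvec (ee 0) (ee 2)).1 x := by
    have := congrArg (fun M => (fpoly M).1 x) h2
    simp only [fpoly_add, fpoly_smul] at this
    exact this
  have h4 : ((√6 : ℝ) : ℂ) = ((√2 : ℝ) : ℂ) * ((√3 : ℝ) : ℂ) := by
    rw [← Complex.ofReal_mul, ← Real.sqrt_mul (by norm_num)]; norm_num
  have h20 := sqrt_two_ne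
  have h30 := sqrt_three_ne
  rw [vplus, h1, h1]
  have : ∀ r s : ℂ, (3 * Complex.I / ((√6 : ℝ) : ℂ)) * r
      + Complex.I * ((3 * Complex.I / ((√6 : ℝ) : ℂ)) * s)
      = (3 * Complex.I / ((√6 : ℝ) : ℂ)) * (r + Complex.I * s) := by intro r s; ring
  rw [this, h3, h4]
  field_simp
  linear_combination (-3 * (fvec (ee 0) (ee 2)).1 x) * Complex.I_sq -
    (fvec (ee 0) (ee 2)).1 x * sqrt_three_sq

/-- The integrand `|z₀|^{2n}|z₂|^{2n}` is, up to a multinomial coefficient, the Berezin symbol on `H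
(2n)` of the projection onto the monomial `X₀^n X₂^n`. Normalization gives its integral as the trace
`1` over the dimension. -/
theorem orbitIntegral_fvec_pow (n : ℕ) :
    orbitIntegral (fvec (ee 0) (ee 2) ^ n * fvec (ee 2) (ee 0) ^ n).1
      = (n.factorial : ℂ) ^ 2 * 2 / ((2 * n + 2).factorial : ℂ) := by
  let c : Fin 3 →₀ ℕ := Finsupp.single 0 n + Finsupp.single 2 n
  have hc : c.degree = 2 * n := by simp [c, two_mul]
  have hc0 : c 0 = n := by simp [c]
  have hc1 : c 1 = 0 := by simp [c]
  have hc2 : c 2 = n := by simp [c]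
  let v : H (2 * n) := ⟨MvPolynomial.monomial c 1, MvPolynomial.isHomogeneous_monomial _ hc⟩
  let φ : H (2 * n) →ₗ[ℂ] ℂ := (MvPolynomial.lcoeff ℂ c).comp (Submodule.subtype _)
  let A : Module.End ℂ (H (2 * n)) := φ.smulRight v
  have hA : LinearMap.trace ℂ (H (2 * n)) A = 1 := by
    rw [LinearMap.trace_smulRight]
    simp [φ, v]
  have hmult : (n.factorial : ℂ) ^ 2 * (Nat.multinomial Finset.univ c : ℂ)
      = ((2 * n).factorial : ℂ) := by
    have := Nat.multinomial_spec Finset.univ c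
    rw [Fin.prod_univ_three, Fin.sum_univ_three, hc0, hc1, hc2, add_zero, ← two_mul] at this
    rw [← this]
    push_cast
    ring
  have hB : berezin (2 * n) A = (Nat.multinomial Finset.univ c : ℂ) •
      (fvec (ee 0) (ee 2) ^ n * fvec (ee 2) (ee 0) ^ n) := by
    apply pull_injective; ext g
    change (berezin _ A).1 (act g base) = _ * ((fvec (ee 0) (ee 2)).1 (act g base) ^ n *
      (fvec (ee 2) (ee 0)).1 (act g base) ^ n)
    rw [berezin_act_base, fvec_act_base, fvec_act_base]
    have h1 : A (coh (2 * n) (col g)) = ((lin (col g) ^ (2 * n)).coeff c) • v := rfl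
    rw [h1, coeff_lin_pow _ _ hc, Submodule.coe_smul, MvPolynomial.smul_eval,
      MvPolynomial.eval_monomial, Finsupp.prod_fintype _ _ (by simp), Fin.prod_univ_three,
      Fin.prod_univ_three, hc0, hc1, hc2]
    simp only [single_one_dotProduct]
    ring
  have h1 := berezin_normalized A
  rw [hB, hA, finrank_H] at h1
  have h2 : orbitIntegral ((Nat.multinomial Finset.univ c : ℂ) •
      (fvec (ee 0) (ee 2) ^ n * fvec (ee 2) (ee 0) ^ n)).1
      = (Nat.multinomial Finset.univ c : ℂ) * orbitIntegral
        (fvec (ee 0) (ee 2) ^ n * fvec (ee 2) (ee 0) ^ n).1 :=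
    orbitIntegralL.map_smul _ _
  rw [h2] at h1
  have hm0 : (Nat.multinomial Finset.univ c : ℂ) ≠ 0 :=
    Nat.cast_ne_zero.2 (Nat.multinomial_pos _ _).ne'
  have hch : ((2 * n + 2).choose 2 : ℂ) = (2 * n + 2) * (2 * n + 1) / 2 := by
    rw [Nat.cast_choose_two]; push_cast; ring
  have hf : ((2 * n + 2).factorial : ℂ) = (2 * n + 2) * ((2 * n + 1) * (2 * n).factorial) := by
    rw [Nat.factorial_succ, Nat.factorial_succ]; push_cast; ring
  rw [hch] at h1
  have e1 : (2 * n + 1 : ℂ) ≠ 0 := by exact_mod_cast Nat.succ_ne_zero (2 * n)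
  have e2 : (2 * n + 2 : ℂ) ≠ 0 := by exact_mod_cast Nat.succ_ne_zero (2 * n + 1)
  have e3 : (n.factorial : ℂ) ≠ 0 := Nat.cast_ne_zero.2 (Nat.factorial_ne_zero n)
  rw [hf, ← hmult]
  apply mul_left_cancel₀ hm0
  rw [h1]
  field_simp

theorem orbitIntegral_vplus (n : ℕ) :
    (orbitIntegral fun y => ((‖vplus y ^ n‖ ^ 2 : ℝ) : ℂ)).re
      = 3 ^ n * ((n.factorial : ℝ) ^ 2 * 2 / ((2 * n + 2).factorial : ℝ)) := by
  have h1 : (fun y : Orbit => ((‖vplus y ^ n‖ ^ 2 : ℝ) : ℂ))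
      = (((3 : ℂ) ^ n) • (fvec (ee 0) (ee 2) ^ n * fvec (ee 2) (ee 0) ^ n)).1 := by
    ext y
    change _ = (3 : ℂ) ^ n * ((fvec (ee 0) (ee 2)).1 y ^ n * (fvec (ee 2) (ee 0)).1 y ^ n)
    rw [fvec_conj, ← Complex.normSq_eq_norm_sq, Complex.normSq_eq_conj_mul_self, vplus_eq,
      ← sqrt_three_sq]
    simp only [map_pow, map_mul, Complex.conj_ofReal, mul_pow]
    ring
  have h2 : orbitIntegral (((3 : ℂ) ^ n) • (fvec (ee 0) (ee 2) ^ n * fvec (ee 2) (ee 0) ^ n)).1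
      = (3 : ℂ) ^ n * orbitIntegral (fvec (ee 0) (ee 2) ^ n * fvec (ee 2) (ee 0) ^ n).1 :=
    orbitIntegralL.map_smul _ _
  rw [h1, h2, orbitIntegral_fvec_pow]
  have : (3 : ℂ) ^ n * ((n.factorial : ℂ) ^ 2 * 2 / ((2 * n + 2).factorial : ℂ))
      = ((3 ^ n * ((n.factorial : ℝ) ^ 2 * 2 / ((2 * n + 2).factorial : ℝ)) : ℝ) : ℂ) := by
    push_cast; ring
  rw [this, Complex.ofReal_re]

/-- The characteristic numbers of the Berezin correspondence. -/
def berChar (n p : ℕ) : ℝ := √((p.choose n : ℝ) / ((p + n + 2).choose n : ℝ))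

theorem berChar_pos {n p : ℕ} (h : n ≤ p) : 0 < berChar n p := by
  have h1 : 0 < (p.choose n : ℝ) := Nat.cast_pos.2 (Nat.choose_pos h)
  have h2 : 0 < ((p + n + 2).choose n : ℝ) := Nat.cast_pos.2 (Nat.choose_pos (by omega))
  exact Real.sqrt_pos.2 (div_pos h1 h2)

theorem mu_pos (n p : ℕ) : 0 < mu n p := by
  rw [mu]; positivity

/-- Both sides are nonnegative, so squares may be compared. The factors depending on `n` alone
cancel between `μ_n(p)` and the norm of `v₊^n`. -/
theorem sqrt_finrank_mul (n p : ℕ) (h : n ≤ p) :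
    √(Module.finrank ℂ (H p) : ℝ) * ((mu n p)⁻¹ * (p.descFactorial n : ℝ))
      = berChar n p * (√3 ^ n /
        √(3 ^ n * ((n.factorial : ℝ) ^ 2 * 2 / ((2 * n + 2).factorial : ℝ)))) := by
  have hmu := mu_pos n p
  have hb := berChar_pos h
  have f1 : ((p + 2).choose 2 : ℝ) = (p + 2).factorial / (2 * p.factorial) := by
    rw [Nat.cast_choose ℝ (by omega : 2 ≤ p + 2)]; simp
  have f2 : (p.descFactorial n : ℝ) = p.factorial / (p - n).factorial := by
    rw [← Nat.factorial_mul_descFactorial h]; push_cast; field_simp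
  have f3 : (p.choose n : ℝ) = p.factorial / (n.factorial * (p - n).factorial) :=
    Nat.cast_choose ℝ h
  have f4 : ((p + n + 2).choose n : ℝ) = (p + n + 2).factorial / (n.factorial * (p + 2).factorial) := by
    rw [Nat.cast_choose ℝ (by omega : n ≤ p + n + 2), show p + n + 2 - n = p + 2 by omega]
  have hsq : (√(Module.finrank ℂ (H p) : ℝ) * ((mu n p)⁻¹ * (p.descFactorial n : ℝ))) ^ 2
      = (berChar n p * (√3 ^ n /
        √(3 ^ n * ((n.factorial : ℝ) ^ 2 * 2 / ((2 * n + 2).factorial : ℝ))))) ^ 2 := by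
    simp only [mul_pow, div_pow, inv_pow, berChar, mu]
    rw [Real.sq_sqrt (by positivity), Real.sq_sqrt (by positivity), Real.sq_sqrt (by positivity),
      Real.sq_sqrt (by positivity), Real.sq_sqrt (by positivity), ← pow_mul, mul_comm n 2, pow_mul,
      Real.sq_sqrt (by norm_num), finrank_H, f1, f2, f3, f4]
    field_simp
  have hl : 0 ≤ √(Module.finrank ℂ (H p) : ℝ) * ((mu n p)⁻¹ * (p.descFactorial n : ℝ)) := by
    positivity
  have hr : 0 ≤ berChar n p * (√3 ^ n /
        √(3 ^ n * ((n.factorial : ℝ) ^ 2 * 2 / ((2 * n + 2).factorial : ℝ)))) := by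
    positivity
  exact (pow_left_inj₀ hl hr two_ne_zero).1 hsq

theorem harmonic_eq (n : ℕ) (x : Orbit) : harmonic n x = ((√3 ^ n /
    √(3 ^ n * ((n.factorial : ℝ) ^ 2 * 2 / ((2 * n + 2).factorial : ℝ))) : ℝ) : ℂ) *
      (fvec (ee 0) (ee 2)).1 x ^ n := by
  rw [harmonic, orbitIntegral_vplus, vplus_eq, mul_pow, Complex.ofReal_div, Complex.ofReal_pow]
  ring

variable {p : ℕ} {W : Module.End ℂ (H p) →ₗ[ℂ] PolyOrbit}

/-- Equivariance removes `g`, and both sides of the defining identity are multiples of the same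
function, which is nonzero somewhere. This yields existence and uniqueness together. -/
theorem isCharacteristicNumber_iff (hW : IsSymbolCorrespondence p W) {n : ℕ} (hn : n ≤ p) (c : ℝ) :
    IsCharacteristicNumber p W n c ↔ c = relChar W n * berChar n p := by
  set K : ℝ := √3 ^ n /
    √(3 ^ n * ((n.factorial : ℝ) ^ 2 * 2 / ((2 * n + 2).factorial : ℝ))) with hK
  have hK0 : K ≠ 0 := by positivity
  have hleft : ∀ (g : SU3) (x : Orbit),
      (W (((√(Module.finrank ℂ (H p) : ℝ) : ℝ) : ℂ) • conj g (operatorBasis p n))).1 (act g x)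
        = ((relChar W n * berChar n p : ℝ) : ℂ) * (K * (fvec (ee 0) (ee 2)).1 x ^ n) := by
    intro g x
    rw [map_smul]
    change ((√(Module.finrank ℂ (H p) : ℝ) : ℝ) : ℂ) * (W (conj g (operatorBasis p n))).1 (act g x)
      = _
    rw [hW.equivariant, operatorBasis, Vplus_eq, map_smul, map_dop_pow_eq hW hn (by simp)]
    change ((√(Module.finrank ℂ (H p) : ℝ) : ℝ) : ℂ) * ((((mu n p)⁻¹ : ℝ) : ℂ) *
      ((relChar W n : ℂ) * p.descFactorial n * (fvec (ee 0) (ee 2)).1 x ^ n)) = _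
    have h := congrArg (fun r : ℝ => (r : ℂ)) (sqrt_finrank_mul n p hn)
    simp only [← hK] at h
    push_cast at h ⊢
    linear_combination (relChar W n : ℂ) * (fvec (ee 0) (ee 2)).1 x ^ n * h
  constructor
  · intro h
    obtain ⟨x, hx⟩ := exists_fvec_ne_zero
    have h1 := h 1 x
    rw [hleft, harmonic_eq, ← hK] at h1
    have h2 : (K : ℂ) * (fvec (ee 0) (ee 2)).1 x ^ n ≠ 0 :=
      mul_ne_zero (Complex.ofReal_ne_zero.2 hK0) (pow_ne_zero _ hx)
    exact_mod_cast (mul_right_cancel₀ h2 h1).symm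
  · rintro rfl g x
    rw [hleft, harmonic_eq]

theorem relChar_berezin {n : ℕ} (hn : n ≤ p) : relChar (berezin p) n = 1 := by
  have h1 := map_dop_pow_eq (isSymbolCorrespondence_berezin p) hn (a := ee 0) (b := ee 2) (by simp)
  rw [berezin_dop_pow (by simp)] at h1
  obtain ⟨x, hx⟩ := exists_fvec_ne_zero
  have h2 : (p.descFactorial n : ℂ) * (fvec (ee 0) (ee 2)).1 x ^ n = (relChar (berezin p) n : ℂ) *
      p.descFactorial n * (fvec (ee 0) (ee 2)).1 x ^ n := congrFun (congrArg Subtype.val h1) x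
  have h3 := mul_right_cancel₀ (pow_ne_zero n hx) h2
  have h4 : (relChar (berezin p) n : ℂ) = 1 :=
    mul_right_cancel₀ (descFactorial_ne hn) (by rw [one_mul]; exact h3.symm)
  exact_mod_cast h4

/-! ### Asymptotics of the Berezin numbers -/

theorem isBigO_ratio_sub_one (n j : ℕ) :
    (fun p : ℕ => (p.descFactorial j : ℝ) / ((p + n + 2).descFactorial j : ℝ) - 1)
      =O[atTop] fun p : ℕ => 1 / (p : ℝ) := by
  induction j with
  | zero => simp [Asymptotics.isBigO_zero]
  | succ j ih =>
    have hone : (fun p : ℕ => 1 / (p : ℝ)) =O[atTop] fun _ : ℕ => (1 : ℝ) :=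
      (tendsto_one_div_atTop_nhds_zero_nat).isBigO_one ℝ
    have hfac : (fun p : ℕ => (((p - j : ℕ) : ℝ) / ((p + n + 2 - j : ℕ) : ℝ)) - 1)
        =O[atTop] fun p : ℕ => 1 / (p : ℝ) := by
      apply Asymptotics.IsBigO.of_bound (2 * (n + 2))
      -- For `p > 2j` the denominator `p + n + 2 - j` exceeds `p/2`, which explains the constant
      -- `2(n + 2)`.
      filter_upwards [eventually_gt_atTop (2 * j)] with p hp
      have hp0 : (0 : ℝ) < p := Nat.cast_pos.2 (by omega)
      rw [Nat.cast_sub (by omega : j ≤ p), Nat.cast_sub (by omega : j ≤ p + n + 2)]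
      push_cast
      have hj : 2 * (j : ℝ) < p := by exact_mod_cast hp
      have hn0 : (0 : ℝ) ≤ n := Nat.cast_nonneg n
      have hd : (0 : ℝ) < p + n + 2 - j := by linarith
      have e : ((p : ℝ) - j) / (p + n + 2 - j) - 1 = -((n + 2) / (p + n + 2 - j)) := by
        field_simp; ring
      rw [e, norm_neg, Real.norm_of_nonneg (by positivity), Real.norm_of_nonneg (by positivity),
        mul_one_div, div_le_div_iff₀ hd hp0]
      nlinarith
    -- The identity `xy - 1 = (x-1)(y-1) + (x-1) + (y-1)` adds one factor of the falling factorials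
    -- at a time.
    have hsplit : (fun p : ℕ => (p.descFactorial (j + 1) : ℝ) / ((p + n + 2).descFactorial (j + 1) : ℝ) - 1)
        = fun p : ℕ => ((((p - j : ℕ) : ℝ) / ((p + n + 2 - j : ℕ) : ℝ)) - 1) *
            ((p.descFactorial j : ℝ) / ((p + n + 2).descFactorial j : ℝ) - 1) +
            ((((p - j : ℕ) : ℝ) / ((p + n + 2 - j : ℕ) : ℝ)) - 1) +
            ((p.descFactorial j : ℝ) / ((p + n + 2).descFactorial j : ℝ) - 1) := by
      ext p
      rw [Nat.descFactorial_succ, Nat.descFactorial_succ, Nat.cast_mul, Nat.cast_mul,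
        mul_div_mul_comm]
      ring
    rw [hsplit]
    refine ((Asymptotics.IsBigO.add ?_ hfac)).add ih
    have := hfac.mul (ih.trans hone)
    simpa using this

theorem choose_div_choose (n p : ℕ) : (p.choose n : ℝ) / ((p + n + 2).choose n : ℝ)
    = (p.descFactorial n : ℝ) / ((p + n + 2).descFactorial n : ℝ) := by
  rw [Nat.descFactorial_eq_factorial_mul_choose, Nat.descFactorial_eq_factorial_mul_choose,
    Nat.cast_mul, Nat.cast_mul, mul_div_mul_left _ _ (Nat.cast_ne_zero.2 (Nat.factorial_ne_zero n))]

/-- The square root does not increase the distance to `1`, because `y - 1 = (√y - 1)(√y + 1)`. -/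
theorem isBigO_berChar_sub_one (n : ℕ) : (fun p : ℕ => |berChar n p - 1|)
    =O[atTop] fun p : ℕ => 1 / (p : ℝ) := by
  refine Asymptotics.IsBigO.trans (Asymptotics.IsBigO.of_bound 1 (Eventually.of_forall fun p => ?_))
    (isBigO_ratio_sub_one n n)
  rw [berChar, ← choose_div_choose, one_mul, norm_abs_eq_norm, Real.norm_eq_abs, Real.norm_eq_abs]
  set y : ℝ := (p.choose n : ℝ) / ((p + n + 2).choose n : ℝ)
  have hy : 0 ≤ y := by positivity
  have e : y - 1 = (√y - 1) * (√y + 1) := by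
    have := Real.mul_self_sqrt hy
    linear_combination -this
  rw [e, abs_mul]
  have : 1 ≤ |√y + 1| := by
    rw [abs_of_nonneg (by positivity)]
    linarith [Real.sqrt_nonneg y]
  nlinarith [abs_nonneg (√y - 1)]

theorem tendsto_berChar (n : ℕ) : Tendsto (fun p => berChar n p) atTop (𝓝 1) := by
  have h1 := (isBigO_berChar_sub_one n).trans_tendsto tendsto_one_div_atTop_nhds_zero_nat
  have h2 := (tendsto_zero_iff_abs_tendsto_zero (fun p => berChar n p - 1)).2 h1
  simpa using h2.add_const 1


/-! ### The supremum norm -/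

theorem bddAbove_norm (f : PolyOrbit) : BddAbove (Set.range fun x : Orbit => ‖f.1 x‖) := by
  obtain ⟨C, hC⟩ := (isCompact_range (continuous_pull f)).isBounded.exists_norm_le
  refine ⟨C, ?_⟩
  rintro _ ⟨x, rfl⟩
  obtain ⟨g, rfl⟩ := orbit_cases x
  exact hC _ ⟨g, rfl⟩

theorem norm_le_supNorm (f : PolyOrbit) (x : Orbit) : ‖f.1 x‖ ≤ supNorm f :=
  le_ciSup (bddAbove_norm f) x

theorem supNorm_nonneg (f : PolyOrbit) : 0 ≤ supNorm f :=
  (norm_nonneg _).trans (norm_le_supNorm f base)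

theorem supNorm_le {f : PolyOrbit} {C : ℝ} (h : ∀ x, ‖f.1 x‖ ≤ C) : supNorm f ≤ C :=
  haveI : Nonempty Orbit := ⟨base⟩
  ciSup_le h

theorem supNorm_add_le (f h : PolyOrbit) : supNorm (f + h) ≤ supNorm f + supNorm h :=
  supNorm_le fun x => (norm_add_le (f.1 x) (h.1 x)).trans
    (add_le_add (norm_le_supNorm f x) (norm_le_supNorm h x))

theorem supNorm_smul_le (r : ℂ) (f : PolyOrbit) : supNorm (r • f) ≤ ‖r‖ * supNorm f :=
  supNorm_le fun x => (norm_mul_le r (f.1 x)).trans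
    (mul_le_mul_of_nonneg_left (norm_le_supNorm f x) (norm_nonneg _))

theorem supNorm_zero : supNorm 0 = 0 :=
  le_antisymm (supNorm_le fun x => by
    change ‖(0 : ℂ)‖ ≤ 0
    simp) (supNorm_nonneg 0)

/-- Uniform convergence of a sequence of polynomial functions on the orbit. -/
def Conv (u : ℕ → PolyOrbit) (v : PolyOrbit) : Prop :=
  Tendsto (fun p => supNorm (u p - v)) atTop (𝓝 0)

theorem Conv.of_le {u : ℕ → PolyOrbit} {v : PolyOrbit} {b : ℕ → ℝ}
    (hb : Tendsto b atTop (𝓝 0)) (h : ∀ p, supNorm (u p - v) ≤ b p) : Conv u v :=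
  squeeze_zero (fun _ => supNorm_nonneg _) h hb

theorem conv_const (v : PolyOrbit) : Conv (fun _ => v) v :=
  Conv.of_le tendsto_const_nhds fun _ => by rw [sub_self, supNorm_zero]

theorem Conv.congr' {u u' : ℕ → PolyOrbit} {v : PolyOrbit} (h : Conv u v)
    (huu : ∀ᶠ p in atTop, u p = u' p) : Conv u' v :=
  Tendsto.congr' (huu.mono fun p hp => by rw [hp]) h

theorem Conv.add {u u' : ℕ → PolyOrbit} {v v' : PolyOrbit} (h : Conv u v) (h' : Conv u' v') :
    Conv (fun p => u p + u' p) (v + v') := by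
  refine Conv.of_le (by simpa using Tendsto.add h h') fun p => ?_
  rw [add_sub_add_comm]
  exact supNorm_add_le _ _

theorem Conv.smul {α : ℕ → ℂ} {a : ℂ} {u : ℕ → PolyOrbit} {v : PolyOrbit}
    (hα : Tendsto α atTop (𝓝 a)) (h : Conv u v) : Conv (fun p => α p • u p) (a • v) := by
  have hb : Tendsto (fun p => ‖α p‖ * supNorm (u p - v) + ‖α p - a‖ * supNorm v) atTop (𝓝 0) := by
    have h1 := (hα.norm.mul h).add
      ((tendsto_iff_norm_sub_tendsto_zero.1 hα).mul_const (supNorm v))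
    simpa using h1
  refine Conv.of_le hb fun p => ?_
  have : α p • u p - a • v = α p • (u p - v) + (α p - a) • v := by
    rw [smul_sub, sub_smul]; abel
  rw [this]
  exact (supNorm_add_le _ _).trans (add_le_add (supNorm_smul_le _ _) (supNorm_smul_le _ _))

theorem Conv.sub {u u' : ℕ → PolyOrbit} {v v' : PolyOrbit} (h : Conv u v) (h' : Conv u' v') :
    Conv (fun p => u p - u' p) (v - v') := by
  have := h.add (Conv.smul (α := fun _ => (-1 : ℂ)) tendsto_const_nhds h')
  simpa [sub_eq_add_neg] using this

theorem Conv.sum {ι : Type*} {u : ι → ℕ → PolyOrbit} {v : ι → PolyOrbit} {s : Finset ι}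
    (h : ∀ i ∈ s, Conv (u i) (v i)) : Conv (fun p => ∑ i ∈ s, u i p) (∑ i ∈ s, v i) := by
  classical
  induction s using Finset.induction_on with
  | empty => simpa using conv_const 0
  | insert i s hi ih =>
    simp only [Finset.sum_insert hi]
    exact (h i (Finset.mem_insert_self i s)).add
      (ih fun j hj => h j (Finset.mem_insert_of_mem hj))

theorem Conv.apply {u : ℕ → PolyOrbit} {v : PolyOrbit} (h : Conv u v) (x : Orbit) :
    Tendsto (fun p => (u p).1 x) atTop (𝓝 (v.1 x)) := by
  rw [tendsto_iff_norm_sub_tendsto_zero]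
  exact squeeze_zero (fun _ => norm_nonneg _) (fun p => norm_le_supNorm (u p - v) x) h

/-- A multiple of a fixed nonzero function converges only if the scalars do. -/
theorem Conv.tendsto_of_smul {α : ℕ → ℂ} {a : ℂ} {v : PolyOrbit} (h : Conv (fun p => α p • v)
    (a • v)) {x : Orbit} (hx : v.1 x ≠ 0) : Tendsto α atTop (𝓝 a) := by
  have := (h.apply x).mul_const (v.1 x)⁻¹
  have e : ∀ r : ℂ, (r • v).1 x * (v.1 x)⁻¹ = r := fun r => by
    change r * v.1 x * (v.1 x)⁻¹ = r
    rw [mul_assoc, mul_inv_cancel₀ hx, mul_one]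
  simpa only [e] using this

/-! ### The Poisson bracket -/

theorem bracket_eq_sum (F G : MvPolynomial (Fin 8) ℂ) :
    bracket F G = ∑ j, ∑ k, (∑ l, MvPolynomial.C (structConst k j l) * MvPolynomial.X l) *
      MvPolynomial.pderiv j F * MvPolynomial.pderiv k G := by
  simp only [bracket, Finset.sum_mul]

theorem bracket_add_left (F F' G : MvPolynomial (Fin 8) ℂ) :
    bracket (F + F') G = bracket F G + bracket F' G := by
  simp only [bracket, map_add, mul_add, add_mul, Finset.sum_add_distrib]

theorem bracket_add_right (F G G' : MvPolynomial (Fin 8) ℂ) :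
    bracket F (G + G') = bracket F G + bracket F G' := by
  simp only [bracket, map_add, mul_add, Finset.sum_add_distrib]

theorem bracket_smul_left (r : ℂ) (F G : MvPolynomial (Fin 8) ℂ) :
    bracket (r • F) G = r • bracket F G := by
  simp only [bracket, Finset.smul_sum, (MvPolynomial.pderiv _).map_smul, mul_smul_comm,
    smul_mul_assoc]

theorem bracket_smul_right (r : ℂ) (F G : MvPolynomial (Fin 8) ℂ) :
    bracket F (r • G) = r • bracket F G := by
  simp only [bracket, Finset.smul_sum, (MvPolynomial.pderiv _).map_smul, mul_smul_comm]

theorem bracket_pow_pow (F G : MvPolynomial (Fin 8) ℂ) (n m : ℕ) :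
    bracket (F ^ n) (G ^ m) =
      ((n * m : ℕ) : ℂ) • (F ^ (n - 1) * G ^ (m - 1) * bracket F G) := by
  simp only [bracket, Finset.smul_sum, Finset.mul_sum, Derivation.leibniz_pow, nsmul_eq_mul,
    smul_eq_mul]
  refine Finset.sum_congr rfl fun j _ => Finset.sum_congr rfl fun k _ =>
    Finset.sum_congr rfl fun l _ => ?_
  rw [← MvPolynomial.C_mul']
  simp only [Nat.cast_mul, map_mul, map_natCast]
  ring

/-- The Poisson tensor at `x` is the matrix of a commutator with `x`. This makes it computable by
traces and shows its tangency to the orbit. -/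
theorem sum_structConst_mul_coord (j k : Fin 8) (x : Orbit) :
    ∑ l, structConst k j l * coord l x.1 = coord j (x.1 * E k - E k * x.1) := by
  have h : ∑ l, structConst k j l * coord l x.1 =
      -((E k * E j - E j * E k) * ∑ l, coord l x.1 • E l).trace := by
    simp only [Finset.mul_sum, Matrix.trace_sum, mul_smul_comm, Matrix.trace_smul, smul_eq_mul,
      ← Finset.sum_neg_distrib, structConst, coord_eq _ (E k * E j - E j * E k)]
    refine Finset.sum_congr rfl fun l _ => ?_
    rw [Matrix.trace_mul_comm (E l)]
    ring
  rw [h, sum_coord_smul_E, coord_eq, sub_mul, mul_sub, Matrix.trace_sub, Matrix.trace_sub,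
    ← mul_assoc, ← mul_assoc]
  linear_combination Matrix.trace_mul_cycle (E j) x.1 (E k)

theorem eval_bracket (F G : MvPolynomial (Fin 8) ℂ) (x : Orbit) :
    eval (fun j => coord j x.1) (bracket F G) =
      ∑ j, ∑ k, coord j (x.1 * E k - E k * x.1) *
        eval (fun j => coord j x.1) (MvPolynomial.pderiv j F) *
        eval (fun j => coord j x.1) (MvPolynomial.pderiv k G) := by
  simp only [bracket_eq_sum, map_sum, map_mul, MvPolynomial.eval_C, MvPolynomial.eval_X,
    sum_structConst_mul_coord]

theorem coord_commutator_swap (j k : Fin 8) (X : Matrix (Fin 3) (Fin 3) ℂ) :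
    coord j (X * E k - E k * X) = -coord k (X * E j - E j * X) := by
  simp only [coord_eq, mul_sub, Matrix.trace_sub, ← mul_assoc]
  rw [Matrix.trace_mul_cycle (E j) X, Matrix.trace_mul_cycle (E k) X]
  ring

theorem sum_coord_mul_trace {X : Matrix (Fin 3) (Fin 3) ℂ} (hX : X.trace = 0)
    (M : Matrix (Fin 3) (Fin 3) ℂ) : ∑ j, coord j X * (M * E j).trace = (M * X).trace := by
  have h : ∑ j, coord j X • E j = X := by
    have := sum_trace_smul_E X
    rw [hX, zero_div, zero_smul, zero_sub] at this
    simp only [coord_eq, neg_smul, Finset.sum_neg_distrib, this, neg_neg]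
  conv_rhs => rw [← h]
  simp only [Finset.mul_sum, mul_smul_comm, Matrix.trace_sum, Matrix.trace_smul, smul_eq_mul]

theorem pderiv_Lpoly (M : Matrix (Fin 3) (Fin 3) ℂ) (j : Fin 8) :
    MvPolynomial.pderiv j (Lpoly M) =
      MvPolynomial.C (-(Complex.I * ((√6 : ℝ) : ℂ) / 3 * (M * E j).trace)) := by
  rw [Lpoly, map_sub, MvPolynomial.pderiv_C, zero_sub, map_sum,
    Finset.sum_eq_single j, MvPolynomial.pderiv_C_mul, MvPolynomial.pderiv_X_self, mul_one, map_neg]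
  · intro i _ hi
    rw [MvPolynomial.pderiv_C_mul, MvPolynomial.pderiv_X_of_ne hi, mul_zero]
  · simp

theorem integralRadius_mul_sqrt_six : (integralRadius : ℂ) * ((√6 : ℝ) : ℂ) = 2 := by
  rw [← Complex.ofReal_mul, integralRadius, ← Real.sqrt_mul (by norm_num),
    show (2 / 3 * 6 : ℝ) = 2 ^ 2 by norm_num, Real.sqrt_sq (by norm_num)]
  norm_num

/-- The gradients contribute `(i√6/3)² = -2/3`, and `r√6 = 2` for the integral radius `r`; this
matches the normalization `√(2/3)` of the commutator. The constant terms play no role since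
commutators have trace zero. -/
theorem toPoly_bracket_Lpoly (M N : Matrix (Fin 3) (Fin 3) ℂ) :
    Complex.I • toPoly (bracket (Lpoly M) (Lpoly N)) =
      (integralRadius : ℂ) • fpoly (M * N - N * M) := by
  apply Subtype.ext; ext x
  change Complex.I * (toPoly (bracket (Lpoly M) (Lpoly N))).1 x =
    (integralRadius : ℂ) * (fpoly (M * N - N * M)).1 x
  have tr0 (A B : Matrix (Fin 3) (Fin 3) ℂ) : (A * B - B * A).trace = 0 := by
    rw [Matrix.trace_sub, Matrix.trace_mul_comm, sub_self]
  have key : (toPoly (bracket (Lpoly M) (Lpoly N))).1 x =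
      -(2 / 3) * ((M * N - N * M) * x.1).trace := by
    rw [toPoly_val, eval_bracket]
    simp only [pderiv_Lpoly, MvPolynomial.eval_C]
    rw [Finset.sum_comm]
    have h1 (k : Fin 8) : ∑ j, coord j (x.1 * E k - E k * x.1) *
        -(Complex.I * ((√6 : ℝ) : ℂ) / 3 * (M * E j).trace) *
        -(Complex.I * ((√6 : ℝ) : ℂ) / 3 * (N * E k).trace) =
        -(2 / 3) * (-coord k (M * x.1 - x.1 * M) * (N * E k).trace) := by
      have h2 : -coord k (M * x.1 - x.1 * M) =
          ∑ j, coord j (x.1 * E k - E k * x.1) * (M * E j).trace := by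
        rw [sum_coord_mul_trace (tr0 _ _), coord_eq, neg_neg, mul_sub, mul_sub, Matrix.trace_sub,
          Matrix.trace_sub, ← mul_assoc, ← mul_assoc, ← mul_assoc, ← mul_assoc]
        linear_combination -Matrix.trace_mul_cycle M x.1 (E k) - Matrix.trace_mul_cycle (E k) x.1 M
      rw [h2, Finset.sum_mul, Finset.mul_sum]
      refine Finset.sum_congr rfl fun j _ => ?_
      have hc : (Complex.I * ((√6 : ℝ) : ℂ) / 3) * (Complex.I * ((√6 : ℝ) : ℂ) / 3) = -(2 / 3) := by
        linear_combination (Complex.I ^ 2 / 9) * sqrt_six_sq + 6 / 9 * Complex.I_sq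
      rw [← hc]; ring
    simp only [h1, ← Finset.mul_sum, neg_mul, Finset.sum_neg_distrib]
    rw [sum_coord_mul_trace (tr0 _ _), mul_sub, sub_mul, Matrix.trace_sub, Matrix.trace_sub,
      ← mul_assoc, ← mul_assoc]
    linear_combination (-2 / 3) * Matrix.trace_mul_cycle N x.1 M
  rw [key, fpoly_val, proj, Matrix.mul_smul, Matrix.trace_smul, mul_sub, Matrix.trace_sub, mul_one,
    tr0, Matrix.mul_smul, Matrix.trace_smul, smul_eq_mul, smul_eq_mul]
  linear_combination (Complex.I * ((M * N - N * M) * x.1).trace / 3) * integralRadius_mul_sqrt_six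

/-! ### Descent of the Poisson bracket to the orbit -/

/-- A polynomial along a differentiable curve. -/
theorem hasDerivAt_eval {c : ℝ → Fin 8 → ℂ} {c' : Fin 8 → ℂ} {t : ℝ}
    (h : ∀ j, HasDerivAt (fun s => c s j) (c' j) t) (F : MvPolynomial (Fin 8) ℂ) :
    HasDerivAt (fun s => eval (c s) F)
      (∑ j, c' j * eval (c t) (MvPolynomial.pderiv j F)) t := by
  induction F using MvPolynomial.induction_on with
  | C r => simpa using hasDerivAt_const t r
  | add F G hF hG =>
    simp only [map_add, mul_add, Finset.sum_add_distrib]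
    exact hF.add hG
  | mul_X F i hF =>
    have := hF.mul (h i)
    simp only [map_mul, MvPolynomial.eval_X]
    refine HasDerivAt.congr_deriv this ?_
    simp only [Derivation.leibniz, smul_eq_mul, map_add, map_mul, MvPolynomial.eval_X, mul_add,
      Finset.sum_add_distrib, Finset.sum_mul]
    rw [add_comm]
    congr 1
    · rw [Finset.sum_eq_single i]
      · simp [mul_comm]
      · intro j _ hj
        rw [MvPolynomial.pderiv_X_of_ne hj.symm]; simp
      · simp
    · exact Finset.sum_congr rfl fun j _ => by ring

/-- The orbit is stable under conjugation by unitary matrices. -/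
theorem unitary_conj_mem {U : Matrix (Fin 3) (Fin 3) ℂ} (hU : U ∈ Matrix.unitaryGroup (Fin 3) ℂ)
    (x : Orbit) : ∃ g : SU3, U * x.1 * star U = g.1 * xi * g⁻¹.1 := by
  obtain ⟨h, hh⟩ := x.2
  have hd : star U.det * U.det = 1 := by
    have := (Matrix.mem_unitaryGroup_iff').1 hU
    rw [← Matrix.det_one (n := Fin 3) (R := ℂ), ← this, Matrix.det_mul, Matrix.star_eq_conjTranspose,
      Matrix.det_conjTranspose]
  -- A cube root of the conjugate determinant moves `U` into `SU(3)`, and this phase cancels under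
  -- conjugation.
  obtain ⟨r, hr⟩ := IsAlgClosed.exists_pow_nat_eq (star U.det) (n := 3) (by norm_num)
  have hrn : ‖r‖ = 1 := by
    have h1 : ‖U.det‖ = 1 := by
      have := congrArg norm hd
      rw [norm_mul, norm_star, norm_one] at this
      nlinarith [norm_nonneg U.det]
    have h2 := congrArg norm hr
    rw [norm_pow, norm_star, h1] at h2
    exact (pow_eq_one_iff_of_nonneg (norm_nonneg r) (by norm_num)).1 h2
  have hrr : r * star r = 1 := by
    rw [Complex.star_def, Complex.mul_conj, Complex.normSq_eq_norm_sq, hrn]; norm_num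
  have hV : r • U ∈ Matrix.specialUnitaryGroup (Fin 3) ℂ := by
    rw [Matrix.mem_specialUnitaryGroup_iff, Matrix.mem_unitaryGroup_iff]
    constructor
    · rw [star_smul, smul_mul_smul_comm, (Matrix.mem_unitaryGroup_iff).1 hU, hrr, one_smul]
    · rw [Matrix.det_smul, Fintype.card_fin, hr, hd]
  refine ⟨⟨r • U, hV⟩ * h, ?_⟩
  rw [mul_inv_rev, hh]
  have : ((⟨r • U, hV⟩ : SU3)⁻¹).1 = star (r • U) := rfl
  simp only [Submonoid.coe_mul, this, star_smul, mul_assoc, smul_mul_assoc, mul_smul_comm, smul_smul,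
    mul_comm (star r) r, hrr, one_smul]

open scoped Matrix.Norms.Operator in
theorem hasDerivAt_conj_exp (A X : Matrix (Fin 3) (Fin 3) ℂ) :
    HasDerivAt (fun t : ℝ => NormedSpace.exp (t • A) * X * NormedSpace.exp (t • -A))
      (A * X - X * A) 0 := by
  have h1 := hasDerivAt_exp_smul_const (𝕂 := ℝ) A (0 : ℝ)
  have h2 := hasDerivAt_exp_smul_const (𝕂 := ℝ) (-A) (0 : ℝ)
  have := (h1.mul_const X).mul h2
  simp only [zero_smul, NormedSpace.exp_zero, one_mul, mul_one, mul_neg, ← sub_eq_add_neg] at this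
  exact this

theorem exp_smul_E_mem (t : ℝ) (k : Fin 8) :
    NormedSpace.exp (t • E k) ∈ Matrix.unitaryGroup (Fin 3) ℂ ∧
      star (NormedSpace.exp (t • E k)) = NormedSpace.exp (t • -E k) := by
  have hs : star (NormedSpace.exp (t • E k)) = NormedSpace.exp (t • -E k) := by
    rw [Matrix.star_eq_conjTranspose, ← Matrix.exp_conjTranspose, Matrix.conjTranspose_smul,
      E_conjTranspose]
    simp
  refine ⟨?_, hs⟩
  rw [Matrix.mem_unitaryGroup_iff, hs, ← Matrix.exp_add_of_commute]
  · simp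
  · simp

open scoped Matrix.Norms.Operator in
theorem hasDerivAt_coord_conj_exp (A X : Matrix (Fin 3) (Fin 3) ℂ) (j : Fin 8) :
    HasDerivAt (fun t : ℝ => coord j (NormedSpace.exp (t • A) * X * NormedSpace.exp (t • -A)))
      (coord j (A * X - X * A)) 0 := by
  let L : Matrix (Fin 3) (Fin 3) ℂ →ₗ[ℝ] ℂ :=
    { toFun := coord j
      map_add' := fun M N => by simp [coord, mul_add]
      map_smul' := fun r M => by simp [coord] }
  exact (LinearMap.toContinuousLinearMap L).hasFDerivAt.comp_hasDerivAt 0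
    (hasDerivAt_conj_exp A X)

/-- The Hamiltonian vector fields of the coordinates are tangent to the orbit. -/
theorem sum_coord_commutator_mul_pderiv {F : MvPolynomial (Fin 8) ℂ} (hF : toPoly F = 0)
    (x : Orbit) (k : Fin 8) :
    ∑ j, coord j (E k * x.1 - x.1 * E k) *
      eval (fun j => coord j x.1) (MvPolynomial.pderiv j F) = 0 := by
  have h := hasDerivAt_eval (fun j => hasDerivAt_coord_conj_exp (E k) x.1 j) F
  -- The curve stays on the orbit, where `F` vanishes; its velocity at `0` is the commutator in the
  -- goal.
  have h0 : (fun s : ℝ => eval (fun j => coord j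
      (NormedSpace.exp (s • E k) * x.1 * NormedSpace.exp (s • -E k))) F) = fun _ => 0 := by
    ext s
    obtain ⟨hU, hs⟩ := exp_smul_E_mem s k
    obtain ⟨g, hg⟩ := unitary_conj_mem hU x
    rw [← hs]
    have := toPoly_val F ⟨_, g, hg⟩
    rw [hF] at this
    exact this.symm
  rw [h0] at h
  have := h.unique (hasDerivAt_const (0 : ℝ) (0 : ℂ))
  simpa using this

/-- The bracket is a sum over `k` of `∂_k G` times the derivative of `F` along a field tangent to
the orbit. -/
theorem toPoly_bracket_eq_zero_left {F : MvPolynomial (Fin 8) ℂ} (hF : toPoly F = 0)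
    (G : MvPolynomial (Fin 8) ℂ) : toPoly (bracket F G) = 0 := by
  apply Subtype.ext; ext x
  rw [toPoly_val, eval_bracket, Finset.sum_comm]
  change _ = (0 : ℂ)
  refine Finset.sum_eq_zero fun k _ => ?_
  have := sum_coord_commutator_mul_pderiv hF x k
  have hn (j : Fin 8) : coord j (x.1 * E k - E k * x.1) = -coord j (E k * x.1 - x.1 * E k) := by
    rw [coord_eq, coord_eq, ← neg_sub, mul_neg, Matrix.trace_neg]
  simp only [hn, neg_mul, Finset.sum_neg_distrib, ← Finset.sum_mul, this, zero_mul, neg_zero]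

theorem toPoly_bracket_eq_zero_right {G : MvPolynomial (Fin 8) ℂ} (hG : toPoly G = 0)
    (F : MvPolynomial (Fin 8) ℂ) : toPoly (bracket F G) = 0 := by
  apply Subtype.ext; ext x
  rw [toPoly_val, eval_bracket]
  change _ = (0 : ℂ)
  refine Finset.sum_eq_zero fun j _ => ?_
  have := sum_coord_commutator_mul_pderiv hG x j
  have hn (k : Fin 8) : coord j (x.1 * E k - E k * x.1) = coord k (E j * x.1 - x.1 * E j) := by
    rw [coord_commutator_swap, coord_eq, coord_eq, ← neg_sub, mul_neg, Matrix.trace_neg]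
    ring
  simp only [hn]
  rw [← zero_mul (eval (fun j => coord j x.1) (MvPolynomial.pderiv j F)), ← this, Finset.sum_mul]
  exact Finset.sum_congr rfl fun k _ => by ring

/-- Polynomials are sums of powers of nilpotent linear functions and polynomials that vanish on the
orbit. -/
theorem poly_induction {motive : MvPolynomial (Fin 8) ℂ → Prop}
    (zero : ∀ F, toPoly F = 0 → motive F)
    (pow : ∀ a b n, a ⬝ᵥ b = 0 → motive (Lpoly (Matrix.vecMulVec a b) ^ n))
    (add : ∀ F G, motive F → motive G → motive (F + G))
    (smul : ∀ (r : ℂ) F, motive F → motive (r • F)) (F : MvPolynomial (Fin 8) ℂ) : motive F := by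
  obtain ⟨n, hn⟩ := exists_mem_polySpan (toPoly F)
  suffices H : ∀ f ∈ polySpan n, ∃ G, toPoly G = f ∧ motive G by
    obtain ⟨G, hG, hm⟩ := H _ hn
    -- `F` differs from a combination of nilpotent powers by a polynomial that vanishes on the
    -- orbit.
    have := add G (F - G) hm (zero _ (by rw [map_sub, hG, sub_self]))
    rwa [add_sub_cancel] at this
  intro f hf
  induction hf using Submodule.span_induction with
  | mem f h =>
    obtain ⟨k, -, a, b, hab, rfl⟩ := h
    exact ⟨_, map_pow toPoly _ k, pow a b k hab⟩
  | zero => exact ⟨0, map_zero _, zero 0 (map_zero _)⟩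
  | add f g _ _ hf hg =>
    obtain ⟨F, rfl, hF⟩ := hf
    obtain ⟨G, rfl, hG⟩ := hg
    exact ⟨F + G, map_add _ _ _, add _ _ hF hG⟩
  | smul r f _ hf =>
    obtain ⟨F, rfl, hF⟩ := hf
    exact ⟨r • F, map_smul _ _ _, smul _ _ hF⟩


/-! ### Twisted products -/

section Twisted

variable {p : ℕ} {W : Module.End ℂ (H p) →ₗ[ℂ] PolyOrbit}

theorem twisted_map (hW : Function.Injective W) (A B : Module.End ℂ (H p)) :
    twisted W (W A) (W B) = W (A * B) := by
  rw [twisted, Function.leftInverse_invFun hW A, Function.leftInverse_invFun hW B]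

/-- Membership in the range is essential: elsewhere `invFun` takes a default value and bilinearity
may fail. -/
theorem twisted_add_left (hW : Function.Injective W) {f f' h : PolyOrbit} (hf : f ∈ Set.range W)
    (hf' : f' ∈ Set.range W) (hh : h ∈ Set.range W) :
    twisted W (f + f') h = twisted W f h + twisted W f' h := by
  obtain ⟨A, rfl⟩ := hf
  obtain ⟨A', rfl⟩ := hf'
  obtain ⟨B, rfl⟩ := hh
  rw [← map_add, twisted_map hW, twisted_map hW, twisted_map hW, add_mul, map_add]

theorem twisted_add_right (hW : Function.Injective W) {f f' h : PolyOrbit} (hf : f ∈ Set.range W)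
    (hf' : f' ∈ Set.range W) (hh : h ∈ Set.range W) :
    twisted W h (f + f') = twisted W h f + twisted W h f' := by
  obtain ⟨A, rfl⟩ := hf
  obtain ⟨A', rfl⟩ := hf'
  obtain ⟨B, rfl⟩ := hh
  rw [← map_add, twisted_map hW, twisted_map hW, twisted_map hW, mul_add, map_add]

theorem twisted_smul_smul (hW : Function.Injective W) {f h : PolyOrbit} (r s : ℂ)
    (hf : f ∈ Set.range W) (hh : h ∈ Set.range W) :
    twisted W (r • f) (s • h) = (r * s) • twisted W f h := by
  obtain ⟨A, rfl⟩ := hf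
  obtain ⟨B, rfl⟩ := hh
  rw [← map_smul, ← map_smul, twisted_map hW, twisted_map hW, smul_mul_smul_comm, map_smul]

theorem twisted_fvec_pow (hW : IsSymbolCorrespondence p W) {n m : ℕ} (hn : n ≤ p) (hm : m ≤ p)
    {a b c d : Fin 3 → ℂ} (hab : a ⬝ᵥ b = 0) (hcd : c ⬝ᵥ d = 0) :
    twisted W (fvec a b ^ n) (fvec c d ^ m) =
      ((relChar W n * p.descFactorial n) * (relChar W m * p.descFactorial m) : ℂ)⁻¹ •
        W (dop p a b ^ n * dop p c d ^ m) := by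
  have hne {k : ℕ} (hk : k ≤ p) : (relChar W k * p.descFactorial k : ℂ) ≠ 0 :=
    mul_ne_zero (Complex.ofReal_ne_zero.2 (relChar_ne_zero hW hk)) (descFactorial_ne hk)
  have h (k : ℕ) (hk : k ≤ p) (a b : Fin 3 → ℂ) (hab : a ⬝ᵥ b = 0) :
      fvec a b ^ k = (relChar W k * p.descFactorial k : ℂ)⁻¹ • W (dop p a b ^ k) := by
    rw [map_dop_pow_eq hW hk hab, inv_smul_smul₀ (hne hk)]
  rw [h n hn a b hab, h m hm c d hcd, twisted_smul_smul hW.injective _ _ ⟨_, rfl⟩ ⟨_, rfl⟩,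
    twisted_map hW.injective, ← mul_inv]

/-- The whole sum is a Berezin symbol, but single terms need not be; only linearity of `fromBerezin
W` is used to separate them, so no bound by `p` is needed. -/
theorem map_dop_pow_mul_dop_pow {a b c d : Fin 3 → ℂ} (hab : a ⬝ᵥ b = 0) (hcd : c ⬝ᵥ d = 0)
    (n m : ℕ) : W (dop p a b ^ n * dop p c d ^ m) =
      ∑ kl ∈ Finset.HasAntidiagonal.antidiagonal n,
        ((n.choose kl.1 : ℂ) * m.descFactorial kl.1 * p.descFactorial (m + kl.2)) •
          fromBerezin W
            (fvec a b ^ kl.2 * fvec c d ^ (m - kl.1) * ((b ⬝ᵥ c) • fvec a d) ^ kl.1) := by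
  rw [← fromBerezin_berezin, berezin_dop_pow_mul_dop_pow hab hcd, map_sum]
  exact Finset.sum_congr rfl fun kl _ => map_smul _ _ _

theorem polySpan_le_range (hW : IsSymbolCorrespondence p W) {n : ℕ} (hn : n ≤ p) :
    polySpan n ≤ LinearMap.range W := by
  rw [polySpan, Submodule.span_le]
  rintro _ ⟨k, hk, a, b, hab, rfl⟩
  refine ⟨(relChar W k * p.descFactorial k : ℂ)⁻¹ • dop p a b ^ k, ?_⟩
  rw [map_smul, map_dop_pow_eq hW (hk.trans hn) hab, inv_smul_smul₀]
  exact mul_ne_zero (Complex.ofReal_ne_zero.2 (relChar_ne_zero hW (hk.trans hn)))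
    (descFactorial_ne (hk.trans hn))

end Twisted

/-! ### Asymptotics of the coefficients -/

theorem tendsto_descFactorial_div_pow (j : ℕ) :
    Tendsto (fun p : ℕ => (p.descFactorial j : ℂ) / (p : ℂ) ^ j) atTop (𝓝 1) := by
  induction j with
  | zero => simp
  | succ j ih =>
    have h1 : Tendsto (fun p : ℕ => ((p - j : ℕ) : ℂ) / p) atTop (𝓝 1) := by
      have h2 : Tendsto (fun p : ℕ => 1 - (j : ℂ) * (p : ℂ)⁻¹) atTop (𝓝 1) := by
        simpa using (tendsto_inv_atTop_nhds_zero_nat (𝕜 := ℂ)).const_mul (j : ℂ) |>.const_sub 1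
      refine h2.congr' ?_
      filter_upwards [eventually_ge_atTop (j + 1)] with p hp
      have hp0 : (p : ℂ) ≠ 0 := Nat.cast_ne_zero.2 (by omega)
      rw [Nat.cast_sub (by omega)]
      field_simp
    have := h1.mul ih
    rw [one_mul] at this
    refine this.congr fun p => ?_
    rw [Nat.descFactorial_succ, pow_succ, Nat.cast_mul, div_mul_div_comm, mul_comm (p : ℂ)]

/-- The quotient of falling factorials in the expansion of twisted products. -/
def descRatio (n m j p : ℕ) : ℂ :=
  (p.descFactorial j : ℂ) / (p.descFactorial n * p.descFactorial m)

/-- Falling factorials behave like powers of `p`, so the coefficient with `k` contractions is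
equivalent to `p^{-k}`. -/
theorem tendsto_descRatio_mul_pow {n m j k : ℕ} (h : j + k = n + m) :
    Tendsto (fun p : ℕ => descRatio n m j p * (p : ℂ) ^ k) atTop (𝓝 1) := by
  have h1 := (tendsto_descFactorial_div_pow j).div
    ((tendsto_descFactorial_div_pow n).mul (tendsto_descFactorial_div_pow m)) (by norm_num)
  rw [mul_one, div_one] at h1
  refine h1.congr' ?_
  filter_upwards [eventually_ge_atTop (n + m + 1)] with p hp
  have hp0 : (p : ℂ) ≠ 0 := Nat.cast_ne_zero.2 (by omega)
  have hn : (p.descFactorial n : ℂ) ≠ 0 := descFactorial_ne (by omega)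
  have hm : (p.descFactorial m : ℂ) ≠ 0 := descFactorial_ne (by omega)
  simp only [descRatio, Pi.div_apply]
  have hpk : (p : ℂ) ^ j * (p : ℂ) ^ k = (p : ℂ) ^ n * (p : ℂ) ^ m := by
    rw [← pow_add, h, pow_add]
  field_simp
  rw [mul_assoc, mul_assoc, hpk]

theorem tendsto_mul_pow_of_lt {u : ℕ → ℂ} {k i : ℕ} (hi : i < k)
    (h : Tendsto (fun p : ℕ => u p * (p : ℂ) ^ k) atTop (𝓝 1)) :
    Tendsto (fun p : ℕ => u p * (p : ℂ) ^ i) atTop (𝓝 0) := by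
  have h1 := h.mul ((tendsto_inv_atTop_nhds_zero_nat (𝕜 := ℂ)).pow (k - i))
  rw [zero_pow (by omega), mul_zero] at h1
  refine h1.congr' ?_
  filter_upwards [eventually_ge_atTop 1] with p hp
  have hp0 : (p : ℂ) ≠ 0 := Nat.cast_ne_zero.2 (by omega)
  rw [mul_assoc]
  congr 1
  rw [inv_pow, ← div_eq_mul_inv, div_eq_iff (pow_ne_zero _ hp0), ← pow_add]
  congr 1; omega

/-! ### Rays -/

section Ray

variable {W : (p : ℕ) → Module.End ℂ (H p) →ₗ[ℂ] PolyOrbit}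

theorem eventually_mem_range (hW : ∀ p : ℕ, 1 ≤ p → IsSymbolCorrespondence p (W p))
    (f : PolyOrbit) : ∀ᶠ p in atTop, f ∈ Set.range (W p) := by
  obtain ⟨n, hn⟩ := exists_mem_polySpan f
  filter_upwards [eventually_ge_atTop 1, eventually_ge_atTop n] with p h1 h2
  exact polySpan_le_range (hW p h1) h2 hn

/-- A fixed function involves only finitely many summands, so convergence of each scalar suffices,
without uniformity in `n`. -/
theorem conv_fromBerezin (hW : ∀ p : ℕ, 1 ≤ p → IsSymbolCorrespondence p (W p))
    (ht : ∀ n, Tendsto (fun p => (relChar (W p) n : ℂ)) atTop (𝓝 1)) (f : PolyOrbit) :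
    Conv (fun p => fromBerezin (W p) f) f := by
  obtain ⟨n, hn⟩ := exists_mem_polySpan f
  induction hn using Submodule.span_induction with
  | mem f h =>
    obtain ⟨k, -, a, b, hab, rfl⟩ := h
    have := (Conv.smul (ht k) (conv_const (fvec a b ^ k)))
    rw [one_smul] at this
    refine this.congr' ?_
    filter_upwards [eventually_ge_atTop 1, eventually_ge_atTop k] with p h1 h2
    rw [fromBerezin_fvec_pow (hW p h1) h2 hab]
  | zero => simpa using conv_const 0
  | add f g _ _ hf hg => simpa using hf.add hg
  | smul r f _ hf => simpa using Conv.smul (tendsto_const_nhds (x := r)) hf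

theorem twisted_fvec_pow_eq (hW : ∀ p : ℕ, 1 ≤ p → IsSymbolCorrespondence p (W p))
    {a b c d : Fin 3 → ℂ} (hab : a ⬝ᵥ b = 0) (hcd : c ⬝ᵥ d = 0) (n m : ℕ) :
    ∀ᶠ p in atTop, twisted (W p) (fvec a b ^ n) (fvec c d ^ m) =
      ∑ kl ∈ Finset.HasAntidiagonal.antidiagonal n,
        ((relChar (W p) n * relChar (W p) m : ℂ)⁻¹ *
          ((n.choose kl.1 : ℂ) * m.descFactorial kl.1 * descRatio n m (m + kl.2) p)) •
          fromBerezin (W p)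
            (fvec a b ^ kl.2 * fvec c d ^ (m - kl.1) * ((b ⬝ᵥ c) • fvec a d) ^ kl.1) := by
  filter_upwards [eventually_ge_atTop 1, eventually_ge_atTop n, eventually_ge_atTop m] with p h1 h2 h3
  rw [twisted_fvec_pow (hW p h1) h2 h3 hab hcd, map_dop_pow_mul_dop_pow hab hcd, Finset.smul_sum]
  refine Finset.sum_congr rfl fun kl _ => ?_
  rw [smul_smul]
  congr 1
  simp only [descRatio, mul_inv, div_eq_mul_inv]
  ring

/-- Every contraction costs a factor `1/p`, so only the term without contractions survives. -/
theorem conv_twisted_fvec_pow (hW : ∀ p : ℕ, 1 ≤ p → IsSymbolCorrespondence p (W p))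
    (ht : ∀ n, Tendsto (fun p => (relChar (W p) n : ℂ)) atTop (𝓝 1))
    {a b c d : Fin 3 → ℂ} (hab : a ⬝ᵥ b = 0) (hcd : c ⬝ᵥ d = 0) (n m : ℕ) :
    Conv (fun p => twisted (W p) (fvec a b ^ n) (fvec c d ^ m)) (fvec a b ^ n * fvec c d ^ m) := by
  have hinv : Tendsto (fun p => (relChar (W p) n * relChar (W p) m : ℂ)⁻¹) atTop (𝓝 1) := by
    simpa using ((ht n).mul (ht m)).inv₀ (by norm_num)
  have key := Conv.sum (s := Finset.HasAntidiagonal.antidiagonal n)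
    (u := fun kl p => ((relChar (W p) n * relChar (W p) m : ℂ)⁻¹ *
          ((n.choose kl.1 : ℂ) * m.descFactorial kl.1 * descRatio n m (m + kl.2) p)) •
          fromBerezin (W p)
            (fvec a b ^ kl.2 * fvec c d ^ (m - kl.1) * ((b ⬝ᵥ c) • fvec a d) ^ kl.1))
    (v := fun kl => (if kl.1 = 0 then (1 : ℂ) else 0) •
            (fvec a b ^ kl.2 * fvec c d ^ (m - kl.1) * ((b ⬝ᵥ c) • fvec a d) ^ kl.1)) ?_
  · have hv : ∑ kl ∈ Finset.HasAntidiagonal.antidiagonal n, (if kl.1 = 0 then (1 : ℂ) else 0) •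
        (fvec a b ^ kl.2 * fvec c d ^ (m - kl.1) * ((b ⬝ᵥ c) • fvec a d) ^ kl.1) =
        fvec a b ^ n * fvec c d ^ m := by
      rw [Finset.sum_eq_single (0, n)]
      · simp
      · rintro ⟨k, l⟩ hkl hne
        rw [Finset.HasAntidiagonal.mem_antidiagonal] at hkl
        have : k ≠ 0 := by
          rintro rfl
          exact hne (by simpa using hkl)
        simp [this]
      · simp
    rw [hv] at key
    refine key.congr' ?_
    filter_upwards [twisted_fvec_pow_eq hW hab hcd n m] with p hp using hp.symm
  · rintro ⟨k, l⟩ hkl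
    rw [Finset.HasAntidiagonal.mem_antidiagonal] at hkl
    dsimp only at hkl ⊢
    refine Conv.smul ?_ (conv_fromBerezin hW ht _)
    have hr := tendsto_descRatio_mul_pow (n := n) (m := m) (j := m + l) (k := k) (by omega)
    rw [← one_mul (if k = 0 then (1 : ℂ) else 0)]
    refine hinv.mul ?_
    rcases Nat.eq_zero_or_pos k with rfl | hk
    · simpa using hr
    · have := (tendsto_mul_pow_of_lt hk hr).const_mul ((n.choose k : ℂ) * m.descFactorial k)
      simpa [hk.ne'] using this

/-- The first order term of twisted products of powers of nilpotent linear functions. -/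
theorem conv_mul_twisted_sub (hW : ∀ p : ℕ, 1 ≤ p → IsSymbolCorrespondence p (W p))
    (ht : ∀ n, Tendsto (fun p => (relChar (W p) n : ℂ)) atTop (𝓝 1))
    {a b c d : Fin 3 → ℂ} (hab : a ⬝ᵥ b = 0) (hcd : c ⬝ᵥ d = 0) (n m : ℕ) :
    Conv (fun p => (p : ℂ) • (twisted (W p) (fvec a b ^ n) (fvec c d ^ m) -
        ((relChar (W p) n * relChar (W p) m : ℂ)⁻¹ * descRatio n m (n + m) p) •
          fromBerezin (W p) (fvec a b ^ n * fvec c d ^ m)))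
      (((n * m : ℕ) : ℂ) •
        (fvec a b ^ (n - 1) * fvec c d ^ (m - 1) * ((b ⬝ᵥ c) • fvec a d))) := by
  have hinv : Tendsto (fun p => (relChar (W p) n * relChar (W p) m : ℂ)⁻¹) atTop (𝓝 1) := by
    simpa using ((ht n).mul (ht m)).inv₀ (by norm_num)
  have hex := twisted_fvec_pow_eq hW hab hcd n m
  rcases n with _ | n
  · simp only [zero_mul, Nat.cast_zero, zero_smul]
    refine (conv_const 0).congr' ?_
    filter_upwards [hex] with p hp
    rw [hp]
    simp
  -- The subtracted multiple is the term without contractions. The others are indexed by `k + 1`, so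
  -- after multiplication by `p` the single contraction `k = 0` is the one that remains.
  · have key := Conv.sum (s := Finset.HasAntidiagonal.antidiagonal n)
      (u := fun kl p => ((relChar (W p) (n + 1) * relChar (W p) m : ℂ)⁻¹ *
            (((n + 1).choose (kl.1 + 1) : ℂ) * m.descFactorial (kl.1 + 1) *
              (descRatio (n + 1) m (m + kl.2) p * (p : ℂ) ^ 1))) •
            fromBerezin (W p) (fvec a b ^ kl.2 * fvec c d ^ (m - (kl.1 + 1)) *
              ((b ⬝ᵥ c) • fvec a d) ^ (kl.1 + 1)))
      (v := fun kl => (if kl.1 = 0 then (((n + 1) * m : ℕ) : ℂ) else 0) •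
              (fvec a b ^ kl.2 * fvec c d ^ (m - (kl.1 + 1)) *
                ((b ⬝ᵥ c) • fvec a d) ^ (kl.1 + 1))) ?_
    · have hv : ∑ kl ∈ Finset.HasAntidiagonal.antidiagonal n,
          (if kl.1 = 0 then (((n + 1) * m : ℕ) : ℂ) else 0) •
          (fvec a b ^ kl.2 * fvec c d ^ (m - (kl.1 + 1)) *
            ((b ⬝ᵥ c) • fvec a d) ^ (kl.1 + 1)) = (((n + 1) * m : ℕ) : ℂ) •
          (fvec a b ^ n * fvec c d ^ (m - 1) * ((b ⬝ᵥ c) • fvec a d)) := by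
        rw [Finset.sum_eq_single (0, n)]
        · simp
        · rintro ⟨k, l⟩ hkl hne
          rw [Finset.HasAntidiagonal.mem_antidiagonal] at hkl
          have : k ≠ 0 := by
            rintro rfl
            exact hne (by simpa using hkl)
          simp [this]
        · simp
      rw [hv] at key
      rw [Nat.add_sub_cancel]
      refine key.congr' ?_
      filter_upwards [hex] with p hp
      rw [hp, Finset.Nat.antidiagonal_succ, Finset.sum_cons, Finset.sum_map]
      simp only [Nat.choose_zero_right, Nat.descFactorial_zero, pow_zero, Nat.sub_zero, mul_one,
        Nat.cast_one, one_mul, Function.Embedding.prodMap, Function.Embedding.coeFn_mk,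
        Prod.map, Function.Embedding.refl_apply, Nat.succ_eq_add_one, add_comm m (n + 1),
        add_sub_cancel_left, Finset.smul_sum, smul_smul]
      refine Finset.sum_congr rfl fun kl _ => ?_
      congr 1
      ring
    · rintro ⟨k, l⟩ hkl
      rw [Finset.HasAntidiagonal.mem_antidiagonal] at hkl
      dsimp only at hkl ⊢
      refine Conv.smul ?_ (conv_fromBerezin hW ht _)
      have hr := tendsto_descRatio_mul_pow (n := n + 1) (m := m) (j := m + l) (k := k + 1) (by omega)
      rw [← one_mul (if k = 0 then _ else _)]
      refine hinv.mul ?_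
      rcases Nat.eq_zero_or_pos k with rfl | hk
      · have := hr.const_mul (((n + 1).choose (0 + 1) : ℂ) * m.descFactorial (0 + 1))
        simpa using this
      · have := (tendsto_mul_pow_of_lt (by omega : 1 < k + 1) hr).const_mul
          (((n + 1).choose (k + 1) : ℂ) * m.descFactorial (k + 1))
        simpa [hk.ne'] using this

/-- The conditions of Poisson type for one pair of polynomials, apart from membership. -/
def PoissonPair (W : (p : ℕ) → Module.End ℂ (H p) →ₗ[ℂ] PolyOrbit)
    (F G : MvPolynomial (Fin 8) ℂ) : Prop :=
  Conv (fun p => twisted (W p) (toPoly F) (toPoly G)) (toPoly F * toPoly G) ∧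
  Conv (fun p => ((p * integralRadius : ℝ) : ℂ) •
    (twisted (W p) (toPoly F) (toPoly G) - twisted (W p) (toPoly G) (toPoly F)))
    (Complex.I • toPoly (bracket F G))

/-- The membership clause is automatic: for large `p` the image contains any given step of the
filtration. -/
theorem isPoissonType_iff (hW : ∀ p : ℕ, 1 ≤ p → IsSymbolCorrespondence p (W p)) :
    IsPoissonType W ↔ ∀ F G, PoissonPair W F G :=
  ⟨fun h F G => (h F G).2, fun h F G =>
    ⟨(eventually_mem_range hW _).and (eventually_mem_range hW _), h F G⟩⟩

theorem toPoly_Lpoly_pow (a b : Fin 3 → ℂ) (n : ℕ) :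
    toPoly (Lpoly (Matrix.vecMulVec a b) ^ n) = fvec a b ^ n := map_pow _ _ _

theorem vecMulVec_mul_vecMulVec_fpoly (a b c d : Fin 3 → ℂ) :
    fpoly (Matrix.vecMulVec a b * Matrix.vecMulVec c d) = (b ⬝ᵥ c) • fvec a d := by
  rw [Matrix.vecMulVec_mul_vecMulVec, Matrix.vecMulVec_smul, fpoly_smul, fvec]

theorem I_smul_toPoly_bracket_Lpoly_pow (a b c d : Fin 3 → ℂ) (n m : ℕ) :
    Complex.I • toPoly (bracket (Lpoly (Matrix.vecMulVec a b) ^ n)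
      (Lpoly (Matrix.vecMulVec c d) ^ m)) = (integralRadius : ℂ) • (((n * m : ℕ) : ℂ) •
        (fvec a b ^ (n - 1) * fvec c d ^ (m - 1) *
          ((b ⬝ᵥ c) • fvec a d - (d ⬝ᵥ a) • fvec c b))) := by
  rw [bracket_pow_pow, map_smul, map_mul, map_mul, toPoly_Lpoly_pow, toPoly_Lpoly_pow,
    ← vecMulVec_mul_vecMulVec_fpoly, ← vecMulVec_mul_vecMulVec_fpoly, ← fpoly_sub,
    smul_comm Complex.I, ← mul_smul_comm, toPoly_bracket_Lpoly, mul_smul_comm, smul_comm]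

/-- The terms without contractions in the two orders have equal coefficients and cancel exactly,
before multiplication by `p`. Hence no rate of convergence of the scalars `relChar` is required. -/
theorem poissonPair_pow (hW : ∀ p : ℕ, 1 ≤ p → IsSymbolCorrespondence p (W p))
    (ht : ∀ n, Tendsto (fun p => (relChar (W p) n : ℂ)) atTop (𝓝 1))
    {a b c d : Fin 3 → ℂ} (hab : a ⬝ᵥ b = 0) (hcd : c ⬝ᵥ d = 0) (n m : ℕ) :
    PoissonPair W (Lpoly (Matrix.vecMulVec a b) ^ n) (Lpoly (Matrix.vecMulVec c d) ^ m) := by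
  rw [PoissonPair, toPoly_Lpoly_pow, toPoly_Lpoly_pow]
  refine ⟨conv_twisted_fvec_pow hW ht hab hcd n m, ?_⟩
  have h := (conv_mul_twisted_sub hW ht hab hcd n m).sub (conv_mul_twisted_sub hW ht hcd hab m n)
  have h2 := Conv.smul (tendsto_const_nhds (x := (integralRadius : ℂ))) h
  have hv : (integralRadius : ℂ) • ((((n * m : ℕ) : ℂ) •
        (fvec a b ^ (n - 1) * fvec c d ^ (m - 1) * ((b ⬝ᵥ c) • fvec a d))) -
      (((m * n : ℕ) : ℂ) •
        (fvec c d ^ (m - 1) * fvec a b ^ (n - 1) * ((d ⬝ᵥ a) • fvec c b)))) =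
      Complex.I • toPoly (bracket (Lpoly (Matrix.vecMulVec a b) ^ n)
        (Lpoly (Matrix.vecMulVec c d) ^ m)) := by
    rw [I_smul_toPoly_bracket_Lpoly_pow, mul_sub, smul_sub, smul_sub, smul_sub,
      mul_comm m n, mul_comm (fvec c d ^ (m - 1))]
  rw [hv] at h2
  refine h2.congr' (Eventually.of_forall fun p => ?_)
  have hs : descRatio m n (m + n) p = descRatio n m (n + m) p := by
    rw [descRatio, descRatio, add_comm, mul_comm (p.descFactorial n : ℂ)]
  rw [hs, mul_comm (fvec c d ^ m), mul_comm (relChar (W p) m : ℂ), ← smul_sub, sub_sub_sub_cancel_right,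
    smul_smul]
  rw [Complex.ofReal_mul, Complex.ofReal_natCast, mul_comm (integralRadius : ℂ)]

theorem PoissonPair.add_left (hW : ∀ p : ℕ, 1 ≤ p → IsSymbolCorrespondence p (W p))
    {F F' G : MvPolynomial (Fin 8) ℂ} (h : PoissonPair W F G) (h' : PoissonPair W F' G) :
    PoissonPair W (F + F') G := by
  have hl : ∀ᶠ p in atTop,
      twisted (W p) (toPoly F) (toPoly G) + twisted (W p) (toPoly F') (toPoly G) =
        twisted (W p) (toPoly F + toPoly F') (toPoly G) ∧
      twisted (W p) (toPoly G) (toPoly F) + twisted (W p) (toPoly G) (toPoly F') =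
        twisted (W p) (toPoly G) (toPoly F + toPoly F') := by
    filter_upwards [eventually_ge_atTop 1, eventually_mem_range hW (toPoly F),
      eventually_mem_range hW (toPoly F'), eventually_mem_range hW (toPoly G)] with p h1 h2 h3 h4
    exact ⟨(twisted_add_left (hW p h1).injective h2 h3 h4).symm,
      (twisted_add_right (hW p h1).injective h2 h3 h4).symm⟩
  constructor
  · rw [map_add, add_mul]
    exact (h.1.add h'.1).congr' (hl.mono fun p hp => hp.1)
  · rw [bracket_add_left, map_add, map_add, smul_add]
    refine (h.2.add h'.2).congr' (hl.mono fun p hp => ?_)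
    rw [← hp.1, ← hp.2, ← smul_add]
    congr 1; abel

theorem PoissonPair.add_right (hW : ∀ p : ℕ, 1 ≤ p → IsSymbolCorrespondence p (W p))
    {F F' G : MvPolynomial (Fin 8) ℂ} (h : PoissonPair W G F) (h' : PoissonPair W G F') :
    PoissonPair W G (F + F') := by
  have hl : ∀ᶠ p in atTop,
      twisted (W p) (toPoly F) (toPoly G) + twisted (W p) (toPoly F') (toPoly G) =
        twisted (W p) (toPoly F + toPoly F') (toPoly G) ∧
      twisted (W p) (toPoly G) (toPoly F) + twisted (W p) (toPoly G) (toPoly F') =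
        twisted (W p) (toPoly G) (toPoly F + toPoly F') := by
    filter_upwards [eventually_ge_atTop 1, eventually_mem_range hW (toPoly F),
      eventually_mem_range hW (toPoly F'), eventually_mem_range hW (toPoly G)] with p h1 h2 h3 h4
    exact ⟨(twisted_add_left (hW p h1).injective h2 h3 h4).symm,
      (twisted_add_right (hW p h1).injective h2 h3 h4).symm⟩
  constructor
  · rw [map_add, mul_add]
    exact (h.1.add h'.1).congr' (hl.mono fun p hp => hp.2)
  · rw [bracket_add_right, map_add, map_add, smul_add]
    refine (h.2.add h'.2).congr' (hl.mono fun p hp => ?_)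
    rw [← hp.1, ← hp.2, ← smul_add]
    congr 1; abel

theorem PoissonPair.smul_smul (hW : ∀ p : ℕ, 1 ≤ p → IsSymbolCorrespondence p (W p))
    {F G : MvPolynomial (Fin 8) ℂ} (r s : ℂ) (h : PoissonPair W F G) :
    PoissonPair W (r • F) (s • G) := by
  have hl : ∀ᶠ p in atTop,
      (r * s) • twisted (W p) (toPoly F) (toPoly G) =
        twisted (W p) (r • toPoly F) (s • toPoly G) ∧
      (r * s) • twisted (W p) (toPoly G) (toPoly F) =
        twisted (W p) (s • toPoly G) (r • toPoly F) := by
    filter_upwards [eventually_ge_atTop 1, eventually_mem_range hW (toPoly F),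
      eventually_mem_range hW (toPoly G)] with p h1 h2 h3
    rw [twisted_smul_smul (hW p h1).injective _ _ h2 h3,
      twisted_smul_smul (hW p h1).injective _ _ h3 h2, mul_comm s r]
    exact ⟨rfl, rfl⟩
  constructor
  · rw [map_smul, map_smul, smul_mul_smul_comm]
    exact (Conv.smul tendsto_const_nhds h.1).congr' (hl.mono fun p hp => hp.1)
  · have := Conv.smul (tendsto_const_nhds (x := r * s)) h.2
    rw [bracket_smul_left, bracket_smul_right, map_smul, map_smul, map_smul, map_smul,
      _root_.smul_smul r s, smul_comm Complex.I]
    refine this.congr' (hl.mono fun p hp => ?_)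
    rw [← hp.1, ← hp.2, ← smul_sub, smul_comm]

/-- The twisted product with the zero function is eventually zero, so the claim amounts to the
descent of the bracket. -/
theorem poissonPair_of_toPoly_eq_zero (hW : ∀ p : ℕ, 1 ≤ p → IsSymbolCorrespondence p (W p))
    {F G : MvPolynomial (Fin 8) ℂ} (h : toPoly F = 0 ∨ toPoly G = 0) : PoissonPair W F G := by
  have hl : ∀ᶠ p in atTop, twisted (W p) (toPoly F) (toPoly G) = 0 ∧
      twisted (W p) (toPoly G) (toPoly F) = 0 := by
    filter_upwards [eventually_ge_atTop 1, eventually_mem_range hW (toPoly F),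
      eventually_mem_range hW (toPoly G)] with p h1 h2 h3
    have hs {f h : PolyOrbit} (r s : ℂ) (hf : f ∈ Set.range (W p)) (hh : h ∈ Set.range (W p)) :=
      twisted_smul_smul (hW p h1).injective r s hf hh
    rcases h with h | h
    · have e1 := hs 0 1 h2 h3
      have e2 := hs 1 0 h3 h2
      rw [h] at *
      simpa using And.intro e1 e2
    · have e1 := hs 1 0 h2 h3
      have e2 := hs 0 1 h3 h2
      rw [h] at *
      simpa using And.intro e1 e2
  have hm : toPoly F * toPoly G = 0 := by rcases h with h | h <;> simp [h]
  have hb : toPoly (bracket F G) = 0 := by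
    rcases h with h | h
    exacts [toPoly_bracket_eq_zero_left h G, toPoly_bracket_eq_zero_right h F]
  constructor
  · rw [hm]
    exact (conv_const 0).congr' (hl.mono fun p hp => hp.1.symm)
  · rw [hb, smul_zero]
    exact (conv_const 0).congr' (hl.mono fun p hp => by rw [hp.1, hp.2, sub_zero, smul_zero])

theorem isPoissonType_of_tendsto (hW : ∀ p : ℕ, 1 ≤ p → IsSymbolCorrespondence p (W p))
    (ht : ∀ n, Tendsto (fun p => (relChar (W p) n : ℂ)) atTop (𝓝 1)) : IsPoissonType W := by
  rw [isPoissonType_iff hW]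
  intro F G
  induction F using poly_induction with
  | zero F hF => exact poissonPair_of_toPoly_eq_zero hW (Or.inl hF)
  | add F F' h h' => exact h.add_left hW h'
  | smul r F h => simpa using h.smul_smul hW r 1
  | pow a b n hab =>
    induction G using poly_induction with
    | zero G hG => exact poissonPair_of_toPoly_eq_zero hW (Or.inr hG)
    | add G G' h h' => exact h.add_right hW h'
    | smul r G h => simpa using h.smul_smul hW 1 r
    | pow c d m hcd => exact poissonPair_pow hW ht hab hcd n m

/-- Powers of one nilpotent operator multiply without contractions, so the twisted product is an
explicit multiple of one fixed function. The ratio of falling factorials tends to `1` and can be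
divided out. -/
theorem tendsto_relChar_div (hW : ∀ p : ℕ, 1 ≤ p → IsSymbolCorrespondence p (W p))
    (hP : IsPoissonType W) (n m : ℕ) :
    Tendsto (fun p => (relChar (W p) (n + m) / (relChar (W p) n * relChar (W p) m) : ℂ))
      atTop (𝓝 1) := by
  have h02 : ee 0 ⬝ᵥ ee 2 = 0 := by simp
  have h := ((isPoissonType_iff hW).1 hP (Lpoly (Matrix.vecMulVec (ee 0) (ee 2)) ^ n)
    (Lpoly (Matrix.vecMulVec (ee 0) (ee 2)) ^ m)).1
  rw [toPoly_Lpoly_pow, toPoly_Lpoly_pow] at h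
  rw [← pow_add, ← one_smul ℂ (fvec (ee 0) (ee 2) ^ (n + m))] at h
  have h2 : Conv (fun p => ((relChar (W p) (n + m) / (relChar (W p) n * relChar (W p) m) : ℂ) *
      descRatio n m (n + m) p) • fvec (ee 0) (ee 2) ^ (n + m))
      ((1 : ℂ) • fvec (ee 0) (ee 2) ^ (n + m)) := by
    refine h.congr' ?_
    filter_upwards [eventually_ge_atTop 1, eventually_ge_atTop (n + m)] with p h1 h2
    rw [twisted_fvec_pow (hW p h1) (by omega) (by omega) h02 h02, ← pow_add,
      map_dop_pow_eq (hW p h1) h2 h02, smul_smul]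
    congr 1
    simp only [descRatio, mul_inv, div_eq_mul_inv]
    ring
  obtain ⟨x, hx⟩ := exists_fvec_ne_zero
  have h3 := h2.tendsto_of_smul (x := x) (pow_ne_zero (n + m) hx)
  have h4 := tendsto_descRatio_mul_pow (n := n) (m := m) (j := n + m) (k := 0) rfl
  have h5 := h3.div h4 one_ne_zero
  rw [div_one] at h5
  refine h5.congr' ?_
  filter_upwards [eventually_ge_atTop (n + m)] with p h1
  have : descRatio n m (n + m) p ≠ 0 := div_ne_zero (descFactorial_ne h1)
    (mul_ne_zero (descFactorial_ne (by omega)) (descFactorial_ne (by omega)))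
  rw [Pi.div_apply, pow_zero, mul_one, mul_div_assoc, div_self this, mul_one]

/-- The commutator of `E₁₃` and `E₃₁` has Berezin symbol `p K`, and `K` lies in the summand `(1,1)`
like the two factors. One scalar `relChar` in the numerator against two in the denominator leaves
its inverse, which the bracket condition forces to tend to `1`. -/
theorem tendsto_relChar_one (hW : ∀ p : ℕ, 1 ≤ p → IsSymbolCorrespondence p (W p))
    (hP : IsPoissonType W) : Tendsto (fun p => (relChar (W p) 1 : ℂ)) atTop (𝓝 1) := by
  have h02 : ee 0 ⬝ᵥ ee 2 = 0 := by simp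
  have h20 : ee 2 ⬝ᵥ ee 0 = 0 := by simp
  have h00 : ee 0 ⬝ᵥ ee 0 = 1 := by simp
  have h22 : ee 2 ⬝ᵥ ee 2 = 1 := by simp
  set K : PolyOrbit := fvec (ee 0) (ee 0) - fvec (ee 2) (ee 2) with hK
  -- The diagonal function `K` is written through nilpotent elements, on which `fromBerezin W` is
  -- known.
  have hKn : K = fvec (ee 0 + ee 2) (ee 0 - ee 2) ^ 1 + fvec (ee 0) (ee 2) ^ 1 -
      fvec (ee 2) (ee 0) ^ 1 := by
    simp only [pow_one, hK, fvec, ← fpoly_add, ← fpoly_sub, Matrix.add_vecMulVec,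
      Matrix.vecMulVec_sub]
    congr 1; abel
  have hK0 : K.1 base ≠ 0 := by
    have : K.1 base = 1 := by
      change (fvec (ee 0) (ee 0)).1 base - (fvec (ee 2) (ee 2)).1 base = 1
      rw [← act_one base, fvec_act_base, fvec_act_base]
      simp [col, colBar]
    rw [this]; exact one_ne_zero
  have h := ((isPoissonType_iff hW).1 hP (Lpoly (Matrix.vecMulVec (ee 0) (ee 2)) ^ 1)
    (Lpoly (Matrix.vecMulVec (ee 2) (ee 0)) ^ 1)).2
  rw [I_smul_toPoly_bracket_Lpoly_pow, toPoly_Lpoly_pow, toPoly_Lpoly_pow, h00, h22] at h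
  simp only [one_smul, Nat.sub_self, pow_zero, one_mul, mul_one, Nat.cast_one, ← hK] at h
  have hr : (integralRadius : ℂ) ≠ 0 := by
    intro h0
    have := integralRadius_mul_sqrt_six
    rw [h0, zero_mul] at this
    norm_num at this
  have h2 : Conv (fun p => ((integralRadius : ℂ) * (relChar (W p) 1 : ℂ)⁻¹) • K)
      ((integralRadius : ℂ) • K) := by
    refine h.congr' ?_
    filter_upwards [eventually_ge_atTop 1] with p h1
    have hT : fromBerezin (W p) K = (relChar (W p) 1 : ℂ) • K := by
      rw [hKn, map_sub, map_add, fromBerezin_fvec_pow (hW p h1) h1 (by simp),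
        fromBerezin_fvec_pow (hW p h1) h1 h02, fromBerezin_fvec_pow (hW p h1) h1 h20,
        smul_sub, smul_add]
    have ht := relChar_ne_zero (hW p h1) h1
    have hp0 : (p : ℂ) ≠ 0 := Nat.cast_ne_zero.2 (by omega)
    have e1 := twisted_fvec_pow (hW p h1) h1 h1 h02 h20
    have e2 := twisted_fvec_pow (hW p h1) h1 h1 h20 h02
    rw [map_dop_pow_mul_dop_pow h02 h20, Finset.Nat.antidiagonal_succ] at e1
    rw [map_dop_pow_mul_dop_pow h20 h02, Finset.Nat.antidiagonal_succ] at e2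
    have e3 : twisted (W p) (fvec (ee 0) (ee 2) ^ 1) (fvec (ee 2) (ee 0) ^ 1) -
        twisted (W p) (fvec (ee 2) (ee 0) ^ 1) (fvec (ee 0) (ee 2) ^ 1) =
        ((relChar (W p) 1 * p) * (relChar (W p) 1 * p) : ℂ)⁻¹ • (p : ℂ) •
          fromBerezin (W p) K := by
      rw [e1, e2, ← smul_sub]
      congr 1
      · simp
      · rw [hK, map_sub]
        simp [h00, h22, mul_comm (fvec (ee 2) (ee 0)), smul_sub]
    rw [e3, hT, smul_smul, smul_smul, smul_smul]
    congr 1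
    have ht' : (relChar (W p) 1 : ℂ) ≠ 0 := Complex.ofReal_ne_zero.2 ht
    rw [Complex.ofReal_mul, Complex.ofReal_natCast]
    field_simp
  have h3 := (h2.tendsto_of_smul hK0).const_mul ((integralRadius : ℂ)⁻¹)
  simp only [inv_mul_cancel_left₀ hr, inv_mul_cancel₀ hr] at h3
  simpa using h3.inv₀ one_ne_zero

theorem tendsto_relChar (hW : ∀ p : ℕ, 1 ≤ p → IsSymbolCorrespondence p (W p))
    (hP : IsPoissonType W) (n : ℕ) : Tendsto (fun p => (relChar (W p) n : ℂ)) atTop (𝓝 1) := by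
  have h1 := tendsto_relChar_one hW hP
  induction n with
  | zero =>
    -- For `n = m = 0` the ratio is the inverse of the zeroth scalar.
    have h := (tendsto_relChar_div hW hP 0 0).inv₀ one_ne_zero
    rw [inv_one] at h
    refine h.congr' ?_
    filter_upwards [eventually_ge_atTop 1] with p hp
    have : (relChar (W p) 0 : ℂ) ≠ 0 :=
      Complex.ofReal_ne_zero.2 (relChar_ne_zero (hW p hp) (Nat.zero_le p))
    field_simp
  | succ n ih =>
    have h := (tendsto_relChar_div hW hP n 1).mul (ih.mul h1)
    simp only [one_mul] at h
    refine h.congr' ?_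
    filter_upwards [eventually_ge_atTop 1, eventually_ge_atTop n] with p hp hn
    have t1 : (relChar (W p) 1 : ℂ) ≠ 0 :=
      Complex.ofReal_ne_zero.2 (relChar_ne_zero (hW p hp) hp)
    have tn : (relChar (W p) n : ℂ) ≠ 0 :=
      Complex.ofReal_ne_zero.2 (relChar_ne_zero (hW p hp) hn)
    field_simp

theorem isPoissonType_iff_tendsto (hW : ∀ p : ℕ, 1 ≤ p → IsSymbolCorrespondence p (W p)) :
    IsPoissonType W ↔ ∀ n, Tendsto (fun p => relChar (W p) n) atTop (𝓝 1) := by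
  have hc (n : ℕ) : Tendsto (fun p => (relChar (W p) n : ℂ)) atTop (𝓝 1) ↔
      Tendsto (fun p => relChar (W p) n) atTop (𝓝 1) := by
    rw [← Complex.ofReal_one, Filter.tendsto_ofReal_iff]
  exact ⟨fun h n => (hc n).1 (tendsto_relChar hW h n),
    fun h => isPoissonType_of_tendsto hW fun n => (hc n).2 (h n)⟩

end Ray

end QuarkSystem

end

/-! ### The theorem -/

theorem proposition3p17 :
    -- The Berezin correspondences and their characteristic numbers.
    (∀ p : ℕ, 1 ≤ p → ∃ B : Module.End ℂ (H p) →ₗ[ℂ] PolyOrbit,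
      IsBerezin p B ∧ IsSymbolCorrespondence p B ∧
      ∀ n ≤ p,
        IsCharacteristicNumber p B n √((p.choose n : ℝ) / ((p + n + 2).choose n : ℝ)) ∧
        0 < √((p.choose n : ℝ) / ((p + n + 2).choose n : ℝ))) ∧
    (∀ n : ℕ, (fun p : ℕ => |√((p.choose n : ℝ) / ((p + n + 2).choose n : ℝ)) - 1|)
      =O[Filter.atTop] fun p : ℕ => 1 / (p : ℝ)) ∧
    -- Every ray has characteristic numbers, and they decide whether it is of Poisson type.
    (∀ W : (p : ℕ) → Module.End ℂ (H p) →ₗ[ℂ] PolyOrbit,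
      (∀ p : ℕ, 1 ≤ p → IsSymbolCorrespondence p (W p)) →
      (∀ p : ℕ, 1 ≤ p → ∀ n ≤ p, ∃! c : ℝ, IsCharacteristicNumber p (W p) n c) ∧
      ∀ c : ℕ → ℕ → ℝ,
        (∀ p : ℕ, 1 ≤ p → ∀ n ≤ p, IsCharacteristicNumber p (W p) n (c p n)) →
        (IsPoissonType W ↔
          ∀ n : ℕ, Filter.Tendsto (fun p => c p n) Filter.atTop (nhds 1))) := by
  refine ⟨fun p _ => ⟨berezin p, isBerezin_berezin p, isSymbolCorrespondence_berezin p,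
    fun n hn => ⟨?_, berChar_pos hn⟩⟩, isBigO_berChar_sub_one, fun W hW => ⟨fun p hp n hn => ?_,
      fun c hc => ?_⟩⟩
  · rw [isCharacteristicNumber_iff (isSymbolCorrespondence_berezin p) hn, relChar_berezin hn,
      one_mul, berChar]
  · exact ⟨_, (isCharacteristicNumber_iff (hW p hp) hn _).2 rfl,
      fun c hc => (isCharacteristicNumber_iff (hW p hp) hn c).1 hc⟩
  · rw [isPoissonType_iff_tendsto hW]
    refine forall_congr' fun n => ?_
    -- Since `berChar n p` tends to `1`, the characteristic number and the relative scalar have the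
    -- limit `1` together.
    have he : ∀ᶠ p in Filter.atTop, c p n = relChar (W p) n * berChar n p := by
      filter_upwards [Filter.eventually_ge_atTop 1, Filter.eventually_ge_atTop n] with p hp hn
      exact (isCharacteristicNumber_iff (hW p hp) hn _).1 (hc p hp n hn)
    have hb := tendsto_berChar n
    constructor <;> intro h
    · have := h.mul hb
      rw [one_mul] at this
      exact this.congr' (he.mono fun p hp => hp.symm)
    · have := h.div hb one_ne_zero
      rw [div_one] at this
      refine this.congr' ?_
      filter_upwards [he, Filter.eventually_ge_atTop n] with p hp hn
      rw [Pi.div_apply, hp, mul_div_cancel_right₀ _ (berChar_pos hn).ne']
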